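/- Let $N$ be a squarefree positive integer. Let $\mathrm{Sp}_2(\mathbb R)=\{M\in\mathbb R^{4\times4}: M'JM=J\}$, $J=\begin{pmatrix}0&-E\\E&0\end{pmatrix}$, be the real symplectic group of degree $2$, and let $$\mathbb G=\Big\{\tfrac1{\sqrt m}M\in \mathrm{Sp}_2(\mathbb R)\;:\; M\in\mathbb Z^{4\times 4},\ m\in\mathbb N\Big\}.$$ Let $\Sigma_N$ be the paramodular group, consisting of all matrices in $\mathrm{Sp}_2(\mathbb R)$ of the form $$(\ast)\qquad\begin{pmatrix} a_1&a_2N&b_1&b_2\\ a_3&a_4&b_3&b_4/N\\ c_1&c_2N&d_1&d_2\\ c_3N&c_4N&d_3N&d_4\end{pmatrix},\qquad a_i,b_i,c_i,d_i\in\mathbb Z ,$$ and let $\Sigma_N^*\subseteq\mathbb G$ be the extended paramodular group, generated by $\Sigma_N$ and the matrices $$W_d=\begin{pmatrix}V_d&0\\0&V_d'^{-1}\end{pmatrix},\quad V_d=\tfrac1{\sqrt d}\begin{pmatrix}\alpha d&\beta N\\ \gamma&\delta d\end{pmatrix},\quad \alpha,\beta,\gamma,\delta\in\mathbb Z,\ \det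 V_d=1,\qquad d\mid N .$$ Then $(\Sigma_N^*,\mathbb G)$ is a Hecke pair, i.e. every double coset $\Sigma_N^*g\Sigma_N^*$, $g\in\mathbb G$, is a finite union of right cosets $\Sigma_N^*h$. Let $\mathcal H(\Sigma_N^*,\mathbb G)$ be its Hecke algebra over $\mathbb Z$, i.e. the ring of all finite $\mathbb Z$-linear combinations $\sum_i t_i\,\Sigma_N^*g_i$ of right cosets that are invariant under right multiplication by $\Sigma_N^*$, with the product $\big(\sum_i t_i\Sigma_N^*g_i\big)\big(\sum_j s_j\Sigma_N^*h_j\big)=\sum_{i,j}t_is_j\Sigma_N^*g_ih_j$; a double coset is identified with the sum of the right cosets it contains. For a prime $p$ let $\mathbb G^*_{p}$ be the subgroup of $\mathbb G$ generated by $\Sigma_N^*$ and all $M\in\mathbb G$ such that $\sqrt{p^r}\,M$ has the form $(\ast)$ for some integer $r\ge0$, and let the $p$-primary component $\mathcal H(\Sigma_N^*,\mathbb G^*_{p})\subseteq \mathcal H(\Sigma_N^*,\mathbb G)$ be the subalgebra of the elements all of whose right cosets lie in $\mathbb G^*_{p}$. Put $$\mathcal T^*_{N,1}(p)=\Sigma_N^*\tfrac1{\sqrt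 p}\operatorname{diag}(1,1,p,p)\Sigma_N^*,\qquad \mathcal T^*_{N,2}(p)=\Sigma_N^*\tfrac1p\operatorname{diag}(1,p,p^2,p)\Sigma_N^* .$$ Then the Hecke algebra $\mathcal H(\Sigma_N^*,\mathbb G)$ is commutative and has no zero-divisors. It is the tensor product over $\mathbb Z$ of its primary components $\mathcal H(\Sigma_N^*,\mathbb G^*_{p})$, $p$ prime (that is, for any finitely many distinct primes multiplication maps the tensor product of the corresponding components injectively into $\mathcal H(\Sigma_N^*,\mathbb G)$, and the images of these maps exhaust $\mathcal H(\Sigma_N^*,\mathbb G)$). For every prime $p$ the primary component $\mathcal H(\Sigma_N^*,\mathbb G^*_{p})$ is the polynomial ring over $\mathbb Z$ in the algebraically independent elements $\mathcal T^*_{N,1}(p)$ and $\mathcal T^*_{N,2}(p)$. -/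

import Mathlib

noncomputable section

namespace Hecke

variable {G : Type*} [Group G]

/-- The space `U \ G` of right cosets `U g`. -/
abbrev RightCosets (U : Subgroup G) : Type _ := Quotient (QuotientGroup.rightRel U)

/-- The right coset `U g`. -/
def coset (U : Subgroup G) (g : G) : RightCosets U := Quotient.mk _ g

theorem coset_eq_iff (U : Subgroup G) (g h : G) : coset U g = coset U h ↔ h * g⁻¹ ∈ U := by
  unfold coset
  rw [Quotient.eq, QuotientGroup.rightRel_apply]

theorem coset_out (U : Subgroup G) (c : RightCosets U) : coset U c.out = c := Quotient.out_eq c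

/-- Right multiplication `U g ↦ U g h` on right cosets. -/
def mulRight (U : Subgroup G) (h : G) (c : RightCosets U) : RightCosets U :=
  Quotient.map (fun g : G => g * h) (by
    intro a b hab
    have hab' : b * a⁻¹ ∈ U := QuotientGroup.rightRel_apply.1 hab
    refine QuotientGroup.rightRel_apply.2 ?_
    simpa [mul_assoc] using hab') c

@[simp] theorem mulRight_coset (U : Subgroup G) (h g : G) :
    mulRight U h (coset U g) = coset U (g * h) := rfl

theorem mulRight_mulRight (U : Subgroup G) (h k : G) (c : RightCosets U) :
    mulRight U k (mulRight U h c) = mulRight U (h * k) c := by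
  rw [← coset_out U c]
  simp [mul_assoc]

theorem mulRight_one (U : Subgroup G) (c : RightCosets U) : mulRight U 1 c = c := by
  rw [← coset_out U c]
  simp

/-- Right translation `∑ tᵢ U gᵢ ↦ ∑ tᵢ U gᵢ h` on formal `ℤ`-linear combinations of
right cosets. -/
def translate (U : Subgroup G) (h : G) : (RightCosets U →₀ ℤ) →+ (RightCosets U →₀ ℤ) :=
  Finsupp.mapDomain.addMonoidHom (mulRight U h)

theorem translate_single (U : Subgroup G) (h g : G) (n : ℤ) :
    translate U h (Finsupp.single (coset U g) n) = Finsupp.single (coset U (g * h)) n := by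
  simp [translate, Finsupp.mapDomain_single]

theorem translate_translate (U : Subgroup G) (h k : G) (T : RightCosets U →₀ ℤ) :
    translate U k (translate U h T) = translate U (h * k) T := by
  simp only [translate, Finsupp.mapDomain.addMonoidHom_apply]
  rw [← Finsupp.mapDomain_comp]
  congr 1
  funext c
  exact mulRight_mulRight U h k c

/-- The underlying group of the Hecke algebra `ℋ(U, G)` over `ℤ`: the formal finite `ℤ`-linear
combinations of right cosets `U g` that are invariant under right multiplication by `U`. If
`(U, G)` is a Hecke pair, the double cosets `U g U`, read as the sums of the right cosets which
they contain, form a `ℤ`-basis. -/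
def heckeAddSubgroup (U : Subgroup G) : AddSubgroup (RightCosets U →₀ ℤ) where
  carrier := {T | ∀ u ∈ U, translate U u T = T}
  zero_mem' := fun u _ => map_zero _
  add_mem' := fun ha hb u hu => by rw [map_add, ha u hu, hb u hu]
  neg_mem' := fun ha u hu => by rw [map_neg, ha u hu]

/-- The Hecke algebra `ℋ(U, G)` over `ℤ`. -/
def HeckeAlgebra (U : Subgroup G) : Type _ := heckeAddSubgroup U

namespace HeckeAlgebra

variable {U : Subgroup G}

instance : AddCommGroup (HeckeAlgebra U) := inferInstanceAs (AddCommGroup (heckeAddSubgroup U))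

/-- The expansion of an element of the Hecke algebra as a combination of right cosets. -/
def expansion : HeckeAlgebra U →+ (RightCosets U →₀ ℤ) := (heckeAddSubgroup U).subtype

theorem expansion_injective : Function.Injective (expansion (U := U)) := Subtype.val_injective

/-- The element of the Hecke algebra given by an invariant combination of right cosets. -/
def mk (x : RightCosets U →₀ ℤ) (hx : ∀ u ∈ U, translate U u x = x) : HeckeAlgebra U := ⟨x, hx⟩

@[simp] theorem expansion_mk (x : RightCosets U →₀ ℤ) (hx : ∀ u ∈ U, translate U u x = x) :
    expansion (mk x hx) = x := rfl

theorem translate_expansion (T : HeckeAlgebra U) {u : G} (hu : u ∈ U) :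
    translate U u (expansion T) = expansion T := T.2 u hu

/-- The product with `T = ∑ tᵢ U gᵢ` on the left,
`∑ sⱼ U hⱼ ↦ ∑ tᵢ sⱼ U gᵢ hⱼ`. -/
def act (T : HeckeAlgebra U) : (RightCosets U →₀ ℤ) →+ (RightCosets U →₀ ℤ) :=
  Finsupp.liftAddHom fun c : RightCosets U =>
    zmultiplesHom (RightCosets U →₀ ℤ) (translate U c.out (expansion T))

theorem act_coset (T : HeckeAlgebra U) (g : G) (n : ℤ) :
    act T (Finsupp.single (coset U g) n) = n • translate U g (expansion T) := by
  have h : translate U (coset U g).out (expansion T) = translate U g (expansion T) := by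
    have hu : (coset U g).out * g⁻¹ ∈ U := (coset_eq_iff U _ _).1 (coset_out U (coset U g)).symm
    calc translate U (coset U g).out (expansion T)
        = translate U g (translate U ((coset U g).out * g⁻¹) (expansion T)) := by
          rw [translate_translate]; simp
      _ = _ := by rw [translate_expansion T hu]
  simp [act, h]

theorem hom_ext' {A : Type*} [AddCommGroup A] {f f' : (RightCosets U →₀ ℤ) →+ A}
    (h : ∀ g n, f (Finsupp.single (coset U g) n) = f' (Finsupp.single (coset U g) n)) :
    f = f' := by
  refine Finsupp.addHom_ext fun c n => ?_
  rw [← coset_out U c]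
  exact h _ n

theorem act_translate (T : HeckeAlgebra U) (h : G) (x : RightCosets U →₀ ℤ) :
    act T (translate U h x) = translate U h (act T x) := by
  have : (act T).comp (translate U h) = (translate U h).comp (act T) := by
    refine hom_ext' fun g n => ?_
    simp [translate_single, act_coset, translate_translate, map_zsmul]
  exact DFunLike.congr_fun this x

instance : One (HeckeAlgebra U) :=
  ⟨mk (Finsupp.single (coset U 1) 1) fun u hu => by
    rw [translate_single]
    congr 1
    rw [coset_eq_iff]
    simpa using U.inv_mem hu⟩

/-- The product `(∑ tᵢ U gᵢ) (∑ sⱼ U hⱼ) = ∑ tᵢ sⱼ U gᵢ hⱼ`. -/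
instance : Mul (HeckeAlgebra U) :=
  ⟨fun T S => mk (act T (expansion S)) fun u hu => by
    rw [← act_translate, translate_expansion S hu]⟩

theorem expansion_one : expansion (1 : HeckeAlgebra U) = Finsupp.single (coset U 1) 1 := rfl

theorem expansion_mul (T S : HeckeAlgebra U) : expansion (T * S) = act T (expansion S) := rfl

theorem act_one (T : HeckeAlgebra U) : act T (expansion 1) = expansion T := by
  rw [expansion_one, act_coset]
  have := translate_expansion T U.one_mem
  rw [this, one_smul]

theorem act_mul (T S : HeckeAlgebra U) (x : RightCosets U →₀ ℤ) :
    act (T * S) x = act T (act S x) := by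
  have : act (T * S) = (act T).comp (act S) := by
    refine hom_ext' fun g n => ?_
    simp [act_coset, map_zsmul, act_translate, expansion_mul]
  exact DFunLike.congr_fun this x

theorem act_add (T S : HeckeAlgebra U) (x : RightCosets U →₀ ℤ) :
    act (T + S) x = act T x + act S x := by
  have : act (T + S) = act T + act S := by
    refine hom_ext' fun g n => ?_
    simp [act_coset, map_add]
  exact DFunLike.congr_fun this x

theorem one_act (x : RightCosets U →₀ ℤ) : act (1 : HeckeAlgebra U) x = x := by
  have : act (1 : HeckeAlgebra U) = AddMonoidHom.id _ := by
    refine hom_ext' fun g n => ?_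
    simp [act_coset, expansion_one, translate_single]
  exact DFunLike.congr_fun this x

instance : Ring (HeckeAlgebra U) where
  __ := (inferInstance : AddCommGroup (HeckeAlgebra U))
  one := 1
  mul := (· * ·)
  mul_assoc a b c := expansion_injective (by
    show expansion (a * b * c) = expansion (a * (b * c))
    rw [expansion_mul, act_mul, expansion_mul, expansion_mul])
  one_mul a := expansion_injective (one_act _)
  mul_one a := expansion_injective (act_one a)
  left_distrib a b c := expansion_injective (by
    show expansion (a * (b + c)) = expansion (a * b + a * c)
    rw [map_add, expansion_mul, map_add, map_add]; rfl)
  right_distrib a b c := expansion_injective (by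
    show expansion ((a + b) * c) = expansion (a * c + b * c)
    rw [map_add, expansion_mul, act_add]; rfl)
  zero_mul a := expansion_injective (by
    show expansion ((0 : HeckeAlgebra U) * a) = expansion 0
    have h := act_add (0 : HeckeAlgebra U) 0 (expansion a)
    rw [add_zero] at h
    rw [expansion_mul, map_zero]
    exact left_eq_add.1 h)
  mul_zero a := expansion_injective (map_zero (act a))

end HeckeAlgebra

/-- The set of right cosets contained in the double coset `U g U`. -/
def cosetsIn (U : Subgroup G) (g : G) : Set (RightCosets U) := {c | ∃ u ∈ U, c = coset U (g * u)}

/-- `(U, G)` is a Hecke pair: every double coset `U g U` decomposes into finitely many right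
cosets. -/
def IsHeckePair (U : Subgroup G) : Prop := ∀ g : G, (cosetsIn U g).Finite

theorem image_cosetsIn (U : Subgroup G) (g : G) {u : G} (hu : u ∈ U) :
    mulRight U u '' cosetsIn U g = cosetsIn U g := by
  ext c
  constructor
  · rintro ⟨_, ⟨v, hv, rfl⟩, rfl⟩
    exact ⟨v * u, U.mul_mem hv hu, by simp [mul_assoc]⟩
  · rintro ⟨v, hv, rfl⟩
    exact ⟨_, ⟨v * u⁻¹, U.mul_mem hv (U.inv_mem hu), rfl⟩, by simp [mul_assoc]⟩

theorem translate_sum_cosetsIn (U : Subgroup G) (g : G) (h : (cosetsIn U g).Finite) {u : G}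
    (hu : u ∈ U) :
    translate U u (∑ c ∈ h.toFinset, Finsupp.single c 1) =
      ∑ c ∈ h.toFinset, Finsupp.single c 1 := by
  classical
  have hinj : Function.Injective (mulRight U u) := fun a b hab => by
    have := congrArg (mulRight U u⁻¹) hab
    simpa [mulRight_mulRight, mulRight_one] using this
  have himg : h.toFinset.image (mulRight U u) = h.toFinset := by
    apply Finset.coe_injective
    simpa using image_cosetsIn U g hu
  conv_rhs => rw [← himg]
  rw [Finset.sum_image fun a _ b _ hab => hinj hab, map_sum]
  refine Finset.sum_congr rfl fun c _ => ?_
  simp [translate, Finsupp.mapDomain_single]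

open Classical in
/-- The double coset `U g U` as an element of the Hecke algebra: the sum of the right cosets
contained in it (`0` by convention if there are infinitely many, which cannot occur for a Hecke
pair). -/
def doubleCoset (U : Subgroup G) (g : G) : HeckeAlgebra U :=
  if h : (cosetsIn U g).Finite then
    HeckeAlgebra.mk (∑ c ∈ h.toFinset, Finsupp.single c 1)
      fun _ hu => translate_sum_cosetsIn U g h hu
  else 0

theorem expansion_doubleCoset (U : Subgroup G) (g : G) (h : (cosetsIn U g).Finite) :
    HeckeAlgebra.expansion (doubleCoset U g) = ∑ c ∈ h.toFinset, Finsupp.single c 1 := by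
  rw [doubleCoset, dif_pos h, HeckeAlgebra.expansion_mk]

/-- For a subgroup `U ≤ P ≤ G`, the Hecke algebra `ℋ(U, P)` as a subalgebra of `ℋ(U, G)`: the
elements all of whose right cosets lie in `P`. -/
def heckeSubalgebra (U P : Subgroup G) (hUP : U ≤ P) : Subalgebra ℤ (HeckeAlgebra U) :=
  subalgebraOfSubring
  { carrier := {T | ∀ g : G, HeckeAlgebra.expansion T (coset U g) ≠ 0 → g ∈ P}
    zero_mem' := fun g hg => absurd rfl hg
    one_mem' := fun g hg => by
      rw [HeckeAlgebra.expansion_one] at hg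
      have h : coset U 1 = coset U g := by
        by_contra hne
        exact hg (Finsupp.single_eq_of_ne (Ne.symm hne))
      exact hUP (by simpa using (coset_eq_iff U 1 g).1 h)
    add_mem' := fun {a b} ha hb g hg => by
      by_contra hgP
      apply hg
      rw [map_add, Finsupp.add_apply, not_not.1 (mt (ha g) hgP), not_not.1 (mt (hb g) hgP),
        add_zero]
    neg_mem' := fun {a} ha g hg => ha g fun h0 => hg (by
      rw [map_neg, Finsupp.neg_apply, h0, neg_zero])
    mul_mem' := fun {a b} ha hb g hg => by
      classical
      by_contra hgP
      apply hg
      rw [HeckeAlgebra.expansion_mul,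
        ← Finsupp.sum_single (HeckeAlgebra.expansion b), Finsupp.sum, map_sum,
        Finsupp.finsetSum_apply]
      refine Finset.sum_eq_zero fun c hc => ?_
      have hcP : c.out ∈ P := hb _ (by
        rw [coset_out]
        exact Finsupp.mem_support_iff.1 hc)
      rw [← coset_out U c, HeckeAlgebra.act_coset, coset_out]
      have hz : translate U c.out (HeckeAlgebra.expansion a) (coset U g) = 0 := by
        by_contra hne
        have hmem := Finsupp.mapDomain_support (Finsupp.mem_support_iff.2 hne)
        obtain ⟨e, he, hec⟩ := Finset.mem_image.1 hmem
        have heP : e.out ∈ P := ha _ (by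
          rw [coset_out]
          exact Finsupp.mem_support_iff.1 he)
        rw [← coset_out U e, mulRight_coset, coset_eq_iff] at hec
        apply hgP
        have := P.mul_mem (hUP hec) (P.mul_mem heP hcP)
        rwa [inv_mul_cancel_right] at this
      rw [Finsupp.smul_apply, hz, smul_zero] }

end Hecke

section TensorProduct

open scoped TensorProduct

/-- The multiplication map `⨂ᵢ Bᵢ → A`, `⨂ᵢ bᵢ ↦ b₀ b₁ ⋯ bₙ₋₁`, of a finite sequence of
subalgebras of `A`. -/
def tensorMulMap {R A : Type*} [CommRing R] [Ring A] [Algebra R A] {n : ℕ}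
    (B : Fin n → Subalgebra R A) : (⨂[R] i, B i) →ₗ[R] A :=
  PiTensorProduct.lift
    ((MultilinearMap.mkPiAlgebraFin R n A).compLinearMap fun i => (B i).val.toLinearMap)

/-- `A` is the tensor product of the family `C` of subalgebras, in the sense of the (restricted)
tensor product of algebras over a possibly infinite index set, i.e. of the direct limit of the
tensor products of finitely many members: different members commute elementwise, the multiplication
map of every finite selection of different members is injective, and the images of these maps
exhaust `A`. -/
structure IsInternalTensorProduct {R A ι : Type*} [CommRing R] [Ring A] [Algebra R A]
    (C : ι → Subalgebra R A) : Prop where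
  commute : ∀ i j, i ≠ j → ∀ a ∈ C i, ∀ b ∈ C j, a * b = b * a
  injective : ∀ (n : ℕ) (s : Fin n → ι), Function.Injective s →
    Function.Injective (tensorMulMap fun k => C (s k))
  exhaust : ∀ a : A, ∃ (n : ℕ) (s : Fin n → ι), Function.Injective s ∧
    a ∈ LinearMap.range (tensorMulMap fun k => C (s k))

end TensorProduct

namespace Paramodular

open Matrix

/-- Real `4 × 4` matrices, written in blocks of size `2 × 2`. -/
abbrev Mat4 : Type := Matrix (Fin 2 ⊕ Fin 2) (Fin 2 ⊕ Fin 2) ℝ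

/-- The real symplectic group `Sp₂(ℝ)` of degree `2`. -/
abbrev Sp2 : Type := symplecticGroup (Fin 2) ℝ

/-- The matrix has integral entries. -/
def IsIntegral (M : Mat4) : Prop :=
  ∃ A : Matrix (Fin 2 ⊕ Fin 2) (Fin 2 ⊕ Fin 2) ℤ, M = A.map (fun z : ℤ => (z : ℝ))

theorem IsIntegral.mul {A B : Mat4} (hA : IsIntegral A) (hB : IsIntegral B) :
    IsIntegral (A * B) := by
  obtain ⟨A, rfl⟩ := hA
  obtain ⟨B, rfl⟩ := hB
  exact ⟨A * B, (Matrix.map_mul (f := Int.castRingHom ℝ)).symm⟩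

/-- The group `𝔾` of all `M ∈ Sp₂(ℝ)` of the form `(1 / √m) A` with `A` integral and `m` a
positive integer. -/
def bigG : Subgroup Sp2 where
  carrier := {M | ∃ m : ℕ, 0 < m ∧ IsIntegral (Real.sqrt m • (M : Mat4))}
  one_mem' := ⟨1, one_pos, 1, by
    ext i j
    simp [Matrix.one_apply]⟩
  mul_mem' := by
    rintro A B ⟨m, hm, hA⟩ ⟨n, hn, hB⟩
    refine ⟨m * n, Nat.mul_pos hm hn, ?_⟩
    have h := hA.mul hB
    rwa [Matrix.smul_mul, Matrix.mul_smul, smul_smul, ← Real.sqrt_mul (Nat.cast_nonneg m),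
      ← Nat.cast_mul] at h
  inv_mem' := by
    rintro A ⟨m, hm, B, hB⟩
    refine ⟨m, hm, (-J (Fin 2) ℤ) * Bᵀ * J (Fin 2) ℤ, ?_⟩
    have hJ : (J (Fin 2) ℤ).map (fun z : ℤ => (z : ℝ)) = J (Fin 2) ℝ :=
      Matrix.map_J (Fin 2) (Int.castRingHom ℝ)
    have hT : Bᵀ.map (fun z : ℤ => (z : ℝ)) = Real.sqrt m • (A : Mat4)ᵀ := by
      rw [Matrix.transpose_map, ← hB, Matrix.transpose_smul]
    have e1 : ((-J (Fin 2) ℤ) * Bᵀ * J (Fin 2) ℤ).map (fun z : ℤ => (z : ℝ)) =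
        (-J (Fin 2) ℤ).map (fun z : ℤ => (z : ℝ)) * Bᵀ.map (fun z : ℤ => (z : ℝ)) *
          (J (Fin 2) ℤ).map (fun z : ℤ => (z : ℝ)) := by
      have h1 := Matrix.map_mul (f := Int.castRingHom ℝ) (L := (-J (Fin 2) ℤ) * Bᵀ)
        (M := J (Fin 2) ℤ)
      have h2 := Matrix.map_mul (f := Int.castRingHom ℝ) (L := -J (Fin 2) ℤ) (M := Bᵀ)
      rw [h2] at h1
      exact h1
    have e2 : (-J (Fin 2) ℤ).map (fun z : ℤ => (z : ℝ)) = -J (Fin 2) ℝ := by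
      rw [← hJ]
      ext i j
      simp
    rw [e1, e2, hJ, hT, SymplecticGroup.coe_inv]
    simp

/-- The matrix has the shape of the elements of the paramodular group of level `N`. -/
def HasParamodularForm (N : ℕ) (M : Mat4) : Prop :=
  ∃ a₁ a₂ a₃ a₄ b₁ b₂ b₃ b₄ c₁ c₂ c₃ c₄ d₁ d₂ d₃ d₄ : ℤ,
    M = Matrix.fromBlocks
      !![(a₁ : ℝ), a₂ * N; a₃, a₄]
      !![(b₁ : ℝ), b₂; b₃, b₄ / N]
      !![(c₁ : ℝ), c₂ * N; c₃ * N, c₄ * N]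
      !![(d₁ : ℝ), d₂; d₃ * N, d₄]

/-- The paramodular group `Σ_N`, as a set. -/
def paramodular (N : ℕ) : Set Sp2 := {M | HasParamodularForm N (M : Mat4)}

/-- The matrices `W_d = diag(V_d, (V_d')⁻¹)`, `d ∣ N`, for all admissible choices of
`V_d = (1 / √d) (α d, β N; γ, δ d)` of determinant `1`. -/
def atkinLehner (N : ℕ) : Set Sp2 :=
  {M | ∃ (d : ℕ) (α β γ δ : ℤ) (V : Matrix (Fin 2) (Fin 2) ℝ), d ∣ N ∧
    V = (1 / Real.sqrt d) • !![(α : ℝ) * d, β * N; γ, δ * d] ∧ V.det = 1 ∧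
    (M : Mat4) = Matrix.fromBlocks V 0 0 (Vᵀ)⁻¹}

/-- The extended paramodular group `Σ*_N`, generated by `Σ_N` and the `W_d`, `d ∣ N`. -/
def extendedParamodular (N : ℕ) : Subgroup Sp2 :=
  Subgroup.closure (paramodular N ∪ atkinLehner N)

theorem extendedParamodular_le_bigG {N : ℕ} (hN : N ≠ 0) : extendedParamodular N ≤ bigG := by
  have hN' : (N : ℝ) ≠ 0 := Nat.cast_ne_zero.2 hN
  refine (Subgroup.closure_le _).2 ?_
  rintro M (⟨a₁, a₂, a₃, a₄, b₁, b₂, b₃, b₄, c₁, c₂, c₃, c₄, d₁, d₂, d₃, d₄, hM⟩ |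
    ⟨d, α, β, γ, δ, V, hd, rfl, hdet, hM⟩)
  · refine ⟨N ^ 2, by positivity, Matrix.fromBlocks
      !![N * a₁, N * (a₂ * N); N * a₃, N * a₄] !![N * b₁, N * b₂; N * b₃, b₄]
      !![N * c₁, N * (c₂ * N); N * (c₃ * N), N * (c₄ * N)]
      !![N * d₁, N * d₂; N * (d₃ * N), N * d₄], ?_⟩
    rw [hM, Nat.cast_pow, Real.sqrt_sq (Nat.cast_nonneg N)]
    ext i j
    rcases i with i | i <;> rcases j with j | j <;> fin_cases i <;> fin_cases j <;>
      simp
    field_simp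
  · have hd0 : 0 < d := Nat.pos_of_dvd_of_pos hd (Nat.pos_of_ne_zero hN)
    have hs : Real.sqrt d ≠ 0 := Real.sqrt_ne_zero'.2 (by exact_mod_cast hd0)
    refine ⟨d, hd0, Matrix.fromBlocks !![α * d, β * N; γ, δ * d] 0 0
      !![δ * d, -γ; -(β * N), α * d], ?_⟩
    rw [hM, Matrix.inv_def, Matrix.det_transpose, hdet]
    ext i j
    rcases i with i | i <;> rcases j with j | j <;> fin_cases i <;> fin_cases j <;>
      simp [Matrix.adjugate_fin_two, hs]

/-- `Σ*_N` as a subgroup of `𝔾`. -/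
abbrev SigmaStar (N : ℕ) : Subgroup bigG := (extendedParamodular N).subgroupOf bigG

/-- The matrix `(1 / √m) diag(a₁, a₂, d₁, d₂)` with `a₁ d₁ = a₂ d₂ = m`, as an element of `𝔾`. -/
def diagElement (m : ℕ) (hm : 0 < m) (a d : Fin 2 → ℤ) (h : ∀ i, a i * d i = m) : bigG :=
  ⟨⟨(1 / Real.sqrt m) • Matrix.fromBlocks (Matrix.diagonal fun i => (a i : ℝ)) 0 0
      (Matrix.diagonal fun i => (d i : ℝ)), by
    have hs : Real.sqrt m * Real.sqrt m = m := Real.mul_self_sqrt (Nat.cast_nonneg m)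
    have hm0 : (m : ℝ) ≠ 0 := by exact_mod_cast hm.ne'
    have hs0 : Real.sqrt m ≠ 0 := fun h0 => hm0 (by rw [← hs, h0, zero_mul])
    have hc : (1 / Real.sqrt m) * (1 / Real.sqrt m) * m = 1 := by
      field_simp
      rw [sq, hs]
    have h1 : (fun i => (a i : ℝ) * (d i : ℝ)) = fun _ => (m : ℝ) := by
      funext i
      exact_mod_cast h i
    have h2 : (fun i => (d i : ℝ) * (a i : ℝ)) = fun _ => (m : ℝ) := by
      rw [← h1]
      funext i
      exact mul_comm _ _
    rw [SymplecticGroup.mem_iff, J, Matrix.transpose_smul, Matrix.smul_mul, Matrix.smul_mul,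
      Matrix.mul_smul, smul_smul, Matrix.fromBlocks_transpose, Matrix.fromBlocks_multiply,
      Matrix.fromBlocks_multiply, Matrix.fromBlocks_smul]
    simp only [Matrix.transpose_zero, Matrix.diagonal_transpose, Matrix.mul_zero, Matrix.zero_mul,
      Matrix.mul_one, Matrix.mul_neg, Matrix.neg_mul, zero_add, add_zero, neg_zero, smul_zero,
      smul_neg, Matrix.diagonal_mul_diagonal, h1, h2]
    have h3 : ((1 / Real.sqrt m) * (1 / Real.sqrt m)) • Matrix.diagonal (fun _ : Fin 2 => (m : ℝ))
        = 1 := by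
      rw [← Matrix.diagonal_smul]
      simp only [Pi.smul_def, smul_eq_mul, hc]
      exact Matrix.diagonal_one
    rw [h3]⟩,
   ⟨m, hm, Matrix.fromBlocks (Matrix.diagonal a) 0 0 (Matrix.diagonal d), by
    have hs0 : Real.sqrt m ≠ 0 := Real.sqrt_ne_zero'.2 (by exact_mod_cast hm)
    rw [smul_smul, mul_one_div_cancel hs0, one_smul, Matrix.fromBlocks_map,
      Matrix.diagonal_map (by simp), Matrix.diagonal_map (by simp)]
    simp⟩⟩

/-- The Hecke algebra `ℋ(Σ*_N, 𝔾)` over `ℤ`. -/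
abbrev HeckeAlg (N : ℕ) : Type := Hecke.HeckeAlgebra (SigmaStar N)

/-- The double coset `T*_{N,1}(p) = Σ*_N (1 / √p) diag(1, 1, p, p) Σ*_N`. -/
def T1 (N : ℕ) (p : Nat.Primes) : HeckeAlg N :=
  Hecke.doubleCoset (SigmaStar N)
    (diagElement p p.2.pos ![1, 1] ![(p : ℕ), (p : ℕ)] (by
      intro i
      fin_cases i <;> simp))

/-- The double coset `T*_{N,2}(p) = Σ*_N (1 / p) diag(1, p, p², p) Σ*_N`. -/
def T2 (N : ℕ) (p : Nat.Primes) : HeckeAlg N :=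
  Hecke.doubleCoset (SigmaStar N)
    (diagElement ((p : ℕ) ^ 2) (pow_pos p.2.pos 2) ![1, (p : ℕ)] ![(p : ℕ) ^ 2, (p : ℕ)] (by
      intro i
      fin_cases i <;> simp [sq]))

/-- The `p`-primary part of `𝔾` with respect to `Σ*_N`: the subgroup generated by `Σ*_N` and all
`M ∈ 𝔾` for which some `√(p ^ r) M` has the shape of the elements of `Σ_N`. -/
def primaryGroup (N : ℕ) (p : Nat.Primes) : Subgroup bigG :=
  SigmaStar N ⊔ Subgroup.closure
    {M : bigG | ∃ r : ℕ, HasParamodularForm N (Real.sqrt ((p : ℕ) ^ r : ℕ) • ((M : Sp2) : Mat4))}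

/-- The `p`-primary component of `ℋ(Σ*_N, 𝔾)`. -/
def primaryComponent (N : ℕ) (p : Nat.Primes) : Subalgebra ℤ (HeckeAlg N) :=
  Hecke.heckeSubalgebra (SigmaStar N) (primaryGroup N p) le_sup_left

end Paramodular

end

/-!
Denote by `d(g)` the least denominator of the conjugation `X ↦ g X g⁻¹`, `g ∈ 𝔾`, on the order of
all matrices of paramodular shape, and by `d'(g)` its least denominator on the matrices in this
order which are fixed by the symplectic adjoint. Conjugation with `Σ*_N` preserves the order, so `d`
and `d'` are constant on double cosets. Conversely `Σ*_N` contains every `g ∈ 𝔾` with `d(g) = 1`,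
and as only finitely many conjugations are distinct modulo a given integer, double cosets are finite
unions of right cosets. Row and column operations in `Σ*_N`, among them the Atkin-Lehner matrices,
of which there are enough because `N` is squarefree, reduce every double coset to a representative
`D_{s,k} = (1/√m) diag(1, k, m, s k)`, `m = s k²`. Here `d = s k²` and `d' = s k` determine `s`
and `k`.

Double cosets are closed under inversion, hence the anti-automorphism of the Hecke algebra that
inversion induces is the identity, and the algebra is commutative. Denominators are
submultiplicative, so in the product of two Hecke operators with leading terms `D_{s,k}` and
`D_{t,l}` only double cosets occur for which `d` and `d'` divide their values at `D_{st,kl}`, and a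
triangular matrix argument shows that `D_{st,kl}` itself occurs with coefficient one. The leading
terms of `T*_{N,1}(p)` and `T*_{N,2}(p)` are `D_{p,1}` and `D_{1,p}`. By unique factorization of `s`
and `k` the monomials in these elements are therefore unitriangular with respect to the double
cosets, and the Hecke algebra is the polynomial ring in them.
-/

noncomputable section

/-! ### Hecke algebras and bases of monomials -/

namespace Hecke

variable {G : Type*} [Group G] {U : Subgroup G}

theorem coset_mul_left {u : G} (hu : u ∈ U) (g : G) : coset U (u * g) = coset U g := by
  rw [coset_eq_iff]
  simpa using U.inv_mem hu

theorem exists_eq_mul_of_coset_eq {g h : G} (hgh : coset U g = coset U h) :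
    ∃ u ∈ U, g = u * h :=
  ⟨g * h⁻¹, (coset_eq_iff U h g).1 hgh.symm, by group⟩

/-- Right multiplication with a fixed group element as a permutation of the right cosets. -/
def mulRightEquiv (h : G) : RightCosets U ≃ RightCosets U where
  toFun := mulRight U h
  invFun := mulRight U h⁻¹
  left_inv c := by simp [mulRight_mulRight, mulRight_one]
  right_inv c := by simp [mulRight_mulRight, mulRight_one]

theorem translate_apply_coset (h k : G) (x : RightCosets U →₀ ℤ) :
    translate U h x (coset U k) = x (coset U (k * h⁻¹)) := by
  have hx := Finsupp.mapDomain_apply (mulRightEquiv (U := U) h).injective x (coset U (k * h⁻¹))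
  rwa [show mulRightEquiv h (coset U (k * h⁻¹)) = coset U (k * h⁻¹ * h) from rfl,
    inv_mul_cancel_right] at hx

/-- The coefficient of the right coset `U g` in an element of the Hecke algebra. It is a function of
the representative `g`, so that invariance under `U` on both sides can be expressed in the group. -/
def coeff (g : G) : HeckeAlgebra U →+ ℤ :=
  (Finsupp.applyAddHom (coset U g)).comp HeckeAlgebra.expansion

theorem coeff_apply (T : HeckeAlgebra U) (g : G) :
    coeff g T = HeckeAlgebra.expansion T (coset U g) := rfl

theorem coeff_out (T : HeckeAlgebra U) (c : RightCosets U) :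
    coeff c.out T = HeckeAlgebra.expansion T c := by
  rw [coeff_apply, coset_out]

theorem coeff_mem_mul (T : HeckeAlgebra U) {u : G} (hu : u ∈ U) (g : G) :
    coeff (u * g) T = coeff g T := by
  rw [coeff_apply, coset_mul_left hu, coeff_apply]

theorem coeff_mul_mem (T : HeckeAlgebra U) {u : G} (hu : u ∈ U) (g : G) :
    coeff (g * u) T = coeff g T := by
  rw [coeff_apply, ← HeckeAlgebra.translate_expansion T hu, translate_apply_coset,
    mul_inv_cancel_right, coeff_apply]

theorem ext_coeff {T S : HeckeAlgebra U} (h : ∀ g, coeff g T = coeff g S) : T = S :=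
  HeckeAlgebra.expansion_injective (Finsupp.ext fun c => by rw [← coeff_out, ← coeff_out, h])

theorem coeff_one [DecidablePred (· ∈ U)] (g : G) :
    coeff g (1 : HeckeAlgebra U) = if g ∈ U then 1 else 0 := by
  classical
  have hg : coset U 1 = coset U g ↔ g ∈ U := by simp [coset_eq_iff]
  simp only [coeff_apply, HeckeAlgebra.expansion_one, Finsupp.single_apply, hg]

theorem coeff_mul_eq_sum (T S : HeckeAlgebra U) (k : G) :
    coeff k (T * S) =
      ∑ c ∈ (HeckeAlgebra.expansion S).support, coeff c.out S * coeff (k * c.out⁻¹) T := by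
  rw [coeff_apply, HeckeAlgebra.expansion_mul]
  conv_lhs => rw [← Finsupp.sum_single (HeckeAlgebra.expansion S), Finsupp.sum, map_sum,
    Finsupp.finsetSum_apply]
  refine Finset.sum_congr rfl fun c _ => ?_
  conv_lhs => rw [← coset_out U c]
  rw [HeckeAlgebra.act_coset, Finsupp.smul_apply, translate_apply_coset, smul_eq_mul, coeff_apply,
    coeff_apply]

theorem coeff_mul_eq_finsum (T S : HeckeAlgebra U) (k : G) :
    coeff k (T * S) = ∑ᶠ c : RightCosets U, coeff c.out S * coeff (k * c.out⁻¹) T := by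
  rw [coeff_mul_eq_sum, finsum_eq_sum_of_support_subset]
  intro c hc
  rw [Finset.mem_coe, Finsupp.mem_support_iff, ← coeff_out]
  exact left_ne_zero_of_mul hc

theorem coeff_mul_coeff_congr (T S : HeckeAlgebra U) (k : G) {g g' : G}
    (h : coset U g = coset U g') :
    coeff g S * coeff (k * g⁻¹) T = coeff g' S * coeff (k * g'⁻¹) T := by
  obtain ⟨u, hu, rfl⟩ := exists_eq_mul_of_coset_eq h
  rw [mul_inv_rev, ← mul_assoc, coeff_mem_mul S hu, coeff_mul_mem T (U.inv_mem hu)]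

theorem coeff_mul_of_unique_factorization (T S : HeckeAlgebra U) (k h : G)
    (huniq : ∀ h', coeff h' S ≠ 0 → coeff (k * h'⁻¹) T ≠ 0 → h' * h⁻¹ ∈ U) :
    coeff k (T * S) = coeff h S * coeff (k * h⁻¹) T := by
  rw [coeff_mul_eq_finsum, finsum_eq_single _ (coset U h)]
  · exact coeff_mul_coeff_congr T S k (coset_out U _)
  · intro c hne
    by_contra h0
    obtain ⟨hS, hT⟩ := mul_ne_zero_iff.1 h0
    apply hne
    rw [← coset_out U c, eq_comm, coset_eq_iff]
    exact huniq _ hS hT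

theorem exists_coeff_ne_zero_of_coeff_mul_ne_zero {T S : HeckeAlgebra U} {k : G}
    (h : coeff k (T * S) ≠ 0) : ∃ h', coeff h' S ≠ 0 ∧ coeff (k * h'⁻¹) T ≠ 0 := by
  rw [coeff_mul_eq_sum] at h
  obtain ⟨c, -, hc⟩ := Finset.exists_ne_zero_of_sum_ne_zero h
  exact ⟨c.out, mul_ne_zero_iff.1 hc⟩

theorem mul_comm_of_inv_mem_doubleCoset (hinv : ∀ g : G, ∃ u ∈ U, ∃ v ∈ U, g⁻¹ = u * g * v)
    (T S : HeckeAlgebra U) : T * S = S * T := by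
  have coeff_inv (A : HeckeAlgebra U) (g : G) : coeff g⁻¹ A = coeff g A := by
    obtain ⟨u, hu, v, hv, h⟩ := hinv g
    rw [h, coeff_mul_mem A hv, coeff_mem_mul A hu]
  refine ext_coeff fun k => ?_
  rw [← coeff_inv (S * T) k, coeff_mul_eq_finsum, coeff_mul_eq_finsum,
    ← finsum_comp_equiv (mulRightEquiv k)]
  refine finsum_congr fun c => ?_
  have hc : coset U (mulRightEquiv k c).out = coset U (c.out * k) := by
    rw [coset_out, ← mulRight_coset, coset_out]
    rfl
  rw [coeff_mul_coeff_congr T S k hc, mul_inv_rev, mul_inv_cancel_left, coeff_inv T,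
    ← coeff_inv S, mul_inv_rev, mul_comm]

open Classical in
theorem coeff_doubleCoset (hU : IsHeckePair U) (g h : G) :
    coeff h (doubleCoset U g) = if ∃ u ∈ U, ∃ v ∈ U, h = u * g * v then 1 else 0 := by
  have hmem : coset U h ∈ (hU g).toFinset ↔ ∃ u ∈ U, ∃ v ∈ U, h = u * g * v := by
    rw [Set.Finite.mem_toFinset]
    constructor
    · rintro ⟨v, hv, hc⟩
      obtain ⟨u, hu, rfl⟩ := exists_eq_mul_of_coset_eq hc
      exact ⟨u, hu, v, hv, (mul_assoc _ _ _).symm⟩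
    · rintro ⟨u, hu, v, hv, rfl⟩
      exact ⟨v, hv, by rw [mul_assoc, coset_mul_left hu]⟩
  rw [coeff_apply, expansion_doubleCoset U g (hU g), Finsupp.finsetSum_apply]
  simp only [Finsupp.single_apply, Finset.sum_ite_eq', hmem]

theorem mem_heckeSubalgebra {P : Subgroup G} (hUP : U ≤ P) (T : HeckeAlgebra U) :
    T ∈ heckeSubalgebra U P hUP ↔ ∀ g, coeff g T ≠ 0 → g ∈ P := Iff.rfl

theorem finite_coeff_ne_zero (T : HeckeAlgebra U) {I : Type*} (D : I → G)
    (hD : Function.Injective fun i => coset U (D i)) : {i | coeff (D i) T ≠ 0}.Finite := by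
  refine Set.Finite.of_finite_image (f := fun i => coset U (D i))
    ((HeckeAlgebra.expansion T).support.finite_toSet.subset ?_) hD.injOn
  rintro _ ⟨i, hi, rfl⟩
  exact Finsupp.mem_support_iff.2 hi

end Hecke

section Unitriangular

variable {R A I α : Type*} [Ring R] [AddCommGroup A] [Module R A] [LinearOrder α]

/-- The family `M` is unitriangular with respect to the coordinates `ε`, where the indices are
compared by means of the height `f`: the `i`-th coordinate of `M i` is `1`, and the other non-zero
coordinates of `M i` have smaller height. -/
structure IsUnitriangular (ε : I → A →ₗ[R] R) (M : I → A) (f : I → α) : Prop where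
  diag : ∀ i, ε i (M i) = 1
  lt : ∀ i j, ε j (M i) ≠ 0 → j ≠ i → f j < f i

namespace IsUnitriangular

variable {ε : I → A →ₗ[R] R} {M : I → A} {f : I → α}

theorem linearIndependent (h : IsUnitriangular ε M f) : LinearIndependent R M := by
  rw [linearIndependent_iff]
  intro c hc
  by_contra hne
  obtain ⟨i, hi, hmax⟩ := c.support.exists_max_image f (Finsupp.support_nonempty_iff.2 hne)
  have hci := congrArg (ε i) hc
  rw [Finsupp.linearCombination_apply, Finsupp.sum, map_sum, map_zero,
    Finset.sum_eq_single_of_mem i hi, map_smul, h.diag, smul_eq_mul, mul_one] at hci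
  · exact Finsupp.mem_support_iff.1 hi hci
  · intro j hj hji
    rw [map_smul]
    by_contra h0
    exact (hmax j hj).not_gt (h.lt j i (right_ne_zero_of_smul h0) hji.symm)

theorem exists_lt_of_sub_sum_ne_zero (h : IsUnitriangular ε M f) {x : A} {F : Finset I}
    (hF : ∀ i, i ∈ F ↔ ε i x ≠ 0) {j : I} (hj : ε j (x - ∑ i ∈ F, ε i x • M i) ≠ 0) :
    ∃ i, ε i x ≠ 0 ∧ ε j (M i) ≠ 0 ∧ f j < f i := by
  by_contra! hlt
  have hother : ∀ i ∈ F, i ≠ j → ε j (ε i x • M i) = 0 := by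
    intro i hi hij
    rw [map_smul]
    by_contra h0
    have hji := right_ne_zero_of_smul h0
    exact (hlt i ((hF i).1 hi) hji).not_gt (h.lt i j hji hij.symm)
  apply hj
  rw [map_sub, map_sum, Finset.sum_eq_single j hother, map_smul, h.diag, smul_eq_mul, mul_one,
    sub_self]
  intro hjF
  rw [not_not.1 (mt (hF j).2 hjF), zero_smul, map_zero]

theorem mem_span_image [WellFoundedLT α] (h : IsUnitriangular ε M f)
    (hfin : ∀ x, {i | ε i x ≠ 0}.Finite) (hinj : ∀ x, (∀ i, ε i x = 0) → x = 0) {P : Set I}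
    (hP : ∀ i ∈ P, ∀ j, ε j (M i) ≠ 0 → j ∈ P) {x : A} (hx : ∀ i, ε i x ≠ 0 → i ∈ P) :
    x ∈ Submodule.span R (M '' P) := by
  have exists_height (y : A) (hy : y ≠ 0) : ∃ m, ε m y ≠ 0 ∧ ∀ i, ε i y ≠ 0 → f i ≤ f m := by
    have hne : {i | ε i y ≠ 0}.Nonempty := by
      by_contra h0
      exact hy (hinj y fun i => not_not.1 fun hi => h0 ⟨i, hi⟩)
    exact Set.exists_max_image _ f (hfin y) hne
  suffices hbdd : ∀ (a : α) (y : A), (∀ i, ε i y ≠ 0 → i ∈ P) → (∀ i, ε i y ≠ 0 → f i ≤ a) →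
      y ∈ Submodule.span R (M '' P) by
    by_cases hx0 : x = 0
    · exact hx0 ▸ Submodule.zero_mem _
    · obtain ⟨m, -, hm⟩ := exists_height x hx0
      exact hbdd (f m) x hx hm
  intro a
  induction a using WellFoundedLT.induction with | _ a ih =>
  intro y hyP hya
  have hmemF : ∀ i, i ∈ (hfin y).toFinset ↔ ε i y ≠ 0 := fun i => (hfin y).mem_toFinset
  set S := ∑ i ∈ (hfin y).toFinset, ε i y • M i
  have hS : S ∈ Submodule.span R (M '' P) := Submodule.sum_mem _ fun i hi =>
    Submodule.smul_mem _ _ (Submodule.subset_span ⟨i, hyP i ((hmemF i).1 hi), rfl⟩)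
  suffices hsub : y - S ∈ Submodule.span R (M '' P) by
    simpa only [sub_add_cancel] using Submodule.add_mem _ hsub hS
  by_cases h0 : y - S = 0
  · exact h0 ▸ Submodule.zero_mem _
  obtain ⟨m, hm, hmax⟩ := exists_height _ h0
  obtain ⟨i, hi, -, hlt⟩ := h.exists_lt_of_sub_sum_ne_zero hmemF hm
  refine ih (f m) (hlt.trans_le (hya i hi)) _ (fun j hj => ?_) hmax
  obtain ⟨k, hk, hkj, -⟩ := h.exists_lt_of_sub_sum_ne_zero hmemF hj
  exact hP k (hyP k hk) j hkj

end IsUnitriangular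

end Unitriangular

section TensorProduct

open MvPolynomial
open scoped TensorProduct

variable {ι κ K R : Type*} [CommRing K] [CommRing R] [Algebra K R]

theorem tensorMulMap_tprod {n : ℕ} (B : Fin n → Subalgebra K R) (b : ∀ k, B k) :
    tensorMulMap B (⨂ₜ[K] k, b k) = ∏ k, (b k : R) := by
  rw [tensorMulMap, PiTensorProduct.lift.tprod, MultilinearMap.compLinearMap_apply,
    MultilinearMap.mkPiAlgebraFin_apply, List.prod_ofFn]
  rfl

theorem algebraicIndependent_of_linearIndependent_monomials (T : ι → R)
    (h : LinearIndependent K fun e : ι →₀ ℕ => e.prod fun i n => T i ^ n) :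
    AlgebraicIndependent K T := by
  rw [algebraicIndependent_iff_injective_aeval]
  refine LinearMap.injective_of_linearIndependent (f := (aeval T).toLinearMap)
    (basisMonomials ι K).span_eq ?_
  simpa [Function.comp_def, aeval_monomial] using h

theorem linearIndependent_aeval_monomial {T : ι → R} (hT : AlgebraicIndependent K T) :
    LinearIndependent K fun e : ι →₀ ℕ => aeval T (monomial e (1 : K)) := by
  have h := (basisMonomials ι K).linearIndependent.map'
    (aeval T : MvPolynomial ι K →ₐ[K] R).toLinearMap (LinearMap.ker_eq_bot_of_injective hT)
  simpa [Function.comp_def] using h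

/-- The exponent vector on `ι × κ` assembled from exponent vectors on `κ` for the finitely many
first indices `s k`. -/
def assembleExponents {n : ℕ} (s : Fin n → ι) (d : Fin n → κ →₀ ℕ) : ι × κ →₀ ℕ :=
  ∑ k, (d k).mapDomain (Prod.mk (s k))

theorem assembleExponents_apply {n : ℕ} {s : Fin n → ι} (hs : Function.Injective s)
    (d : Fin n → κ →₀ ℕ) (k : Fin n) (i : κ) : assembleExponents s d (s k, i) = d k i := by
  rw [assembleExponents, Finsupp.finsetSum_apply, Finset.sum_eq_single k]
  · exact Finsupp.mapDomain_apply (Prod.mk_right_injective (s k)) _ i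
  · intro l _ hl
    refine Finsupp.mapDomain_of_notMem_range _ _ ?_
    rintro ⟨j, hj⟩
    exact hl (hs (Prod.mk.inj hj).1)
  · simp

theorem assembleExponents_apply_of_notMem {n : ℕ} (s : Fin n → ι) (d : Fin n → κ →₀ ℕ) (p : ι)
    (hp : p ∉ Set.range s) (i : κ) : assembleExponents s d (p, i) = 0 := by
  rw [assembleExponents, Finsupp.finsetSum_apply]
  refine Finset.sum_eq_zero fun l _ => Finsupp.mapDomain_of_notMem_range _ _ ?_
  rintro ⟨j, hj⟩
  exact hp ⟨l, (Prod.mk.inj hj).1⟩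

theorem assembleExponents_injective {n : ℕ} {s : Fin n → ι} (hs : Function.Injective s) :
    Function.Injective (assembleExponents (κ := κ) s) := by
  intro d d' h
  ext k i
  rw [← assembleExponents_apply hs d, h, assembleExponents_apply hs]

theorem assembleExponents_curry {n : ℕ} {s : Fin n → ι} (hs : Function.Injective s)
    {e : ι × κ →₀ ℕ} (he : ∀ x ∈ e.support, x.1 ∈ Set.range s) :
    assembleExponents s (fun k => e.curry (s k)) = e := by
  ext ⟨p, i⟩
  by_cases hp : p ∈ Set.range s
  · obtain ⟨k, rfl⟩ := hp
    rw [assembleExponents_apply hs, Finsupp.curry_apply]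
  · rw [assembleExponents_apply_of_notMem s _ p hp, eq_comm, ← Finsupp.notMem_support_iff]
    exact fun h => hp (he _ h)

variable {T : ι × κ → R} (hT : AlgebraicIndependent K T)

include hT in
theorem algebraicIndependent_slice (p : ι) : AlgebraicIndependent K fun i => T (p, i) :=
  hT.comp _ (Prod.mk_right_injective p)

theorem prod_aevalEquiv_slice_monomial {n : ℕ} (s : Fin n → ι) (d : Fin n → κ →₀ ℕ) :
    ∏ k, ((algebraicIndependent_slice hT (s k)).aevalEquiv (monomial (d k) 1) : R) =
      aeval T (monomial (assembleExponents s d) (1 : K)) := by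
  rw [assembleExponents, monomial_sum_one, map_prod]
  refine Finset.prod_congr rfl fun k _ => ?_
  rw [← rename_monomial, aeval_rename]
  exact (algebraicIndependent_slice hT (s k)).algebraMap_aevalEquiv _

include hT in
theorem tensorMulMap_adjoin_slices_injective {n : ℕ} {s : Fin n → ι} (hs : Function.Injective s) :
    Function.Injective
      (tensorMulMap fun k => Algebra.adjoin K (Set.range fun i => T (s k, i))) := by
  set b : ∀ k, Module.Basis (κ →₀ ℕ) K (Algebra.adjoin K (Set.range fun i => T (s k, i))) :=
    fun k => (basisMonomials κ K).map (algebraicIndependent_slice hT (s k)).aevalEquiv.toLinearEquiv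
    with hb
  refine LinearMap.injective_of_linearIndependent (Basis.piTensorProduct b).span_eq ?_
  have heq : (tensorMulMap fun k => Algebra.adjoin K (Set.range fun i => T (s k, i))) ∘
      Basis.piTensorProduct b = (fun e => aeval T (monomial e (1 : K))) ∘ assembleExponents s := by
    funext d
    rw [Function.comp_apply, Function.comp_apply, Basis.piTensorProduct_apply, tensorMulMap_tprod,
      ← prod_aevalEquiv_slice_monomial hT]
    simp [hb]
  rw [heq]
  exact (linearIndependent_aeval_monomial hT).comp _ (assembleExponents_injective hs)

include hT in
theorem aeval_mem_range_tensorMulMap_adjoin_slices {n : ℕ} {s : Fin n → ι}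
    (hs : Function.Injective s) {P : MvPolynomial (ι × κ) K}
    (hP : ∀ x ∈ P.vars, x.1 ∈ Set.range s) :
    aeval T P ∈ LinearMap.range
      (tensorMulMap fun k => Algebra.adjoin K (Set.range fun i => T (s k, i))) := by
  rw [P.as_sum, map_sum]
  refine Submodule.sum_mem _ fun e he => ?_
  rw [← mul_one (P.coeff e), ← smul_eq_mul, ← smul_monomial, map_smul]
  refine Submodule.smul_mem _ _ ⟨⨂ₜ[K] k,
    (algebraicIndependent_slice hT (s k)).aevalEquiv (monomial (e.curry (s k)) 1), ?_⟩
  rw [tensorMulMap_tprod, prod_aevalEquiv_slice_monomial hT, assembleExponents_curry hs]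
  exact fun x hx => hP x ((mem_vars_iff_mem_support x).2 ⟨e, he, hx⟩)

include hT in
theorem isInternalTensorProduct_adjoin_slices (htop : Algebra.adjoin K (Set.range T) = ⊤) :
    IsInternalTensorProduct fun p : ι => Algebra.adjoin K (Set.range fun i => T (p, i)) where
  commute _ _ _ a _ b _ := mul_comm a b
  injective _ _ hs := tensorMulMap_adjoin_slices_injective hT hs
  exhaust a := by
    classical
    obtain ⟨P, rfl⟩ : a ∈ (aeval T : MvPolynomial (ι × κ) K →ₐ[K] R).range := by
      rw [← Algebra.adjoin_range_eq_range_aeval, htop]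
      exact Algebra.mem_top
    set S : Finset ι := P.vars.image Prod.fst
    have hs : Function.Injective fun k => (S.equivFin.symm k : ι) :=
      Subtype.val_injective.comp S.equivFin.symm.injective
    refine ⟨S.card, _, hs, aeval_mem_range_tensorMulMap_adjoin_slices hT hs fun x hx => ?_⟩
    exact ⟨S.equivFin ⟨x.1, Finset.mem_image_of_mem _ hx⟩, by simp⟩

end TensorProduct

namespace Paramodular

open Matrix

/-! ### Matrices of paramodular shape -/

local notation "e₁" => (Sum.inl 0 : Fin 2 ⊕ Fin 2)
local notation "e₂" => (Sum.inl 1 : Fin 2 ⊕ Fin 2)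
local notation "e₃" => (Sum.inr 0 : Fin 2 ⊕ Fin 2)
local notation "e₄" => (Sum.inr 1 : Fin 2 ⊕ Fin 2)

variable {N : ℕ}

theorem forall_index {P : Fin 2 ⊕ Fin 2 → Prop} : (∀ i, P i) ↔ P e₁ ∧ P e₂ ∧ P e₃ ∧ P e₄ := by
  simp [Sum.forall, Fin.forall_fin_two, and_assoc]

/-- The diagonal matrix `diag(1, 1, 1, N)`, whose conjugate of the paramodular group has integral
entries, as a function of the index. -/
def indexScale (N : ℕ) : Fin 2 ⊕ Fin 2 → ℝ := Sum.elim ![1, 1] ![1, N]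

/-- The isotropy class of an index: `false` on the hyperbolic plane with coordinates `1, 3` and
`true` on the one with coordinates `2, 4`. -/
def indexBlock : Fin 2 ⊕ Fin 2 → Bool := Sum.elim ![false, true] ![false, true]

/-- The divisors imposed on the four blocks of `√d W`, for `W` an Atkin-Lehner matrix of index `d`,
when rows and columns are grouped by `indexBlock`: the array `(d, N; 1, d)`. -/
def blockWeight (N d : ℕ) : Bool → Bool → ℕ
  | false, true => N
  | true, false => 1
  | _, _ => d

/-- The generator of the fractional ideal in which the `(i, j)` entry of `√d M` lies, for `M` in the
coset of an Atkin-Lehner matrix of index `d`. For `d = 1` this is the shape of the paramodular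
group. -/
def weight (N d : ℕ) (i j : Fin 2 ⊕ Fin 2) : ℝ :=
  indexScale N i / indexScale N j * blockWeight N d (indexBlock i) (indexBlock j)

/-- The lattice of the matrices whose `(i, j)` entry is an integral multiple of `w i j`. -/
def InPattern (w : Fin 2 ⊕ Fin 2 → Fin 2 ⊕ Fin 2 → ℝ) (X : Mat4) : Prop :=
  ∀ i j, ∃ z : ℤ, X i j = z * w i j

section InPattern

variable {w w' w'' : Fin 2 ⊕ Fin 2 → Fin 2 ⊕ Fin 2 → ℝ} {X Y : Mat4}

theorem InPattern.add (hX : InPattern w X) (hY : InPattern w Y) : InPattern w (X + Y) :=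
  fun i j => by
    obtain ⟨x, hx⟩ := hX i j
    obtain ⟨y, hy⟩ := hY i j
    exact ⟨x + y, by rw [Matrix.add_apply, hx, hy]; push_cast; ring⟩

theorem InPattern.intSmul (hX : InPattern w X) (n : ℤ) : InPattern w ((n : ℝ) • X) :=
  fun i j => by
    obtain ⟨x, hx⟩ := hX i j
    exact ⟨n * x, by rw [Matrix.smul_apply, hx, smul_eq_mul]; push_cast; ring⟩

theorem inPattern_single {i j : Fin 2 ⊕ Fin 2} {c : ℝ} (h : ∃ z : ℤ, c = z * w i j) :
    InPattern w (Matrix.single i j c) := fun k l => by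
  rw [Matrix.single_apply]
  split_ifs with hkl
  · rwa [← hkl.1, ← hkl.2]
  · exact ⟨0, by simp⟩

theorem InPattern.mul (hX : InPattern w X) (hY : InPattern w' Y)
    (h : ∀ i j k, ∃ z : ℤ, w i j * w' j k = z * w'' i k) : InPattern w'' (X * Y) := by
  intro i k
  choose x hx using hX
  choose y hy using hY
  choose z hz using h
  refine ⟨∑ j, x i j * y j k * z i j k, ?_⟩
  rw [Matrix.mul_apply]
  push_cast
  rw [Finset.sum_mul]
  refine Finset.sum_congr rfl fun j _ => ?_
  rw [hx, hy]
  linear_combination (x i j * y j k : ℝ) * hz i j k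

end InPattern

theorem indexScale_ne_zero (hN : N ≠ 0) (i : Fin 2 ⊕ Fin 2) : indexScale N i ≠ 0 := by
  revert i
  simp [indexScale, hN]

theorem weight_mul_weight (hN : N ≠ 0) (d d' : ℕ) (i j k : Fin 2 ⊕ Fin 2) :
    weight N d i j * weight N d' j k = indexScale N i / indexScale N k *
      ((blockWeight N d (indexBlock i) (indexBlock j) *
        blockWeight N d' (indexBlock j) (indexBlock k) : ℕ) : ℝ) := by
  have := indexScale_ne_zero hN j
  have := indexScale_ne_zero hN k
  rw [weight, weight]
  push_cast
  field_simp

theorem weight_mul_weight_one {d : ℕ} (hN : N ≠ 0) (hd : d ∣ N) (i j k : Fin 2 ⊕ Fin 2) :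
    ∃ z : ℤ, weight N d i j * weight N 1 j k = z * weight N d i k := by
  obtain ⟨z, hz⟩ : ∃ z : ℕ, blockWeight N d (indexBlock i) (indexBlock j) *
      blockWeight N 1 (indexBlock j) (indexBlock k) =
        z * blockWeight N d (indexBlock i) (indexBlock k) := by
    obtain ⟨e, rfl⟩ := hd
    generalize indexBlock i = a
    generalize indexBlock j = b
    generalize indexBlock k = c
    cases a <;> cases b <;> cases c <;> simp only [blockWeight]
    exacts [⟨1, by ring⟩, ⟨d, by ring⟩, ⟨e, by ring⟩, ⟨1, by ring⟩, ⟨1, by ring⟩, ⟨e, by ring⟩,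
      ⟨d, by ring⟩, ⟨1, by ring⟩]
  refine ⟨z, ?_⟩
  rw [weight_mul_weight hN, hz, weight]
  push_cast
  ring

theorem weight_mul_weight_self {d : ℕ} (hN : N ≠ 0) (hd : d ∣ N) (i j k : Fin 2 ⊕ Fin 2) :
    ∃ z : ℤ, weight N d i j * weight N d j k = z * (d * weight N 1 i k) := by
  obtain ⟨z, hz⟩ : ∃ z : ℕ, blockWeight N d (indexBlock i) (indexBlock j) *
      blockWeight N d (indexBlock j) (indexBlock k) =
        z * (d * blockWeight N 1 (indexBlock i) (indexBlock k)) := by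
    obtain ⟨e, rfl⟩ := hd
    generalize indexBlock i = a
    generalize indexBlock j = b
    generalize indexBlock k = c
    cases a <;> cases b <;> cases c <;> simp only [blockWeight]
    exacts [⟨d, by ring⟩, ⟨1, by ring⟩, ⟨e, by ring⟩, ⟨1, by ring⟩, ⟨1, by ring⟩, ⟨e, by ring⟩,
      ⟨1, by ring⟩, ⟨d, by ring⟩]
  refine ⟨z, ?_⟩
  rw [weight_mul_weight hN, hz, weight]
  push_cast
  ring

/-- The order spanned by the matrices of paramodular shape. -/
abbrev InOrder (N : ℕ) (X : Mat4) : Prop := InPattern (weight N 1) X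

theorem InOrder.mul (hN : N ≠ 0) {X Y : Mat4} (hX : InOrder N X) (hY : InOrder N Y) :
    InOrder N (X * Y) := InPattern.mul hX hY (weight_mul_weight_one hN (one_dvd N))

theorem hasParamodularForm_iff (hN : N ≠ 0) {M : Mat4} :
    HasParamodularForm N M ↔ InOrder N M := by
  have hN' : (N : ℝ) ≠ 0 := Nat.cast_ne_zero.2 hN
  constructor
  · rintro ⟨a₁, a₂, a₃, a₄, b₁, b₂, b₃, b₄, c₁, c₂, c₃, c₄, d₁, d₂, d₃, d₄, rfl⟩
    simp only [InOrder, InPattern, forall_index]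
    refine ⟨⟨⟨a₁, ?_⟩, ⟨a₂, ?_⟩, ⟨b₁, ?_⟩, ⟨b₂, ?_⟩⟩, ⟨⟨a₃, ?_⟩, ⟨a₄, ?_⟩, ⟨b₃, ?_⟩, ⟨b₄, ?_⟩⟩,
      ⟨⟨c₁, ?_⟩, ⟨c₂, ?_⟩, ⟨d₁, ?_⟩, ⟨d₂, ?_⟩⟩, ⟨⟨c₃, ?_⟩, ⟨c₄, ?_⟩, ⟨d₃, ?_⟩, ⟨d₄, ?_⟩⟩⟩ <;>
      (simp [weight, indexScale, indexBlock, blockWeight, hN']; try field_simp)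
  · intro h
    choose z hz using h
    refine ⟨z e₁ e₁, z e₁ e₂, z e₂ e₁, z e₂ e₂, z e₁ e₃, z e₁ e₄, z e₂ e₃, z e₂ e₄,
      z e₃ e₁, z e₃ e₂, z e₄ e₁, z e₄ e₂, z e₃ e₃, z e₃ e₄, z e₄ e₃, z e₄ e₄, ?_⟩
    ext i j
    rw [hz]
    revert i j
    simp only [forall_index]
    simp [weight, indexScale, indexBlock, blockWeight, hN']
    field_simp

/-- The symplectic adjoint, which is the inverse on symplectic matrices. -/
def sympAdjoint (X : Mat4) : Mat4 := -J (Fin 2) ℝ * Xᵀ * J (Fin 2) ℝ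

theorem coe_inv (g : Sp2) : ((g⁻¹ : Sp2) : Mat4) = sympAdjoint g := SymplecticGroup.coe_inv g

theorem sympAdjoint_eq (X : Mat4) : sympAdjoint X =
    fromBlocks !![X e₃ e₃, X e₄ e₃; X e₃ e₄, X e₄ e₄] !![-X e₁ e₃, -X e₂ e₃; -X e₁ e₄, -X e₂ e₄]
      !![-X e₃ e₁, -X e₄ e₁; -X e₃ e₂, -X e₄ e₂] !![X e₁ e₁, X e₂ e₁; X e₁ e₂, X e₂ e₂] := by
  ext i j
  revert i j
  simp only [forall_index]
  simp [sympAdjoint, Matrix.mul_apply, J, Matrix.one_apply]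

theorem sympAdjoint_smul (c : ℝ) (X : Mat4) : sympAdjoint (c • X) = c • sympAdjoint X := by
  simp [sympAdjoint]

theorem sympAdjoint_mul (X Y : Mat4) :
    sympAdjoint (X * Y) = sympAdjoint Y * sympAdjoint X := by
  have hJ : J (Fin 2) ℝ * -J (Fin 2) ℝ = 1 := by rw [Matrix.mul_neg, J_squared, neg_neg]
  calc -J (Fin 2) ℝ * (X * Y)ᵀ * J (Fin 2) ℝ
      = -J (Fin 2) ℝ * Yᵀ * (J (Fin 2) ℝ * -J (Fin 2) ℝ) * Xᵀ * J (Fin 2) ℝ := by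
        rw [hJ, Matrix.mul_one, Matrix.transpose_mul, ← Matrix.mul_assoc]
    _ = sympAdjoint Y * sympAdjoint X := by simp only [sympAdjoint, Matrix.mul_assoc]

theorem InPattern.sympAdjoint {d : ℕ} (hN : N ≠ 0) {X : Mat4} (h : InPattern (weight N d) X) :
    InPattern (weight N d) (sympAdjoint X) := by
  have hN' : (N : ℝ) ≠ 0 := Nat.cast_ne_zero.2 hN
  choose z hz using h
  rw [sympAdjoint_eq]
  simp only [InPattern, forall_index]
  refine ⟨⟨⟨z e₃ e₃, ?_⟩, ⟨z e₄ e₃, ?_⟩, ⟨-z e₁ e₃, ?_⟩, ⟨-z e₂ e₃, ?_⟩⟩,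
    ⟨⟨z e₃ e₄, ?_⟩, ⟨z e₄ e₄, ?_⟩, ⟨-z e₁ e₄, ?_⟩, ⟨-z e₂ e₄, ?_⟩⟩,
    ⟨⟨-z e₃ e₁, ?_⟩, ⟨-z e₄ e₁, ?_⟩, ⟨z e₁ e₁, ?_⟩, ⟨z e₂ e₁, ?_⟩⟩,
    ⟨⟨-z e₃ e₂, ?_⟩, ⟨-z e₄ e₂, ?_⟩, ⟨z e₁ e₂, ?_⟩, ⟨z e₂ e₂, ?_⟩⟩⟩ <;>
    simp [hz, weight, indexScale, indexBlock, blockWeight, hN']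

theorem row_relation (g : Sp2) (i j : Fin 2 ⊕ Fin 2) :
    (g : Mat4) i e₃ * (g : Mat4) j e₁ + (g : Mat4) i e₄ * (g : Mat4) j e₂
      - (g : Mat4) i e₁ * (g : Mat4) j e₃ - (g : Mat4) i e₂ * (g : Mat4) j e₄ =
        J (Fin 2) ℝ i j := by
  rw [← congrFun₂ (SymplecticGroup.mem_iff.1 g.2) i j]
  simp [Matrix.mul_apply, J, Matrix.one_apply]
  ring

theorem column_relation (g : Sp2) (i j : Fin 2 ⊕ Fin 2) :
    (g : Mat4) e₃ i * (g : Mat4) e₁ j + (g : Mat4) e₄ i * (g : Mat4) e₂ j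
      - (g : Mat4) e₁ i * (g : Mat4) e₃ j - (g : Mat4) e₂ i * (g : Mat4) e₄ j =
        J (Fin 2) ℝ i j := by
  rw [← congrFun₂ (SymplecticGroup.mem_iff'.1 g.2) i j]
  simp [Matrix.mul_apply, J, Matrix.one_apply]
  ring

/-- The embedding of `SL₂(ℝ) × SL₂(ℝ)` in the symplectic group, the two factors acting on the
hyperbolic planes with coordinates `1, 3` and `2, 4`. -/
def diagonalBlocks (a b c d : Fin 2 → ℝ) (h : ∀ i, a i * d i - b i * c i = 1) : Sp2 :=
  ⟨fromBlocks (diagonal a) (diagonal b) (diagonal c) (diagonal d), by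
    simp only [SymplecticGroup.fromBlocks_mem_iff, diagonal_transpose, diagonal_mul_diagonal,
      diagonal_sub, ← diagonal_one]
    simp only [mul_comm, true_and]
    exact congrArg diagonal (funext fun i => (h i).symm ▸ by ring)⟩

section diagonalBlocks

variable {a b c d : Fin 2 → ℝ} (h : ∀ i, a i * d i - b i * c i = 1) (g : Sp2) (k : Fin 2)
  (i j : Fin 2 ⊕ Fin 2)

theorem diagonalBlocks_mul_inl : ((diagonalBlocks a b c d h * g : Sp2) : Mat4) (Sum.inl k) j =
    a k * (g : Mat4) (Sum.inl k) j + b k * (g : Mat4) (Sum.inr k) j := by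
  simp [diagonalBlocks, Matrix.mul_apply, diagonal_apply]

theorem diagonalBlocks_mul_inr : ((diagonalBlocks a b c d h * g : Sp2) : Mat4) (Sum.inr k) j =
    c k * (g : Mat4) (Sum.inl k) j + d k * (g : Mat4) (Sum.inr k) j := by
  simp [diagonalBlocks, Matrix.mul_apply, diagonal_apply]

theorem mul_diagonalBlocks_inl : ((g * diagonalBlocks a b c d h : Sp2) : Mat4) i (Sum.inl k) =
    a k * (g : Mat4) i (Sum.inl k) + c k * (g : Mat4) i (Sum.inr k) := by
  simp [diagonalBlocks, Matrix.mul_apply, diagonal_apply, mul_comm]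

theorem mul_diagonalBlocks_inr : ((g * diagonalBlocks a b c d h : Sp2) : Mat4) i (Sum.inr k) =
    b k * (g : Mat4) i (Sum.inl k) + d k * (g : Mat4) i (Sum.inr k) := by
  simp [diagonalBlocks, Matrix.mul_apply, diagonal_apply, mul_comm]

end diagonalBlocks

/-- `SL₂(ℤ)`, acting on the coordinates `1, 3`. -/
def special13 (α β γ δ : ℤ) (h : α * δ - β * γ = 1) : Sp2 :=
  diagonalBlocks ![α, 1] ![β, 0] ![γ, 0] ![δ, 1] (by
    simpa [Fin.forall_fin_two] using by exact_mod_cast h)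

/-- The conjugate of `SL₂(ℤ)` in the paramodular group that acts on the coordinates `2, 4`. -/
def special24 (N : ℕ) (hN : N ≠ 0) (α β γ δ : ℤ) (h : α * δ - β * γ = 1) : Sp2 :=
  diagonalBlocks ![1, α] ![0, β / N] ![0, γ * N] ![1, δ] (by
    have hN' : (N : ℝ) ≠ 0 := Nat.cast_ne_zero.2 hN
    have hdet : (α : ℝ) * δ - β * γ = 1 := by exact_mod_cast h
    refine Fin.forall_fin_two.2 ⟨by simp, ?_⟩
    simp only [cons_val_one, cons_val_fin_one]
    field_simp
    exact hdet)

/-- The matrix `V_d`, the upper left block of the generator `W_d` of the extended paramodular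
group. -/
def leviBlock (N d : ℕ) (α β γ δ : ℤ) : Matrix (Fin 2) (Fin 2) ℝ :=
  (1 / Real.sqrt d) • !![(α : ℝ) * d, β * N; γ, δ * d]

theorem leviBlock_det {d : ℕ} (hd : 0 < d) {α β γ δ : ℤ} (h : α * δ * d * d - β * γ * N = d) :
    (leviBlock N d α β γ δ).det = 1 := by
  have hdet : (α : ℝ) * δ * d * d - β * γ * N = d := by exact_mod_cast h
  have hd' : (d : ℝ) ≠ 0 := Nat.cast_ne_zero.2 hd.ne'
  rw [leviBlock, det_smul, det_fin_two_of, Fintype.card_fin, div_pow, one_pow,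
    Real.sq_sqrt (Nat.cast_nonneg d)]
  field_simp
  linear_combination hdet

/-- The generator `W_d` of the extended paramodular group; the adjugate of `V_d` is its inverse. -/
def levi (N d : ℕ) (hd : 0 < d) (α β γ δ : ℤ) (h : α * δ * d * d - β * γ * N = d) : Sp2 :=
  ⟨fromBlocks (leviBlock N d α β γ δ) 0 0 (leviBlock N d α β γ δ).adjugateᵀ, by
    refine SymplecticGroup.fromBlocks_mem_iff.2 ⟨by simp, by simp, ?_⟩
    rw [← transpose_mul, adjugate_mul, leviBlock_det hd h]
    simp⟩

section entries

variable {hN : N ≠ 0} {α β γ δ : ℤ} (g : Sp2) (i j : Fin 2 ⊕ Fin 2)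

section special

variable (h : α * δ - β * γ = 1)

theorem special13_mul₁ : ((special13 α β γ δ h * g : Sp2) : Mat4) e₁ j =
    α * (g : Mat4) e₁ j + β * (g : Mat4) e₃ j := by
  simp [special13, diagonalBlocks_mul_inl]

theorem special13_mul₂ : ((special13 α β γ δ h * g : Sp2) : Mat4) e₂ j = (g : Mat4) e₂ j := by
  simp [special13, diagonalBlocks_mul_inl]

theorem special13_mul₃ : ((special13 α β γ δ h * g : Sp2) : Mat4) e₃ j =
    γ * (g : Mat4) e₁ j + δ * (g : Mat4) e₃ j := by
  simp [special13, diagonalBlocks_mul_inr]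

theorem special13_mul₄ : ((special13 α β γ δ h * g : Sp2) : Mat4) e₄ j = (g : Mat4) e₄ j := by
  simp [special13, diagonalBlocks_mul_inr]

theorem mul_special13₁ : ((g * special13 α β γ δ h : Sp2) : Mat4) i e₁ =
    α * (g : Mat4) i e₁ + γ * (g : Mat4) i e₃ := by
  simp [special13, mul_diagonalBlocks_inl]

theorem mul_special13₂ : ((g * special13 α β γ δ h : Sp2) : Mat4) i e₂ = (g : Mat4) i e₂ := by
  simp [special13, mul_diagonalBlocks_inl]

theorem mul_special13₃ : ((g * special13 α β γ δ h : Sp2) : Mat4) i e₃ =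
    β * (g : Mat4) i e₁ + δ * (g : Mat4) i e₃ := by
  simp [special13, mul_diagonalBlocks_inr]

theorem mul_special13₄ : ((g * special13 α β γ δ h : Sp2) : Mat4) i e₄ = (g : Mat4) i e₄ := by
  simp [special13, mul_diagonalBlocks_inr]

theorem special24_mul₁ : ((special24 N hN α β γ δ h * g : Sp2) : Mat4) e₁ j = (g : Mat4) e₁ j := by
  simp [special24, diagonalBlocks_mul_inl]

theorem special24_mul₂ : ((special24 N hN α β γ δ h * g : Sp2) : Mat4) e₂ j =
    α * (g : Mat4) e₂ j + β / N * (g : Mat4) e₄ j := by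
  simp [special24, diagonalBlocks_mul_inl]

theorem special24_mul₃ : ((special24 N hN α β γ δ h * g : Sp2) : Mat4) e₃ j = (g : Mat4) e₃ j := by
  simp [special24, diagonalBlocks_mul_inr]

theorem special24_mul₄ : ((special24 N hN α β γ δ h * g : Sp2) : Mat4) e₄ j =
    γ * N * (g : Mat4) e₂ j + δ * (g : Mat4) e₄ j := by
  simp [special24, diagonalBlocks_mul_inr]

theorem mul_special24₁ : ((g * special24 N hN α β γ δ h : Sp2) : Mat4) i e₁ = (g : Mat4) i e₁ := by
  simp [special24, mul_diagonalBlocks_inl]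

theorem mul_special24₂ : ((g * special24 N hN α β γ δ h : Sp2) : Mat4) i e₂ =
    α * (g : Mat4) i e₂ + γ * N * (g : Mat4) i e₄ := by
  simp [special24, mul_diagonalBlocks_inl]

theorem mul_special24₃ : ((g * special24 N hN α β γ δ h : Sp2) : Mat4) i e₃ = (g : Mat4) i e₃ := by
  simp [special24, mul_diagonalBlocks_inr]

theorem mul_special24₄ : ((g * special24 N hN α β γ δ h : Sp2) : Mat4) i e₄ =
    β / N * (g : Mat4) i e₂ + δ * (g : Mat4) i e₄ := by
  simp [special24, mul_diagonalBlocks_inr]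

end special

section levi

variable {d : ℕ} {hd : 0 < d} (h : α * δ * d * d - β * γ * N = d)

theorem levi_mul₁ : ((levi N d hd α β γ δ h * g : Sp2) : Mat4) e₁ j =
    (α * d * (g : Mat4) e₁ j + β * N * (g : Mat4) e₂ j) / Real.sqrt d := by
  simp [levi, leviBlock, Matrix.mul_apply]
  ring

theorem levi_mul₂ : ((levi N d hd α β γ δ h * g : Sp2) : Mat4) e₂ j =
    (γ * (g : Mat4) e₁ j + δ * d * (g : Mat4) e₂ j) / Real.sqrt d := by
  simp [levi, leviBlock, Matrix.mul_apply]
  ring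

theorem levi_mul₄ : ((levi N d hd α β γ δ h * g : Sp2) : Mat4) e₄ j =
    (-(β * N) * (g : Mat4) e₃ j + α * d * (g : Mat4) e₄ j) / Real.sqrt d := by
  simp [levi, leviBlock, Matrix.mul_apply, Matrix.adjugate_fin_two]
  ring

theorem mul_levi₁ : ((g * levi N d hd α β γ δ h : Sp2) : Mat4) i e₁ =
    (α * d * (g : Mat4) i e₁ + γ * (g : Mat4) i e₂) / Real.sqrt d := by
  simp [levi, leviBlock, Matrix.mul_apply]
  ring

theorem mul_levi₂ : ((g * levi N d hd α β γ δ h : Sp2) : Mat4) i e₂ =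
    (β * N * (g : Mat4) i e₁ + δ * d * (g : Mat4) i e₂) / Real.sqrt d := by
  simp [levi, leviBlock, Matrix.mul_apply]
  ring

theorem mul_levi₄ : ((g * levi N d hd α β γ δ h : Sp2) : Mat4) i e₄ =
    (-γ * (g : Mat4) i e₃ + α * d * (g : Mat4) i e₄) / Real.sqrt d := by
  simp [levi, leviBlock, Matrix.mul_apply, Matrix.adjugate_fin_two]
  ring

end levi

end entries

theorem mem_extendedParamodular_of_inOrder (hN : N ≠ 0) {g : Sp2}
    (hg : InOrder N (g : Mat4)) : g ∈ extendedParamodular N :=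
  Subgroup.subset_closure (Or.inl ((hasParamodularForm_iff hN).2 hg))

theorem special13_mem {α β γ δ : ℤ} (h : α * δ - β * γ = 1) :
    special13 α β γ δ h ∈ extendedParamodular N :=
  Subgroup.subset_closure (Or.inl ⟨α, 0, 0, 1, β, 0, 0, 0, γ, 0, 0, 0, δ, 0, 0, 1, by
    simp [special13, diagonalBlocks, diagonal_fin_two]⟩)

theorem special24_mem (hN : N ≠ 0) {α β γ δ : ℤ} (h : α * δ - β * γ = 1) :
    special24 N hN α β γ δ h ∈ extendedParamodular N :=
  Subgroup.subset_closure (Or.inl ⟨1, 0, 0, α, 0, 0, 0, β, 0, 0, 0, γ, 1, 0, 0, δ, by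
    simp [special24, diagonalBlocks, diagonal_fin_two]⟩)

theorem levi_mem {d : ℕ} (hd : 0 < d) (hdN : d ∣ N) {α β γ δ : ℤ}
    (h : α * δ * d * d - β * γ * N = d) : levi N d hd α β γ δ h ∈ extendedParamodular N := by
  refine Subgroup.subset_closure
    (Or.inr ⟨d, α, β, γ, δ, leviBlock N d α β γ δ, hdN, rfl, leviBlock_det hd h, ?_⟩)
  rw [inv_def, det_transpose, leviBlock_det hd h, Ring.inverse_one, one_smul,
    ← adjugate_transpose, levi]

theorem exists_inPattern_of_mem_atkinLehner (hN : N ≠ 0) {g : Sp2} (hg : g ∈ atkinLehner N) :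
    ∃ d : ℕ, 0 < d ∧ d ∣ N ∧ InPattern (weight N d) (Real.sqrt d • (g : Mat4)) := by
  obtain ⟨d, α, β, γ, δ, V, hd, rfl, hdet, hM⟩ := hg
  have hd0 : 0 < d := Nat.pos_of_dvd_of_pos hd (Nat.pos_of_ne_zero hN)
  have hs : Real.sqrt d ≠ 0 := Real.sqrt_ne_zero'.2 (by exact_mod_cast hd0)
  have hN' : (N : ℝ) ≠ 0 := Nat.cast_ne_zero.2 hN
  refine ⟨d, hd0, hd, ?_⟩
  rw [hM, Matrix.inv_def, Matrix.det_transpose, hdet]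
  simp only [InPattern, forall_index]
  refine ⟨⟨⟨α, ?_⟩, ⟨β, ?_⟩, ⟨0, ?_⟩, ⟨0, ?_⟩⟩, ⟨⟨γ, ?_⟩, ⟨δ, ?_⟩, ⟨0, ?_⟩, ⟨0, ?_⟩⟩,
    ⟨⟨0, ?_⟩, ⟨0, ?_⟩, ⟨δ, ?_⟩, ⟨-γ, ?_⟩⟩, ⟨⟨0, ?_⟩, ⟨0, ?_⟩, ⟨-β, ?_⟩, ⟨α, ?_⟩⟩⟩ <;>
    simp [Matrix.adjugate_fin_two, weight, indexScale, indexBlock, blockWeight, hs, hN']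

/-! ### Denominators of conjugations -/

/-- The conjugation action of the symplectic group on matrices. -/
def conj (g : Sp2) (X : Mat4) : Mat4 := (g : Mat4) * X * ((g⁻¹ : Sp2) : Mat4)

theorem conj_one (X : Mat4) : conj 1 X = X := by simp [conj]

theorem conj_mul (g h : Sp2) (X : Mat4) : conj (g * h) X = conj g (conj h X) := by
  simp only [conj, _root_.mul_inv_rev, Submonoid.coe_mul, Matrix.mul_assoc]

theorem conj_smul (g : Sp2) (c : ℝ) (X : Mat4) : conj g (c • X) = c • conj g X := by
  simp only [conj, Matrix.mul_smul, Matrix.smul_mul]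

/-- `n` is a denominator for the conjugation with `g` on the order of paramodular shape. The
denominators are invariants of the double coset of `g`, since the extended paramodular group
normalizes the order. -/
def IsDenominator (N n : ℕ) (g : Sp2) : Prop :=
  ∀ X, InOrder N X → InOrder N ((n : ℝ) • conj g X)

/-- The fixed points of the symplectic adjoint. -/
def IsSympSymm (X : Mat4) : Prop := sympAdjoint X = X

/-- `n` is a denominator for the conjugation with `g` on those elements of the order of paramodular
shape which are fixed by the symplectic adjoint. Together with `IsDenominator` this separates the
double cosets. -/
def IsSymmDenominator (N n : ℕ) (g : Sp2) : Prop :=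
  ∀ X, InOrder N X → IsSympSymm X → InOrder N ((n : ℝ) • conj g X)

theorem IsSympSymm.smul {X : Mat4} (hX : IsSympSymm X) (c : ℝ) : IsSympSymm (c • X) := by
  rw [IsSympSymm, sympAdjoint_smul, hX]

theorem IsSympSymm.conj {X : Mat4} (hX : IsSympSymm X) (g : Sp2) : IsSympSymm (conj g X) := by
  rw [IsSympSymm, Paramodular.conj, sympAdjoint_mul, sympAdjoint_mul, hX, ← coe_inv, ← coe_inv,
    inv_inv, Matrix.mul_assoc]

theorem IsDenominator.mul {m n : ℕ} {g h : Sp2} (hg : IsDenominator N m g)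
    (hh : IsDenominator N n h) : IsDenominator N (m * n) (g * h) := fun X hX => by
  rw [conj_mul, Nat.cast_mul, mul_smul, ← conj_smul]
  exact hg _ (hh X hX)

theorem IsSymmDenominator.mul {m n : ℕ} {g h : Sp2} (hg : IsSymmDenominator N m g)
    (hh : IsSymmDenominator N n h) : IsSymmDenominator N (m * n) (g * h) := fun X hX hs => by
  rw [conj_mul, Nat.cast_mul, mul_smul, ← conj_smul]
  exact hg _ (hh X hX hs) ((hs.conj h).smul _)

theorem IsDenominator.isSymmDenominator {n : ℕ} {g : Sp2} (hg : IsDenominator N n g) :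
    IsSymmDenominator N n g := fun X hX _ => hg X hX

theorem InPattern.sqrt_smul_inv {d n : ℕ} (hN : N ≠ 0) {g : Sp2}
    (hg : InPattern (weight N d) (Real.sqrt n • (g : Mat4))) :
    InPattern (weight N d) (Real.sqrt n • ((g⁻¹ : Sp2) : Mat4)) := by
  rw [coe_inv, ← sympAdjoint_smul]
  exact hg.sympAdjoint hN

theorem natCast_smul_conj (n : ℕ) (g : Sp2) (X : Mat4) : (n : ℝ) • conj g X =
    (Real.sqrt n • (g : Mat4)) * X * (Real.sqrt n • ((g⁻¹ : Sp2) : Mat4)) := by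
  rw [conj, Matrix.smul_mul, Matrix.smul_mul, Matrix.mul_smul, smul_smul,
    Real.mul_self_sqrt (Nat.cast_nonneg n)]

theorem isDenominator_of_inOrder_sqrt_smul (hN : N ≠ 0) {n : ℕ} {g : Sp2}
    (hg : InOrder N (Real.sqrt n • (g : Mat4))) : IsDenominator N n g := fun X hX => by
  rw [natCast_smul_conj]
  exact (hg.mul hN hX).mul hN (hg.sqrt_smul_inv hN)

theorem isDenominator_one_of_inPattern (hN : N ≠ 0) {g : Sp2} {d : ℕ} (hd : 0 < d) (hdN : d ∣ N)
    (hg : InPattern (weight N d) (Real.sqrt d • (g : Mat4))) :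
    IsDenominator N 1 g := fun X hX i j => by
  have h := (hg.mul hX (weight_mul_weight_one hN hdN)).mul (hg.sqrt_smul_inv hN)
    (weight_mul_weight_self hN hdN)
  rw [← natCast_smul_conj] at h
  obtain ⟨z, hz⟩ := h i j
  rw [Matrix.smul_apply, smul_eq_mul, mul_left_comm] at hz
  rw [Nat.cast_one, one_smul]
  exact ⟨z, mul_left_cancel₀ (Nat.cast_ne_zero.2 hd.ne') hz⟩

theorem isDenominator_one_of_mem (hN : N ≠ 0) {g : Sp2} (hg : g ∈ extendedParamodular N) :
    IsDenominator N 1 g := by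
  suffices h : IsDenominator N 1 g ∧ IsDenominator N 1 g⁻¹ from h.1
  induction hg using Subgroup.closure_induction with
  | mem g hg =>
    obtain ⟨d, hd, hdN, h⟩ :
        ∃ d : ℕ, 0 < d ∧ d ∣ N ∧ InPattern (weight N d) (Real.sqrt d • (g : Mat4)) := by
      rcases hg with hg | hg
      · exact ⟨1, one_pos, one_dvd N, by simpa using (hasParamodularForm_iff hN).1 hg⟩
      · exact exists_inPattern_of_mem_atkinLehner hN hg
    exact ⟨isDenominator_one_of_inPattern hN hd hdN h,
      isDenominator_one_of_inPattern hN hd hdN (h.sqrt_smul_inv hN)⟩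
  | one => simp [IsDenominator, conj_one]
  | mul g h _ _ hg hh =>
    rw [_root_.mul_inv_rev]
    exact ⟨hg.1.mul hh.1, hh.2.mul hg.2⟩
  | inv g _ hg => rwa [inv_inv, and_comm]

theorem IsDenominator.mul_mem (hN : N ≠ 0) {n : ℕ} {g u v : Sp2} (hg : IsDenominator N n g)
    (hu : u ∈ extendedParamodular N) (hv : v ∈ extendedParamodular N) :
    IsDenominator N n (u * g * v) := by
  simpa using ((isDenominator_one_of_mem hN hu).mul hg).mul (isDenominator_one_of_mem hN hv)

theorem IsSymmDenominator.mul_mem (hN : N ≠ 0) {n : ℕ} {g u v : Sp2}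
    (hg : IsSymmDenominator N n g)
    (hu : u ∈ extendedParamodular N) (hv : v ∈ extendedParamodular N) :
    IsSymmDenominator N n (u * g * v) := by
  simpa using ((isDenominator_one_of_mem hN hu).isSymmDenominator.mul hg).mul
    (isDenominator_one_of_mem hN hv).isSymmDenominator

theorem IsIntegral.inOrder_natCast_smul (hN : N ≠ 0) {A : Mat4} (hA : IsIntegral A) :
    InOrder N ((N : ℝ) • A) := by
  obtain ⟨A, rfl⟩ := hA
  have hN' : (N : ℝ) ≠ 0 := Nat.cast_ne_zero.2 hN
  have hw : ∀ i j, ∃ z : ℤ, (N : ℝ) = z * weight N 1 i j := by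
    simp only [forall_index]
    refine ⟨⟨⟨N, ?_⟩, ⟨1, ?_⟩, ⟨N, ?_⟩, ⟨N, ?_⟩⟩, ⟨⟨N, ?_⟩, ⟨N, ?_⟩, ⟨N, ?_⟩, ⟨N * N, ?_⟩⟩,
      ⟨⟨N, ?_⟩, ⟨1, ?_⟩, ⟨N, ?_⟩, ⟨N, ?_⟩⟩, ⟨⟨1, ?_⟩, ⟨1, ?_⟩, ⟨1, ?_⟩, ⟨N, ?_⟩⟩⟩ <;>
      simp [weight, indexScale, indexBlock, blockWeight, hN']
  intro i j
  obtain ⟨z, hz⟩ := hw i j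
  refine ⟨A i j * z, ?_⟩
  rw [Matrix.smul_apply, Matrix.map_apply, smul_eq_mul]
  push_cast
  linear_combination (A i j : ℝ) * hz

theorem exists_isDenominator (hN : N ≠ 0) {g : Sp2} (hg : g ∈ bigG) :
    ∃ n, 0 < n ∧ IsDenominator N n g := by
  obtain ⟨m, hm, A, hA⟩ := hg
  refine ⟨N ^ 2 * m, by positivity, isDenominator_of_inOrder_sqrt_smul hN ?_⟩
  rw [Nat.cast_mul, Nat.cast_pow, Real.sqrt_mul (by positivity), Real.sqrt_sq (by positivity),
    mul_smul]
  exact IsIntegral.inOrder_natCast_smul hN ⟨A, hA⟩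

/- The matrix unit in position `(1, 3)` serves as a test element. -/
theorem IsDenominator.exists_mul_entry_eq {n : ℕ} {g : Sp2} (hg : IsDenominator N n g)
    (i : Fin 2 ⊕ Fin 2) :
    ∃ z : ℤ, (n : ℝ) * ((g : Mat4) i e₁ * (g : Mat4) e₁ e₁) = z * weight N 1 i e₃ := by
  obtain ⟨z, hz⟩ := hg (Matrix.single e₁ e₃ 1)
    (inPattern_single ⟨1, by simp [weight, indexScale, indexBlock, blockWeight]⟩) i e₃
  refine ⟨z, ?_⟩
  rw [← hz, conj, coe_inv, sympAdjoint_eq]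
  simp [Matrix.mul_apply, Matrix.single_apply]

/- The test element has the smallest possible rank, which is two. -/
theorem IsSymmDenominator.exists_mul_minor_eq (hN : N ≠ 0) {n : ℕ} {g : Sp2}
    (hg : IsSymmDenominator N n g) (i : Fin 2 ⊕ Fin 2) :
    ∃ z : ℤ, (n : ℝ) * ((g : Mat4) i e₂ * (g : Mat4) e₁ e₁ - (g : Mat4) i e₁ * (g : Mat4) e₁ e₂) =
      z * weight N 1 i e₃ := by
  have hN' : (N : ℝ) ≠ 0 := Nat.cast_ne_zero.2 hN
  have hX : InOrder N (Matrix.single e₂ e₃ 1 + Matrix.single e₁ e₄ (-1)) :=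
    (inPattern_single ⟨1, by simp [weight, indexScale, indexBlock, blockWeight]⟩).add
      (inPattern_single ⟨-1, by simp [weight, indexScale, indexBlock, blockWeight, hN']⟩)
  have hs : IsSympSymm (Matrix.single e₂ e₃ 1 + Matrix.single e₁ e₄ (-1)) := by
    rw [IsSympSymm, sympAdjoint_eq]
    ext i j
    revert i j
    simp only [forall_index]
    simp
  obtain ⟨z, hz⟩ := hg _ hX hs i e₃
  refine ⟨z, ?_⟩
  rw [← hz, conj, coe_inv, sympAdjoint_eq]
  simp [Matrix.mul_apply, Matrix.single_apply]
  ring_nf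
  simp

theorem exists_det_one_mul_add_mul_eq_zero (a b : ℤ) :
    ∃ α β γ δ : ℤ, α * δ - β * γ = 1 ∧ α * a + β * b = 0 := by
  by_cases h : a = 0 ∧ b = 0
  · exact ⟨1, 0, 0, 1, by ring, by simp [h.1, h.2]⟩
  · have hg : 0 < Int.gcd a b := Int.gcd_pos_iff.2 (by tauto)
    obtain ⟨g, a', b', -, hco, ha, hb⟩ := Int.exists_gcd_one' hg
    obtain ⟨x, y, hxy⟩ := Int.isCoprime_iff_gcd_eq_one.2 hco
    exact ⟨-b', a', -x, -y, by linear_combination hxy, by rw [ha, hb]; ring⟩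

theorem isCoprime_of_gcd_mul_eq_squarefree (hN : Squarefree N) {R : ℤ} {e : ℕ}
    (he : N = Int.gcd R N * e) : IsCoprime R (e : ℤ) := by
  have hde : Nat.Coprime (Int.gcd R N) e := Nat.coprime_of_squarefree_mul (he ▸ hN)
  rw [Int.isCoprime_iff_gcd_eq_one]
  refine Nat.eq_one_of_dvd_coprimes hde ?_ (by exact_mod_cast Int.gcd_dvd_right R (e : ℤ))
  exact Int.dvd_gcd (Int.gcd_dvd_left R (e : ℤ))
    ((Int.gcd_dvd_right R (e : ℤ)).trans (by exact_mod_cast Dvd.intro_left _ he.symm))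

/- The vector `(a, b)` is proportional to the column `(r d, s)` of an Atkin-Lehner matrix of index
`d`: clear the common factor of `a` and `b` and take for `d` what the first entry then shares with
`N`. This is where `N` has to be squarefree. -/
theorem exists_proportional_atkinLehner_vector (hN : Squarefree N) {a b : ℤ}
    (h : ¬(a = 0 ∧ b = 0)) :
    ∃ (d e : ℕ) (r s x y : ℤ), 0 < d ∧ d * e = N ∧ a * s = b * (r * d) ∧
      r * d * x - s * e * y = 1 := by
  have hg : 0 < Int.gcd a b := Int.gcd_pos_iff.2 (by tauto)
  obtain ⟨g, R, s, -, hco, ha, hb⟩ := Int.exists_gcd_one' hg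
  obtain ⟨e, he⟩ : Int.gcd R N ∣ N := by exact_mod_cast Int.gcd_dvd_right R (N : ℤ)
  obtain ⟨r, hr⟩ := Int.gcd_dvd_left R (N : ℤ)
  have hRe := isCoprime_of_gcd_mul_eq_squarefree hN he
  obtain ⟨x, y, hxy⟩ := (Int.isCoprime_iff_gcd_eq_one.2 hco).mul_right hRe
  refine ⟨Int.gcd R N, e, r, s, x, -y, Int.gcd_pos_of_ne_zero_right R ?_, he.symm, ?_, ?_⟩
  · exact_mod_cast hN.ne_zero
  · rw [ha, hb, mul_comm r, ← hr]; ring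
  · rw [mul_comm r, ← hr]
    linear_combination hxy

theorem exists_rational_of_mem_bigG {g : Sp2} (hg : g ∈ bigG) :
    ∃ (c : ℝ) (A : Fin 2 ⊕ Fin 2 → Fin 2 ⊕ Fin 2 → ℤ),
      c ≠ 0 ∧ ∀ i j, (g : Mat4) i j = c * A i j := by
  obtain ⟨m, hm, A, hA⟩ := hg
  have hs : Real.sqrt m ≠ 0 := Real.sqrt_ne_zero'.2 (by exact_mod_cast hm)
  refine ⟨(Real.sqrt m)⁻¹, A, inv_ne_zero hs, fun i j => ?_⟩
  have h := congrFun₂ hA i j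
  rw [Matrix.smul_apply, Matrix.map_apply, smul_eq_mul] at h
  rw [← h, inv_mul_cancel_left₀ hs]

theorem exists_special13_mul_eq_zero {g : Sp2} (hg : g ∈ bigG) (j : Fin 2 ⊕ Fin 2) :
    ∃ (α β γ δ : ℤ) (h : α * δ - β * γ = 1),
      ((special13 α β γ δ h * g : Sp2) : Mat4) e₁ j = 0 := by
  obtain ⟨c, A, -, hA⟩ := exists_rational_of_mem_bigG hg
  obtain ⟨α, β, γ, δ, h, h0⟩ := exists_det_one_mul_add_mul_eq_zero (A e₁ j) (A e₃ j)
  have h0' : (α : ℝ) * A e₁ j + β * A e₃ j = 0 := by exact_mod_cast h0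
  refine ⟨α, β, γ, δ, h, ?_⟩
  rw [special13_mul₁, hA, hA]
  linear_combination c * h0'

theorem exists_special24_mul_eq_zero (hN : N ≠ 0) {g : Sp2} (hg : g ∈ bigG)
    (j : Fin 2 ⊕ Fin 2) :
    ∃ (α β γ δ : ℤ) (h : α * δ - β * γ = 1),
      ((special24 N hN α β γ δ h * g : Sp2) : Mat4) e₂ j = 0 := by
  obtain ⟨c, A, -, hA⟩ := exists_rational_of_mem_bigG hg
  obtain ⟨α, β, γ, δ, h, h0⟩ := exists_det_one_mul_add_mul_eq_zero (A e₂ j * N) (A e₄ j)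
  have h0' : (α : ℝ) * (A e₂ j * N) + β * A e₄ j = 0 := by exact_mod_cast h0
  have hN' : (N : ℝ) ≠ 0 := Nat.cast_ne_zero.2 hN
  refine ⟨α, β, γ, δ, h, ?_⟩
  rw [special24_mul₂, hA, hA]
  field_simp
  linear_combination c * h0'

theorem exists_levi_mul_column₃_eq_zero (hN : Squarefree N) {g : Sp2} (hg : g ∈ bigG)
    (h₁ : (g : Mat4) e₁ e₃ = 0) (h₂ : (g : Mat4) e₂ e₃ = 0) :
    ∃ u ∈ extendedParamodular N, ((u * g : Sp2) : Mat4) e₁ e₃ = 0 ∧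
      ((u * g : Sp2) : Mat4) e₂ e₃ = 0 ∧ ((u * g : Sp2) : Mat4) e₄ e₃ = 0 := by
  obtain ⟨c, A, -, hA⟩ := exists_rational_of_mem_bigG hg
  have hA0 : ¬(A e₃ e₃ * N = 0 ∧ A e₄ e₃ = 0) := by
    rintro ⟨ha, hb⟩
    have ha' := (mul_eq_zero.1 ha).resolve_right (by exact_mod_cast hN.ne_zero)
    have h := column_relation g e₁ e₃
    rw [h₁, h₂, hA e₃ e₃, hA e₄ e₃, ha', hb] at h
    simp [J] at h
  obtain ⟨d, e, r, s, x, y, hd, rfl, has, hdet⟩ := exists_proportional_atkinLehner_vector hN hA0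
  have has' : (A e₃ e₃ : ℝ) * ((d * e : ℕ) : ℝ) * s = A e₄ e₃ * (r * d) := by exact_mod_cast has
  refine ⟨levi (d * e) d hd r s y x (by push_cast; linear_combination (d : ℤ) * hdet),
    levi_mem hd (Dvd.intro _ rfl) _, ?_, ?_, ?_⟩
  · rw [levi_mul₁, h₁, h₂]; simp
  · rw [levi_mul₂, h₁, h₂]; simp
  · rw [levi_mul₄, hA, hA, div_eq_zero_iff]
    exact Or.inl (by linear_combination -c * has')

theorem row₁_eq_zero_of_column₃_eq_zero {g : Sp2} (h₁ : (g : Mat4) e₁ e₃ = 0)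
    (h₂ : (g : Mat4) e₂ e₃ = 0) (h₄ : (g : Mat4) e₄ e₃ = 0) :
    (g : Mat4) e₁ e₂ = 0 ∧ (g : Mat4) e₁ e₄ = 0 := by
  have hcol : ∀ i, -((g : Mat4) e₁ i * (g : Mat4) e₃ e₃) = J (Fin 2) ℝ i e₃ := fun i => by
    have h := column_relation g i e₃
    rw [h₁, h₂, h₄] at h
    linear_combination h
  have h₃ : (g : Mat4) e₃ e₃ ≠ 0 := fun h0 => by simpa [h0, J] using hcol e₁
  exact ⟨by simpa [J, h₃] using hcol e₂, by simpa [J, h₃] using hcol e₄⟩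

/-- Lower triangular with respect to the ordering `1, 2, 4, 3` of the coordinates. -/
structure IsLowerTriangular (g : Sp2) : Prop where
  h₁₂ : (g : Mat4) e₁ e₂ = 0
  h₁₃ : (g : Mat4) e₁ e₃ = 0
  h₁₄ : (g : Mat4) e₁ e₄ = 0
  h₂₃ : (g : Mat4) e₂ e₃ = 0
  h₂₄ : (g : Mat4) e₂ e₄ = 0
  h₄₃ : (g : Mat4) e₄ e₃ = 0

theorem exists_mul_isLowerTriangular (hN : Squarefree N) {g : Sp2} (hg : g ∈ bigG) :
    ∃ u ∈ extendedParamodular N, IsLowerTriangular (u * g) := by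
  have hN0 := hN.ne_zero
  obtain ⟨α, β, γ, δ, h, h₁⟩ := exists_special13_mul_eq_zero hg e₃
  have hu₁ : special13 α β γ δ h ∈ extendedParamodular N := special13_mem h
  set u₁ := special13 α β γ δ h
  have hg₁ : u₁ * g ∈ bigG := bigG.mul_mem (extendedParamodular_le_bigG hN0 hu₁) hg
  obtain ⟨α, β, γ, δ, h, h₂⟩ := exists_special24_mul_eq_zero hN0 hg₁ e₃
  have h₁' := special24_mul₁ (u₁ * g) e₃ h (hN := hN0)
  rw [h₁] at h₁'
  have hu₂ : special24 N hN0 α β γ δ h ∈ extendedParamodular N := special24_mem hN0 h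
  set u₂ := special24 N hN0 α β γ δ h
  have hg₂ : u₂ * (u₁ * g) ∈ bigG := bigG.mul_mem (extendedParamodular_le_bigG hN0 hu₂) hg₁
  obtain ⟨u₃, hu₃, h₃₁, h₃₂, h₃₄⟩ := exists_levi_mul_column₃_eq_zero hN hg₂ h₁' h₂
  obtain ⟨h12, h14⟩ := row₁_eq_zero_of_column₃_eq_zero h₃₁ h₃₂ h₃₄
  have hg₃ : u₃ * (u₂ * (u₁ * g)) ∈ bigG :=
    bigG.mul_mem (extendedParamodular_le_bigG hN0 hu₃) hg₂
  obtain ⟨α, β, γ, δ, h, h₄⟩ := exists_special24_mul_eq_zero hN0 hg₃ e₄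
  refine ⟨special24 N hN0 α β γ δ h * (u₃ * (u₂ * u₁)),
    mul_mem (special24_mem hN0 h) (mul_mem hu₃ (mul_mem hu₂ hu₁)), ?_⟩
  rw [mul_assoc, mul_assoc, mul_assoc]
  refine ⟨?_, ?_, ?_, ?_, h₄, ?_⟩
  · rw [special24_mul₁, h12]
  · rw [special24_mul₁, h₃₁]
  · rw [special24_mul₁, h14]
  · rw [special24_mul₂, h₃₂, h₃₄]; simp
  · rw [special24_mul₄, h₃₂, h₃₄]; simp

/-! ### Reduction of double cosets -/

/-- The double coset of `g` with respect to the extended paramodular group. -/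
abbrev extendedDoubleCoset (N : ℕ) (g : Sp2) : Set Sp2 :=
  DoubleCoset.doubleCoset g (extendedParamodular N) (extendedParamodular N)

theorem mul_mem_extendedDoubleCoset {v : Sp2} (g : Sp2) (hv : v ∈ extendedParamodular N) :
    g * v ∈ extendedDoubleCoset N g :=
  DoubleCoset.mem_doubleCoset.2 ⟨1, one_mem _, v, hv, by simp⟩

theorem mem_mul_extendedDoubleCoset {u : Sp2} (hu : u ∈ extendedParamodular N) (g : Sp2) :
    u * g ∈ extendedDoubleCoset N g :=
  DoubleCoset.mem_doubleCoset.2 ⟨u, hu, 1, one_mem _, by simp⟩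

theorem mem_extendedDoubleCoset_trans {g h k : Sp2} (hh : h ∈ extendedDoubleCoset N g)
    (hk : k ∈ extendedDoubleCoset N h) : k ∈ extendedDoubleCoset N g :=
  (DoubleCoset.doubleCoset_eq_of_mem hh).subset hk

theorem mem_bigG_of_mem_extendedDoubleCoset (hN : N ≠ 0) {g h : Sp2} (hg : g ∈ bigG)
    (hh : h ∈ extendedDoubleCoset N g) : h ∈ bigG := by
  obtain ⟨u, hu, v, hv, rfl⟩ := DoubleCoset.mem_doubleCoset.1 hh
  exact mul_mem (mul_mem (extendedParamodular_le_bigG hN hu) hg) (extendedParamodular_le_bigG hN hv)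

theorem IsDenominator.of_mem_extendedDoubleCoset (hN : N ≠ 0) {n : ℕ} {g h : Sp2}
    (hg : IsDenominator N n g) (hh : h ∈ extendedDoubleCoset N g) : IsDenominator N n h := by
  obtain ⟨u, hu, v, hv, rfl⟩ := DoubleCoset.mem_doubleCoset.1 hh
  exact hg.mul_mem hN hu hv

theorem IsSymmDenominator.of_mem_extendedDoubleCoset (hN : N ≠ 0) {n : ℕ} {g h : Sp2}
    (hg : IsSymmDenominator N n g) (hh : h ∈ extendedDoubleCoset N g) :
    IsSymmDenominator N n h := by
  obtain ⟨u, hu, v, hv, rfl⟩ := DoubleCoset.mem_doubleCoset.1 hh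
  exact hg.mul_mem hN hu hv

theorem exists_forall_le_of_mul_eq_natCast {α : Type*} {S : Set α} (hS : S.Nonempty) {f : α → ℝ}
    {c : ℝ} (hc : 0 < c) (hf : ∀ x ∈ S, ∃ z : ℕ, c * f x = z) : ∃ x ∈ S, ∀ y ∈ S, f x ≤ f y := by
  have hT : {z : ℕ | ∃ x ∈ S, c * f x = z}.Nonempty := by
    obtain ⟨x, hx⟩ := hS
    obtain ⟨z, hz⟩ := hf x hx
    exact ⟨z, x, hx, hz⟩
  obtain ⟨x, hx, hxz⟩ := Nat.sInf_mem hT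
  refine ⟨x, hx, fun y hy => ?_⟩
  obtain ⟨z, hz⟩ := hf y hy
  refine le_of_mul_le_mul_left ?_ hc
  rw [hxz, hz]
  exact_mod_cast Nat.sInf_le (show z ∈ {z : ℕ | ∃ x ∈ S, c * f x = z} from ⟨y, hy, hz⟩)

/-- The entry of `g` in position `(1, 1)` is non-zero, and minimal with this property in the double
coset of `g`. -/
def IsMinimal (N : ℕ) (g : Sp2) : Prop :=
  (g : Mat4) e₁ e₁ ≠ 0 ∧
    ∀ h ∈ extendedDoubleCoset N g, (h : Mat4) e₁ e₁ ≠ 0 → |(g : Mat4) e₁ e₁| ≤ |(h : Mat4) e₁ e₁|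

theorem IsMinimal.of_mem_extendedDoubleCoset {g h : Sp2} (hg : IsMinimal N g)
    (hh : h ∈ extendedDoubleCoset N g) (h11 : (h : Mat4) e₁ e₁ = (g : Mat4) e₁ e₁) :
    IsMinimal N h :=
  ⟨h11 ▸ hg.1, fun k hk => h11 ▸ hg.2 k (mem_extendedDoubleCoset_trans hh hk)⟩

theorem exists_mul_entry₁_ne_zero (hN : N ≠ 0) (g : Sp2) :
    ∃ v ∈ extendedParamodular N, ((g * v : Sp2) : Mat4) e₁ e₁ ≠ 0 := by
  have hN' : (N : ℝ) ≠ 0 := Nat.cast_ne_zero.2 hN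
  have hs : Real.sqrt N ≠ 0 := Real.sqrt_ne_zero'.2 (by exact_mod_cast Nat.pos_of_ne_zero hN)
  by_cases h1 : (g : Mat4) e₁ e₁ = 0
  swap
  · exact ⟨1, one_mem _, by rwa [mul_one]⟩
  by_cases h3 : (g : Mat4) e₁ e₃ = 0
  swap
  · exact ⟨special13 0 (-1) 1 0 (by norm_num), special13_mem _, by
      rw [mul_special13₁]; simpa using h3⟩
  have exists_of_entry₂ : ∀ g : Sp2, (g : Mat4) e₁ e₂ ≠ 0 →
      ∃ v ∈ extendedParamodular N, ((g * v : Sp2) : Mat4) e₁ e₁ ≠ 0 := fun g h =>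
    ⟨levi N N (Nat.pos_of_ne_zero hN) 0 1 (-1) 0 (by ring), levi_mem _ dvd_rfl _, by
      rw [mul_levi₁]; simp [h, hs]⟩
  by_cases h2 : (g : Mat4) e₁ e₂ = 0
  swap
  · exact exists_of_entry₂ g h2
  have h4 : (g : Mat4) e₁ e₄ ≠ 0 := fun h4 => by
    simpa [h1, h2, h3, h4, J] using row_relation g e₁ e₃
  obtain ⟨v, hv, h⟩ := exists_of_entry₂ (g * special24 N hN 0 (-1) 1 0 (by norm_num)) (by
    rw [mul_special24₂]; simp [hN', h4])
  exact ⟨_, mul_mem (special24_mem hN _) hv, by rwa [← mul_assoc]⟩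

theorem exists_isMinimal (hN : N ≠ 0) {g : Sp2} (hg : g ∈ bigG) :
    ∃ h ∈ extendedDoubleCoset N g, IsMinimal N h := by
  obtain ⟨n, hn, hden⟩ := exists_isDenominator hN hg
  obtain ⟨v, hv, hv0⟩ := exists_mul_entry₁_ne_zero hN g
  obtain ⟨h, ⟨hh, h0⟩, hmin⟩ := exists_forall_le_of_mul_eq_natCast (c := n)
    (S := {h | h ∈ extendedDoubleCoset N g ∧ (h : Mat4) e₁ e₁ ≠ 0})
    (f := fun h => (h : Mat4) e₁ e₁ ^ 2) ⟨_, mul_mem_extendedDoubleCoset g hv, hv0⟩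
    (by exact_mod_cast hn) (fun h hh => by
      obtain ⟨z, hz⟩ := (hden.of_mem_extendedDoubleCoset hN hh.1).exists_mul_entry_eq e₁
      have hw : weight N 1 e₁ e₃ = 1 := by simp [weight, indexScale, indexBlock, blockWeight]
      rw [hw, mul_one, ← sq] at hz
      have hz0 : (0 : ℝ) ≤ z := hz ▸ by positivity
      lift z to ℕ using by exact_mod_cast hz0
      exact ⟨z, by simpa using hz⟩)
  exact ⟨h, hh, h0, fun k hk hk0 =>
    sq_le_sq.1 (hmin k ⟨mem_extendedDoubleCoset_trans hh hk, hk0⟩)⟩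

theorem exists_int_mul_of_forall_abs_le {x y : ℝ} (hx : x ≠ 0)
    (h : ∀ q : ℤ, y - q * x ≠ 0 → |x| ≤ |y - q * x|) : ∃ q : ℤ, y = q * x := by
  refine ⟨⌊y / x⌋, ?_⟩
  by_contra hne
  have hle := h ⌊y / x⌋ (sub_ne_zero.2 hne)
  have hrem : y - ⌊y / x⌋ * x = Int.fract (y / x) * x := by
    rw [Int.fract]; field_simp
  rw [hrem, abs_mul, abs_of_nonneg (Int.fract_nonneg (y / x))] at hle
  nlinarith [Int.fract_lt_one (y / x), abs_pos.2 hx]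

theorem IsMinimal.exists_row₃_eq {g : Sp2} (hg : IsMinimal N g) :
    ∃ q : ℤ, (g : Mat4) e₁ e₃ = q * (g : Mat4) e₁ e₁ := by
  refine exists_int_mul_of_forall_abs_le hg.1 fun q hq => ?_
  have e : ((g * special13 (-q) (-1) 1 0 (by ring) : Sp2) : Mat4) e₁ e₁ =
      (g : Mat4) e₁ e₃ - q * (g : Mat4) e₁ e₁ := by
    rw [mul_special13₁]; push_cast; ring
  rw [← e] at hq ⊢
  exact hg.2 _ (mul_mem_extendedDoubleCoset g (special13_mem _)) hq

theorem IsMinimal.exists_column₃_eq {g : Sp2} (hg : IsMinimal N g) :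
    ∃ q : ℤ, (g : Mat4) e₃ e₁ = q * (g : Mat4) e₁ e₁ := by
  refine exists_int_mul_of_forall_abs_le hg.1 fun q hq => ?_
  have e : ((special13 (-q) 1 (-1) 0 (by ring) * g : Sp2) : Mat4) e₁ e₁ =
      (g : Mat4) e₃ e₁ - q * (g : Mat4) e₁ e₁ := by
    rw [special13_mul₁]; push_cast; ring
  rw [← e] at hq ⊢
  exact hg.2 _ (mem_mul_extendedDoubleCoset (special13_mem _) g) hq

theorem eq_one_of_abs_le_of_eq_mul_sqrt {x w : ℝ} {r : ℤ} {d : ℕ} (hd : 0 < d) (hx : x ≠ 0)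
    (h : x = r * Real.sqrt d * w) (hle : w ≠ 0 → |x| ≤ |w|) : d = 1 ∧ r * r = 1 := by
  have hw : w ≠ 0 := fun h0 => hx (by rw [h, h0, mul_zero])
  have hr : r ≠ 0 := fun h0 => hx (by rw [h, h0]; simp)
  have hsq := sq_le_sq.2 (hle hw)
  rw [h, mul_pow, mul_pow, Real.sq_sqrt (Nat.cast_nonneg d)] at hsq
  have hrd : (r : ℝ) ^ 2 * d ≤ 1 := le_of_mul_le_mul_right (by linarith) (sq_pos_of_ne_zero hw)
  have hrd' : r ^ 2 * d ≤ 1 := by exact_mod_cast hrd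
  have hr0 : 0 < r ^ 2 := by positivity
  have hd1 : (d : ℤ) = 1 := by nlinarith [Int.natCast_pos.2 hd]
  exact ⟨by exact_mod_cast hd1, by nlinarith⟩

theorem IsMinimal.exists_row₂_eq (hN : Squarefree N) {g : Sp2} (hG : g ∈ bigG)
    (hg : IsMinimal N g) :
    ∃ q : ℤ, (g : Mat4) e₁ e₂ = q * (N * (g : Mat4) e₁ e₁) := by
  obtain ⟨c, A, -, hA⟩ := exists_rational_of_mem_bigG hG
  obtain ⟨d, e, r, s, x, y, hd, hde, has, hdet⟩ :=
    exists_proportional_atkinLehner_vector hN (a := A e₁ e₁ * N) (b := A e₁ e₂) (by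
      rintro ⟨ha, -⟩
      have hA0 := (mul_eq_zero.1 ha).resolve_right (by exact_mod_cast hN.ne_zero)
      exact hg.1 (by rw [hA, hA0]; simp))
  have hlev : x * r * d * d - (-s) * (-y) * N = d := by
    rw [← hde]; push_cast; linear_combination (d : ℤ) * hdet
  have hdet' : (r : ℝ) * d * x - s * e * y = 1 := by exact_mod_cast hdet
  have hde' : (d : ℝ) * e = N := by exact_mod_cast hde
  have has' : (A e₁ e₁ : ℝ) * N * s = A e₁ e₂ * (r * d) := by exact_mod_cast has
  have hrel : (r : ℝ) * (g : Mat4) e₁ e₂ = e * s * (g : Mat4) e₁ e₁ := by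
    have hd' : (d : ℝ) ≠ 0 := by exact_mod_cast hd.ne'
    refine mul_left_cancel₀ hd' ?_
    rw [hA, hA]
    linear_combination -c * has' - c * A e₁ e₁ * s * hde'
  obtain ⟨rfl, hr⟩ := eq_one_of_abs_le_of_eq_mul_sqrt (r := r) hd hg.1
    (w := ((g * levi N d hd x (-s) (-y) r hlev : Sp2) : Mat4) e₁ e₁) (by
      rw [mul_levi₁]
      field_simp
      push_cast
      linear_combination (-(g : Mat4) e₁ e₁) * hdet' + y * hrel)
    (hg.2 _ (mul_mem_extendedDoubleCoset g (levi_mem hd (Dvd.intro _ hde) _)))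
  refine ⟨s * r, ?_⟩
  have hr' : (r : ℝ) * r = 1 := by exact_mod_cast hr
  rw [Nat.cast_one, one_mul] at hde'
  rw [← hde']
  push_cast
  linear_combination (-(g : Mat4) e₁ e₂) * hr' + r * hrel

theorem IsMinimal.exists_column₂_eq (hN : Squarefree N) {g : Sp2} (hG : g ∈ bigG)
    (hg : IsMinimal N g) :
    ∃ q : ℤ, (g : Mat4) e₂ e₁ = q * (g : Mat4) e₁ e₁ := by
  obtain ⟨c, A, -, hA⟩ := exists_rational_of_mem_bigG hG
  obtain ⟨d, e, r, s, x, y, hd, hde, has, hdet⟩ :=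
    exists_proportional_atkinLehner_vector hN (a := A e₁ e₁) (b := A e₂ e₁) (by
      rintro ⟨ha, -⟩
      exact hg.1 (by rw [hA, ha]; simp))
  have hlev : x * r * d * d - (-y) * (-s) * N = d := by
    rw [← hde]; push_cast; linear_combination (d : ℤ) * hdet
  have hdet' : (r : ℝ) * d * x - s * e * y = 1 := by exact_mod_cast hdet
  have hde' : (d : ℝ) * e = N := by exact_mod_cast hde
  have has' : (A e₁ e₁ : ℝ) * s = A e₂ e₁ * (r * d) := by exact_mod_cast has
  have hrel : (r : ℝ) * d * (g : Mat4) e₂ e₁ = s * (g : Mat4) e₁ e₁ := by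
    rw [hA, hA]
    linear_combination -c * has'
  obtain ⟨rfl, hr⟩ := eq_one_of_abs_le_of_eq_mul_sqrt (r := r) hd hg.1
    (w := ((levi N d hd x (-y) (-s) r hlev * g : Sp2) : Mat4) e₁ e₁) (by
      rw [levi_mul₁]
      field_simp
      push_cast
      rw [← hde']
      linear_combination (-(g : Mat4) e₁ e₁) * hdet' + y * e * hrel)
    (hg.2 _ (mem_mul_extendedDoubleCoset (levi_mem hd (Dvd.intro _ hde) _) g))
  refine ⟨s * r, ?_⟩
  have hr' : (r : ℝ) * r = 1 := by exact_mod_cast hr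
  rw [Nat.cast_one, mul_one] at hrel
  push_cast
  linear_combination (-(g : Mat4) e₂ e₁) * hr' + r * hrel

/-- The first row of `g` vanishes outside the diagonal. -/
structure HasClearRow (g : Sp2) : Prop where
  row₂ : (g : Mat4) e₁ e₂ = 0
  row₃ : (g : Mat4) e₁ e₃ = 0
  row₄ : (g : Mat4) e₁ e₄ = 0

/-- The first row and the first column of `g` vanish outside the diagonal. -/
structure HasClearCross (g : Sp2) : Prop extends HasClearRow g where
  column₂ : (g : Mat4) e₂ e₁ = 0
  column₃ : (g : Mat4) e₃ e₁ = 0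
  column₄ : (g : Mat4) e₄ e₁ = 0

theorem exists_mul_special24_eq_zero (hN : N ≠ 0) {g : Sp2} (hG : g ∈ bigG) (i : Fin 2 ⊕ Fin 2) :
    ∃ (α β γ δ : ℤ) (h : α * δ - β * γ = 1),
      ((g * special24 N hN α β γ δ h : Sp2) : Mat4) i e₄ = 0 := by
  have hN' : (N : ℝ) ≠ 0 := Nat.cast_ne_zero.2 hN
  obtain ⟨c, A, -, hA⟩ := exists_rational_of_mem_bigG hG
  obtain ⟨α, β, γ, δ, h, h0⟩ := exists_det_one_mul_add_mul_eq_zero (A i e₂) (A i e₄ * N)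
  refine ⟨-γ, α, -δ, β, by linear_combination h, ?_⟩
  have h0' : (α : ℝ) * A i e₂ + β * (A i e₄ * N) = 0 := by exact_mod_cast h0
  rw [mul_special24₄, hA, hA]
  field_simp
  linear_combination c * h0'

theorem IsMinimal.exists_hasClearRow (hN : Squarefree N) {g : Sp2} (hG : g ∈ bigG)
    (hg : IsMinimal N g) : ∃ h ∈ extendedDoubleCoset N g,
      (h : Mat4) e₁ e₁ = (g : Mat4) e₁ e₁ ∧ HasClearRow h := by
  have hN0 := hN.ne_zero
  obtain ⟨α, β, γ, δ, h, h14⟩ := exists_mul_special24_eq_zero hN0 hG e₁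
  have h11 := mul_special24₁ g e₁ h (hN := hN0)
  have hm₁ := mul_mem_extendedDoubleCoset g (special24_mem hN0 h)
  set g₁ := g * special24 N hN0 α β γ δ h
  have hg₁ := hg.of_mem_extendedDoubleCoset hm₁ h11
  obtain ⟨q, hq⟩ := hg₁.exists_row₂_eq hN (mem_bigG_of_mem_extendedDoubleCoset hN0 hG hm₁)
  set g₂ := g₁ * levi N 1 one_pos 1 (-q) 0 1 (by simp)
  have hm₂ : g₂ ∈ extendedDoubleCoset N g₁ :=
    mul_mem_extendedDoubleCoset g₁ (levi_mem _ (one_dvd N) _)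
  have h11₂ : (g₂ : Mat4) e₁ e₁ = (g₁ : Mat4) e₁ e₁ := by rw [mul_levi₁]; simp
  have h12₂ : (g₂ : Mat4) e₁ e₂ = 0 := by rw [mul_levi₂, hq]; simp; ring
  have h14₂ : (g₂ : Mat4) e₁ e₄ = 0 := by rw [mul_levi₄, h14]; simp
  obtain ⟨q', hq'⟩ := (hg₁.of_mem_extendedDoubleCoset hm₂ h11₂).exists_row₃_eq
  refine ⟨g₂ * special13 1 (-q') 0 1 (by ring), mem_extendedDoubleCoset_trans hm₁
    (mem_extendedDoubleCoset_trans hm₂ (mul_mem_extendedDoubleCoset g₂ (special13_mem _))), ?_⟩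
  refine ⟨?_, ?_, ?_, ?_⟩
  · rw [mul_special13₁, h11₂, h11]; simp
  · rw [mul_special13₂, h12₂]
  · rw [mul_special13₃, hq']; push_cast; ring
  · rw [mul_special13₄, h14₂]

theorem exists_special24_mul_row₄_eq_zero (hN : N ≠ 0) {g : Sp2} (hG : g ∈ bigG)
    (j : Fin 2 ⊕ Fin 2) : ∃ (α β γ δ : ℤ) (h : α * δ - β * γ = 1),
      ((special24 N hN α β γ δ h * g : Sp2) : Mat4) e₄ j = 0 := by
  have hN' : (N : ℝ) ≠ 0 := Nat.cast_ne_zero.2 hN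
  obtain ⟨α, β, γ, δ, h, h0⟩ := exists_special24_mul_eq_zero hN hG j
  refine ⟨-γ, -δ, α, β, by linear_combination h, ?_⟩
  rw [special24_mul₂] at h0
  rw [special24_mul₄]
  field_simp at h0
  linear_combination h0

theorem HasClearRow.exists_hasClearCross (hN : Squarefree N) {g : Sp2} (hG : g ∈ bigG)
    (hg : IsMinimal N g) (hrow : HasClearRow g) : ∃ h ∈ extendedDoubleCoset N g,
      (h : Mat4) e₁ e₁ = (g : Mat4) e₁ e₁ ∧ HasClearCross h := by
  have hN0 := hN.ne_zero
  obtain ⟨α, β, γ, δ, h, h41⟩ := exists_special24_mul_row₄_eq_zero hN0 hG e₁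
  have h1 := fun j => special24_mul₁ g j h (hN := hN0)
  have hm₁ := mem_mul_extendedDoubleCoset (special24_mem hN0 h) g
  set g₁ := special24 N hN0 α β γ δ h * g
  have hg₁ := hg.of_mem_extendedDoubleCoset hm₁ (h1 _)
  obtain ⟨q, hq⟩ := hg₁.exists_column₂_eq hN (mem_bigG_of_mem_extendedDoubleCoset hN0 hG hm₁)
  set g₂ := levi N 1 one_pos 1 0 (-q) 1 (by simp) * g₁
  have hm₂ : g₂ ∈ extendedDoubleCoset N g₁ :=
    mem_mul_extendedDoubleCoset (levi_mem _ (one_dvd N) _) g₁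
  have h1₂ : ∀ j, (g₂ : Mat4) e₁ j = (g : Mat4) e₁ j := fun j => by rw [levi_mul₁, h1]; simp
  have h21₂ : (g₂ : Mat4) e₂ e₁ = 0 := by rw [levi_mul₂, hq]; simp
  have h41₂ : (g₂ : Mat4) e₄ e₁ = 0 := by rw [levi_mul₄, h41]; simp
  obtain ⟨q', hq'⟩ := (hg₁.of_mem_extendedDoubleCoset hm₂ (by rw [h1₂, h1])).exists_column₃_eq
  have h1₃ : ∀ j, ((special13 1 0 (-q') 1 (by ring) * g₂ : Sp2) : Mat4) e₁ j =
      (g : Mat4) e₁ j := fun j => by rw [special13_mul₁, h1₂]; simp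
  refine ⟨special13 1 0 (-q') 1 (by ring) * g₂, mem_extendedDoubleCoset_trans hm₁
    (mem_extendedDoubleCoset_trans hm₂ (mem_mul_extendedDoubleCoset (special13_mem _) g₂)),
    h1₃ _, ⟨⟨by rw [h1₃, hrow.row₂], by rw [h1₃, hrow.row₃], by rw [h1₃, hrow.row₄]⟩,
      ?_, ?_, ?_⟩⟩
  · rw [special13_mul₂, h21₂]
  · rw [special13_mul₃, hq']; push_cast; ring
  · rw [special13_mul₄, h41₂]

namespace HasClearCross

variable {g : Sp2} (hg : HasClearCross g)
include hg

theorem special24_mul {hN : N ≠ 0} {α β γ δ : ℤ} (h : α * δ - β * γ = 1) :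
    HasClearCross (special24 N hN α β γ δ h * g) where
  row₂ := by rw [special24_mul₁, hg.row₂]
  row₃ := by rw [special24_mul₁, hg.row₃]
  row₄ := by rw [special24_mul₁, hg.row₄]
  column₂ := by rw [special24_mul₂, hg.column₂, hg.column₄]; simp
  column₃ := by rw [special24_mul₃, hg.column₃]
  column₄ := by rw [special24_mul₄, hg.column₂, hg.column₄]; simp

theorem mul_special24 {hN : N ≠ 0} {α β γ δ : ℤ} (h : α * δ - β * γ = 1) :
    HasClearCross (g * special24 N hN α β γ δ h) where
  row₂ := by rw [mul_special24₂, hg.row₂, hg.row₄]; simp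
  row₃ := by rw [mul_special24₃, hg.row₃]
  row₄ := by rw [mul_special24₄, hg.row₂, hg.row₄]; simp
  column₂ := by rw [mul_special24₁, hg.column₂]
  column₃ := by rw [mul_special24₁, hg.column₃]
  column₄ := by rw [mul_special24₁, hg.column₄]

theorem exists_entry₂_ne_zero (hN : N ≠ 0) : ∃ h ∈ extendedDoubleCoset N g,
    (h : Mat4) e₁ e₁ = (g : Mat4) e₁ e₁ ∧ HasClearCross h ∧ (h : Mat4) e₂ e₂ ≠ 0 := by
  have hN' : (N : ℝ) ≠ 0 := Nat.cast_ne_zero.2 hN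
  by_cases h22 : (g : Mat4) e₂ e₂ = 0
  swap
  · exact ⟨g, DoubleCoset.mem_doubleCoset_self _ _ g, rfl, hg, h22⟩
  have h24 : (g : Mat4) e₂ e₄ ≠ 0 := fun h24 => by
    simpa [h22, hg.column₂, hg.column₄, h24, J] using row_relation g e₂ e₄
  refine ⟨g * special24 N hN 0 (-1) 1 0 (by norm_num),
    mul_mem_extendedDoubleCoset g (special24_mem hN _), mul_special24₁ _ _ _,
    hg.mul_special24 _, ?_⟩
  rw [mul_special24₂, h22]
  simp [hN', h24]

end HasClearCross

/-- The first row and column of `g` are clear, and the entries in the positions `(1, 1)` and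
`(2, 2)` are successively minimal in the double coset. -/
structure IsReduced (N : ℕ) (g : Sp2) : Prop extends HasClearCross g where
  minimal : IsMinimal N g
  ne_zero : (g : Mat4) e₂ e₂ ≠ 0
  le : ∀ h ∈ extendedDoubleCoset N g, (h : Mat4) e₁ e₁ = (g : Mat4) e₁ e₁ → HasClearCross h →
    (h : Mat4) e₂ e₂ ≠ 0 → |(g : Mat4) e₂ e₂| ≤ |(h : Mat4) e₂ e₂|

theorem exists_isReduced (hN : Squarefree N) {g : Sp2} (hG : g ∈ bigG) :
    ∃ h ∈ extendedDoubleCoset N g, IsReduced N h := by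
  have hN0 := hN.ne_zero
  obtain ⟨g₀, hm₀, hmin⟩ := exists_isMinimal hN0 hG
  have hG₀ := mem_bigG_of_mem_extendedDoubleCoset hN0 hG hm₀
  obtain ⟨g₁, hm₁, h11₁, hrow⟩ := hmin.exists_hasClearRow hN hG₀
  obtain ⟨g₂, hm₂, h11₂, hcross⟩ := hrow.exists_hasClearCross hN
    (mem_bigG_of_mem_extendedDoubleCoset hN0 hG₀ hm₁) (hmin.of_mem_extendedDoubleCoset hm₁ h11₁)
  obtain ⟨g₃, hm₃, h11₃, hcross₃, h22₃⟩ := hcross.exists_entry₂_ne_zero hN0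
  obtain ⟨n, hn, hden⟩ := exists_isDenominator hN0 hG₀
  obtain ⟨h, ⟨hh, h11, hcl, h22⟩, hle⟩ := exists_forall_le_of_mul_eq_natCast
    (S := {h | h ∈ extendedDoubleCoset N g₀ ∧ (h : Mat4) e₁ e₁ = (g₀ : Mat4) e₁ e₁ ∧
      HasClearCross h ∧ (h : Mat4) e₂ e₂ ≠ 0})
    (f := fun h => |(h : Mat4) e₂ e₂|) (c := n * |(g₀ : Mat4) e₁ e₁|)
    ⟨g₃, mem_extendedDoubleCoset_trans hm₁ (mem_extendedDoubleCoset_trans hm₂ hm₃),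
      by rw [h11₃, h11₂, h11₁], hcross₃, h22₃⟩
    (mul_pos (by exact_mod_cast hn) (abs_pos.2 hmin.1)) (fun h ⟨hh, h11, hcl, _⟩ => by
      obtain ⟨z, hz⟩ :=
        (hden.of_mem_extendedDoubleCoset hN0 hh).isSymmDenominator.exists_mul_minor_eq hN0 e₂
      have hw : weight N 1 e₂ e₃ = 1 := by simp [weight, indexScale, indexBlock, blockWeight]
      rw [hw, mul_one, hcl.row₂, h11, mul_zero, sub_zero] at hz
      refine ⟨z.natAbs, ?_⟩
      rw [Nat.cast_natAbs, Int.cast_abs, ← hz, abs_mul, abs_mul, Nat.abs_cast]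
      ring)
  refine ⟨h, mem_extendedDoubleCoset_trans hm₀ hh, hcl, hmin.of_mem_extendedDoubleCoset hh h11, h22,
    fun k hk hk11 hkcl hk22 => hle k ⟨mem_extendedDoubleCoset_trans hh hk, ?_, hkcl, hk22⟩⟩
  rw [hk11, h11]

theorem IsReduced.of_mem_extendedDoubleCoset {g h : Sp2} (hg : IsReduced N g)
    (hh : h ∈ extendedDoubleCoset N g) (h11 : (h : Mat4) e₁ e₁ = (g : Mat4) e₁ e₁)
    (hcross : HasClearCross h) (h22 : (h : Mat4) e₂ e₂ = (g : Mat4) e₂ e₂) : IsReduced N h :=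
  ⟨hcross, hg.minimal.of_mem_extendedDoubleCoset hh h11, h22 ▸ hg.ne_zero,
    fun k hk h11' hk' h0 =>
      h22 ▸ hg.le k (mem_extendedDoubleCoset_trans hh hk) (h11'.trans h11) hk' h0⟩

theorem IsReduced.exists_row₄_eq (hN : N ≠ 0) {g : Sp2} (hg : IsReduced N g) :
    ∃ q : ℤ, N * (g : Mat4) e₂ e₄ = q * (g : Mat4) e₂ e₂ := by
  refine exists_int_mul_of_forall_abs_le hg.ne_zero fun q hq => ?_
  have e : ((g * special24 N hN (-q) (-1) 1 0 (by ring) : Sp2) : Mat4) e₂ e₂ =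
      N * (g : Mat4) e₂ e₄ - q * (g : Mat4) e₂ e₂ := by
    rw [mul_special24₂]; push_cast; ring
  rw [← e] at hq ⊢
  exact hg.le _ (mul_mem_extendedDoubleCoset g (special24_mem hN _)) (mul_special24₁ _ _ _)
    (hg.mul_special24 _) hq

theorem IsReduced.exists_column₄_eq (hN : N ≠ 0) {g : Sp2} (hg : IsReduced N g) :
    ∃ q : ℤ, (g : Mat4) e₄ e₂ / N = q * (g : Mat4) e₂ e₂ := by
  refine exists_int_mul_of_forall_abs_le hg.ne_zero fun q hq => ?_
  have e : ((special24 N hN (-q) 1 (-1) 0 (by ring) * g : Sp2) : Mat4) e₂ e₂ =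
      (g : Mat4) e₄ e₂ / N - q * (g : Mat4) e₂ e₂ := by
    rw [special24_mul₂]; push_cast; ring
  rw [← e] at hq ⊢
  exact hg.le _ (mem_mul_extendedDoubleCoset (special24_mem hN _) g) (special24_mul₁ _ _ _)
    (hg.special24_mul _) hq

theorem IsReduced.exists_diagonal (hN : N ≠ 0) {g : Sp2} (hg : IsReduced N g) :
    ∃ h ∈ extendedDoubleCoset N g,
      IsReduced N h ∧ (h : Mat4) e₂ e₄ = 0 ∧ (h : Mat4) e₄ e₂ = 0 := by
  have hN' : (N : ℝ) ≠ 0 := Nat.cast_ne_zero.2 hN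
  obtain ⟨q, hq⟩ := hg.exists_row₄_eq hN
  set g₁ := g * special24 N hN 1 (-q) 0 1 (by ring)
  have hm₁ : g₁ ∈ extendedDoubleCoset N g := mul_mem_extendedDoubleCoset g (special24_mem hN _)
  have h24 : (g₁ : Mat4) e₂ e₄ = 0 := by
    rw [mul_special24₄]
    field_simp
    push_cast
    linear_combination hq
  have hg₁ : IsReduced N g₁ := hg.of_mem_extendedDoubleCoset hm₁ (mul_special24₁ _ _ _)
    (hg.mul_special24 _) (by rw [mul_special24₂]; simp)
  obtain ⟨q', hq'⟩ := hg₁.exists_column₄_eq hN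
  have hm₂ := mem_mul_extendedDoubleCoset (special24_mem hN (α := 1) (β := 0) (γ := -q') (δ := 1)
    (by ring)) g₁
  refine ⟨_, mem_extendedDoubleCoset_trans hm₁ hm₂, hg₁.of_mem_extendedDoubleCoset hm₂
    (special24_mul₁ _ _ _) (hg₁.special24_mul _) (by rw [special24_mul₂]; simp), ?_, ?_⟩
  · rw [special24_mul₂, h24]; simp
  · rw [special24_mul₄]
    push_cast
    rw [div_eq_iff hN'] at hq'
    linear_combination hq'

theorem HasClearCross.coe_eq_diagonal {g : Sp2} (hg : HasClearCross g)
    (h24 : (g : Mat4) e₂ e₄ = 0) (h42 : (g : Mat4) e₄ e₂ = 0) :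
    (g : Mat4) = diagonal (Sum.elim ![(g : Mat4) e₁ e₁, (g : Mat4) e₂ e₂]
      ![((g : Mat4) e₁ e₁)⁻¹, ((g : Mat4) e₂ e₂)⁻¹]) := by
  have hr : ∀ j, -((g : Mat4) e₁ e₁ * (g : Mat4) j e₃) = J (Fin 2) ℝ e₁ j := fun j => by
    have h := row_relation g e₁ j
    rw [hg.row₂, hg.row₃, hg.row₄] at h
    linear_combination h
  have hc : ∀ j, -((g : Mat4) e₁ e₁ * (g : Mat4) e₃ j) = J (Fin 2) ℝ e₁ j := fun j => by
    have h := column_relation g e₁ j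
    rw [hg.column₂, hg.column₃, hg.column₄] at h
    linear_combination h
  have h33 : (g : Mat4) e₁ e₁ * (g : Mat4) e₃ e₃ = 1 := by simpa [J] using hr e₃
  have h11 := left_ne_zero_of_mul_eq_one h33
  have h23 : (g : Mat4) e₂ e₃ = 0 := by simpa [J, h11] using hr e₂
  have h43 : (g : Mat4) e₄ e₃ = 0 := by simpa [J, h11] using hr e₄
  have h32 : (g : Mat4) e₃ e₂ = 0 := by simpa [J, h11] using hc e₂
  have h34 : (g : Mat4) e₃ e₄ = 0 := by simpa [J, h11] using hc e₄
  have h44 : (g : Mat4) e₂ e₂ * (g : Mat4) e₄ e₄ = 1 := by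
    have h := row_relation g e₂ e₄
    rw [h24, h23, hg.column₂] at h
    simpa [J] using h
  ext i j
  revert i j
  simp [hg.row₂, hg.row₃, hg.row₄, hg.column₂, hg.column₃, hg.column₄, h24, h42, h23,
    h43, h32, h34, eq_inv_of_mul_eq_one_right h33, eq_inv_of_mul_eq_one_right h44]

theorem IsReduced.exists_entry₂_eq_mul_entry₁ (hN : Squarefree N) {g : Sp2} (hG : g ∈ bigG)
    (hg : IsReduced N g) : ∃ q : ℤ, (g : Mat4) e₂ e₂ = q * (g : Mat4) e₁ e₁ := by
  set h := levi N 1 one_pos 1 1 0 1 (by simp) * g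
  have hm : h ∈ extendedDoubleCoset N g := mem_mul_extendedDoubleCoset (levi_mem _ (one_dvd N) _) g
  have h11 : (h : Mat4) e₁ e₁ = (g : Mat4) e₁ e₁ := by rw [levi_mul₁, hg.column₂]; simp
  obtain ⟨q, hq⟩ := (hg.minimal.of_mem_extendedDoubleCoset hm h11).exists_row₂_eq hN
    (mem_bigG_of_mem_extendedDoubleCoset hN.ne_zero hG hm)
  refine ⟨q, mul_left_cancel₀ (Nat.cast_ne_zero.2 hN.ne_zero : (N : ℝ) ≠ 0) ?_⟩
  rw [h11, levi_mul₁, hg.row₂] at hq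
  norm_num at hq
  linear_combination hq

theorem IsReduced.exists_mul_entry₂_sq_eq_one (hN : N ≠ 0) {g : Sp2} (hg : IsReduced N g)
    (h24 : (g : Mat4) e₂ e₄ = 0) (h42 : (g : Mat4) e₄ e₂ = 0) :
    ∃ q : ℤ, q * (g : Mat4) e₂ e₂ ^ 2 = 1 := by
  set h := special24 N hN 1 1 0 1 (by ring) * g
  have h22 : (h : Mat4) e₂ e₂ = (g : Mat4) e₂ e₂ := by rw [special24_mul₂, h42]; simp
  obtain ⟨q, hq⟩ := (hg.of_mem_extendedDoubleCoset
    (mem_mul_extendedDoubleCoset (special24_mem hN _) g) (special24_mul₁ _ _ _)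
    (hg.special24_mul _) h22).exists_row₄_eq hN
  have h44 : (g : Mat4) e₄ e₄ = ((g : Mat4) e₂ e₂)⁻¹ := by
    conv_lhs => rw [hg.coe_eq_diagonal h24 h42]
    simp
  rw [h22, special24_mul₂, h24, h44] at hq
  have hb := hg.ne_zero
  field_simp at hq
  exact ⟨q, by push_cast at hq; linear_combination -hq⟩

theorem exists_pnat_abs_eq {a b : ℝ} {q r : ℤ} (hab : b = q * a) (hb : r * b ^ 2 = 1) :
    ∃ s l : ℕ+, |a| = (Real.sqrt s * l)⁻¹ ∧ |b| = (Real.sqrt s)⁻¹ := by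
  have hr : 0 < r := by
    have h : (0 : ℝ) < r := pos_of_mul_pos_left (hb ▸ one_pos) (sq_nonneg b)
    exact_mod_cast h
  have hq : q ≠ 0 := fun h0 => by simp [hab, h0] at hb
  lift r to ℕ using hr.le
  have hq' : |(q : ℝ)| ≠ 0 := abs_ne_zero.2 (by exact_mod_cast hq)
  have hb' : |b| = (Real.sqrt r)⁻¹ := by
    rw [← Real.sqrt_inv, ← Real.sqrt_sq_eq_abs]
    congr 1
    exact eq_inv_of_mul_eq_one_right (by exact_mod_cast hb)
  refine ⟨⟨r, by exact_mod_cast hr⟩, ⟨q.natAbs, Int.natAbs_pos.2 hq⟩, ?_, hb'⟩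
  rw [PNat.mk_coe, PNat.mk_coe, Nat.cast_natAbs, Int.cast_abs, mul_inv, ← hb', hab, abs_mul,
    mul_comm |(q : ℝ)|, mul_inv_cancel_right₀ hq']

theorem coe_diagElement {m : ℕ} (hm : 0 < m) {a d : Fin 2 → ℤ} (h : ∀ i, a i * d i = m) :
    ((diagElement m hm a d h : Sp2) : Mat4) =
      diagonal (Sum.elim (fun i => a i / Real.sqrt m) fun i => d i / Real.sqrt m) := by
  change (1 / Real.sqrt m) • fromBlocks (diagonal fun i => (a i : ℝ)) 0 0 (diagonal _) = _
  rw [fromBlocks_diagonal, ← diagonal_smul]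
  refine congrArg diagonal (funext fun i => ?_)
  rcases i with i | i <;> simp [div_eq_inv_mul]

/-- The representative `(1 / √m) diag(1, k, m, s k)`, `m = s k²`, of a double coset, indexed by
`(s, k)`. -/
def elementaryDivisor (i : ℕ+ × ℕ+) : bigG :=
  diagElement ((i.1 : ℕ) * (i.2 : ℕ) ^ 2) (Nat.mul_pos i.1.pos (pow_pos i.2.pos 2))
    ![1, (i.2 : ℕ)] ![((i.1 : ℕ) * (i.2 : ℕ) ^ 2 : ℕ), ((i.1 : ℕ) * (i.2 : ℕ) : ℕ)] (by
      intro j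
      fin_cases j
      · simp
      · simp only [Fin.mk_one, cons_val_one, cons_val_fin_one, Nat.cast_mul, Nat.cast_pow]; ring)

/-- The diagonal of `elementaryDivisor`. -/
def divisorEntry (i : ℕ+ × ℕ+) : Fin 2 ⊕ Fin 2 → ℝ :=
  Sum.elim ![(Real.sqrt i.1 * i.2)⁻¹, (Real.sqrt i.1)⁻¹] ![Real.sqrt i.1 * i.2, Real.sqrt i.1]

theorem coe_elementaryDivisor (i : ℕ+ × ℕ+) :
    ((elementaryDivisor i : Sp2) : Mat4) = diagonal (divisorEntry i) := by
  have h1 : Real.sqrt (i.1 : ℕ) ≠ 0 := Real.sqrt_ne_zero'.2 (by exact_mod_cast i.1.pos)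
  have h3 : Real.sqrt (i.1 : ℕ) ^ 2 = (i.1 : ℕ) := Real.sq_sqrt (Nat.cast_nonneg _)
  have hs : Real.sqrt (((i.1 : ℕ) * (i.2 : ℕ) ^ 2 : ℕ) : ℝ) = Real.sqrt (i.1 : ℕ) * (i.2 : ℕ) := by
    rw [Nat.cast_mul, Nat.cast_pow, Real.sqrt_mul (Nat.cast_nonneg _),
      Real.sqrt_sq (Nat.cast_nonneg _)]
  have hk : ((i.2 : ℕ) : ℝ) ≠ 0 := by exact_mod_cast i.2.ne_zero
  rw [elementaryDivisor, coe_diagElement, hs]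
  refine congrArg diagonal (funext (forall_index.2 ⟨?_, ?_, ?_, ?_⟩)) <;>
    simp [divisorEntry] <;> field_simp <;> simp [h3]

theorem exists_sign_mul_eq_abs (x : ℝ) :
    ∃ σ : ℤ, σ * σ = 1 ∧ σ * x = |x| ∧ σ * x⁻¹ = |x|⁻¹ := by
  rcases abs_choice x with h | h
  · exact ⟨1, by norm_num, by simp [h], by simp [h]⟩
  · exact ⟨-1, by norm_num, by simp [h], by simp [h]⟩

theorem exists_mul_eq_diagonal_abs (hN : N ≠ 0) {g : Sp2} {a b : ℝ}
    (hg : (g : Mat4) = diagonal (Sum.elim ![a, b] ![a⁻¹, b⁻¹])) : ∃ u ∈ extendedParamodular N,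
      ((u * g : Sp2) : Mat4) = diagonal (Sum.elim ![|a|, |b|] ![|a|⁻¹, |b|⁻¹]) := by
  obtain ⟨σ, hσ, hσa, hσa'⟩ := exists_sign_mul_eq_abs a
  obtain ⟨τ, hτ, hτb, hτb'⟩ := exists_sign_mul_eq_abs b
  refine ⟨special13 σ 0 0 σ (by linear_combination hσ) *
    special24 N hN τ 0 0 τ (by linear_combination hτ),
    mul_mem (special13_mem _) (special24_mem hN _), ?_⟩
  ext i j
  revert i j
  simp only [mul_assoc, forall_index, special13_mul₁, special13_mul₂, special13_mul₃,
    special13_mul₄, special24_mul₁, special24_mul₂, special24_mul₃, special24_mul₄, hg]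
  simp [hσa, hσa', hτb, hτb']

/- A reduced element is diagonal up to the action on the coordinates `2` and `4`, and the minimality
of its entries `a`, `b` makes `b / a` and `1 / b²` integers. -/
theorem exists_elementaryDivisor (hN : Squarefree N) {g : Sp2} (hG : g ∈ bigG) :
    ∃ i, (elementaryDivisor i : Sp2) ∈ extendedDoubleCoset N g := by
  have hN0 := hN.ne_zero
  obtain ⟨h, hh, hred⟩ := exists_isReduced hN hG
  obtain ⟨k, hk, hk_red, h24, h42⟩ := hred.exists_diagonal hN0
  have hkg := mem_extendedDoubleCoset_trans hh hk
  obtain ⟨q, hq⟩ := hk_red.exists_entry₂_eq_mul_entry₁ hN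
    (mem_bigG_of_mem_extendedDoubleCoset hN0 hG hkg)
  obtain ⟨r, hr⟩ := hk_red.exists_mul_entry₂_sq_eq_one hN0 h24 h42
  obtain ⟨s, l, hs, hl⟩ := exists_pnat_abs_eq hq hr
  obtain ⟨u, hu, huk⟩ := exists_mul_eq_diagonal_abs hN0 (hk_red.coe_eq_diagonal h24 h42)
  have heq : u * k = elementaryDivisor (s, l) := Subtype.ext (by
    rw [huk, coe_elementaryDivisor, divisorEntry, hs, hl, inv_inv, inv_inv])
  exact ⟨(s, l), heq ▸ mem_extendedDoubleCoset_trans hkg (mem_mul_extendedDoubleCoset hu k)⟩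

/-! ### Elementary divisors -/

section elementaryDivisor

variable (i j : ℕ+ × ℕ+)

/-- The least positive integer which is a denominator of `elementaryDivisor i` in the sense of
`IsDenominator`. -/
def degree : ℕ := i.1 * i.2 ^ 2

/-- The least positive integer which is a denominator of `elementaryDivisor i` in the sense of
`IsSymmDenominator`. -/
def symmDegree : ℕ := i.1 * i.2

theorem degree_mul : degree (i * j) = degree i * degree j := by
  simp [degree]
  ring

theorem symmDegree_mul : symmDegree (i * j) = symmDegree i * symmDegree j := by
  simp [symmDegree]
  ring

theorem degree_pos : 0 < degree i := Nat.mul_pos i.1.pos (pow_pos i.2.pos 2)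

theorem symmDegree_pos : 0 < symmDegree i := Nat.mul_pos i.1.pos i.2.pos

variable {i j} in
theorem eq_of_degree_eq (h : degree i = degree j) (hs : symmDegree i = symmDegree j) : i = j := by
  have degree_eq : ∀ i, degree i = symmDegree i * (i.2 : ℕ) := fun i => by
    rw [degree, symmDegree]
    ring
  have h₂ : (i.2 : ℕ) = j.2 := by
    rw [degree_eq, degree_eq, hs] at h
    exact Nat.eq_of_mul_eq_mul_left (symmDegree_pos j) h
  have h₁ : (i.1 : ℕ) = j.1 := by
    rw [symmDegree, symmDegree, h₂] at hs
    exact Nat.eq_of_mul_eq_mul_right j.2.pos hs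
  exact Prod.ext (PNat.coe_injective h₁) (PNat.coe_injective h₂)

theorem divisorEntry_mul (a : Fin 2 ⊕ Fin 2) :
    divisorEntry (i * j) a = divisorEntry i a * divisorEntry j a := by
  revert a
  simp only [forall_index, divisorEntry]
  refine ⟨?_, ?_, ?_, ?_⟩ <;> simp <;> ring

theorem elementaryDivisor_mul :
    elementaryDivisor (i * j) = elementaryDivisor i * elementaryDivisor j := by
  refine Subtype.ext (Subtype.ext ?_)
  rw [Subgroup.coe_mul, Submonoid.coe_mul, coe_elementaryDivisor, coe_elementaryDivisor,
    coe_elementaryDivisor, diagonal_mul_diagonal]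
  exact congrArg diagonal (funext (divisorEntry_mul i j))

theorem elementaryDivisor_one : elementaryDivisor 1 = 1 := by
  refine Subtype.ext (Subtype.ext ?_)
  rw [Subgroup.coe_one, Submonoid.coe_one, coe_elementaryDivisor, ← diagonal_one]
  refine congrArg diagonal (funext ?_)
  simp [divisorEntry]

theorem coe_elementaryDivisor_inv : (((elementaryDivisor i : Sp2)⁻¹ : Sp2) : Mat4) =
    diagonal fun a => divisorEntry i a.swap := by
  rw [coe_inv, coe_elementaryDivisor, sympAdjoint_eq]
  ext a b
  revert a b
  simp only [forall_index]
  simp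

theorem conj_elementaryDivisor_apply (X : Mat4) (a b : Fin 2 ⊕ Fin 2) :
    conj (elementaryDivisor i) X a b = divisorEntry i a * X a b * divisorEntry i b.swap := by
  rw [conj, coe_elementaryDivisor, coe_elementaryDivisor_inv, mul_diagonal, diagonal_mul]

theorem sqrt_fst_ne_zero : Real.sqrt (i.1 : ℕ) ≠ 0 :=
  Real.sqrt_ne_zero'.2 (Nat.cast_pos.2 i.1.pos)

theorem sqrt_fst_sq : Real.sqrt (i.1 : ℕ) ^ 2 = (i.1 : ℕ) := Real.sq_sqrt (Nat.cast_nonneg _)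

theorem degree_mul_divisorEntry : (degree i : ℝ) * (divisorEntry i e₁ * divisorEntry i e₁) = 1 := by
  have hσ₀ := sqrt_fst_ne_zero i
  simp only [degree, divisorEntry, Nat.cast_mul, Nat.cast_pow, Sum.elim_inl, cons_val_zero]
  field_simp
  exact (sqrt_fst_sq i).symm

theorem symmDegree_mul_divisorEntry :
    (symmDegree i : ℝ) * (divisorEntry i e₁ * divisorEntry i e₂) = 1 := by
  have hσ₀ := sqrt_fst_ne_zero i
  simp only [symmDegree, divisorEntry, Nat.cast_mul, Sum.elim_inl, cons_val_zero, cons_val_one]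
  field_simp
  exact (sqrt_fst_sq i).symm

theorem exists_degree_mul_divisorEntry_eq (a b : Fin 2 ⊕ Fin 2) :
    ∃ z : ℤ, (degree i : ℝ) * (divisorEntry i a * divisorEntry i b) = z := by
  have hσ₀ := sqrt_fst_ne_zero i
  have hσ := sqrt_fst_sq i
  have hk₀ : ((i.2 : ℕ) : ℝ) ≠ 0 := Nat.cast_ne_zero.2 i.2.ne_zero
  simp only [degree, divisorEntry]
  generalize Real.sqrt (i.1 : ℕ) = σ at hσ₀ hσ ⊢
  generalize (i.1 : ℕ) = s at hσ ⊢
  generalize (i.2 : ℕ) = k at hk₀ ⊢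
  revert a b
  simp only [forall_index]
  refine ⟨⟨⟨1, ?_⟩, ⟨k, ?_⟩, ⟨s * k ^ 2, ?_⟩, ⟨s * k, ?_⟩⟩,
    ⟨⟨k, ?_⟩, ⟨k ^ 2, ?_⟩, ⟨s * k ^ 3, ?_⟩, ⟨s * k ^ 2, ?_⟩⟩,
    ⟨⟨s * k ^ 2, ?_⟩, ⟨s * k ^ 3, ?_⟩, ⟨s ^ 2 * k ^ 4, ?_⟩, ⟨s ^ 2 * k ^ 3, ?_⟩⟩,
    ⟨⟨s * k, ?_⟩, ⟨s * k ^ 2, ?_⟩, ⟨s ^ 2 * k ^ 3, ?_⟩, ⟨s ^ 2 * k ^ 2, ?_⟩⟩⟩ <;>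
    simp [← hσ] <;> field_simp

theorem exists_symmDegree_mul_divisorEntry_eq {a b : Fin 2 ⊕ Fin 2} (hab : a ≠ b) :
    ∃ z : ℤ, (symmDegree i : ℝ) * (divisorEntry i a * divisorEntry i b) = z := by
  have hσ₀ := sqrt_fst_ne_zero i
  have hσ := sqrt_fst_sq i
  have hk₀ : ((i.2 : ℕ) : ℝ) ≠ 0 := Nat.cast_ne_zero.2 i.2.ne_zero
  simp only [symmDegree, divisorEntry]
  generalize Real.sqrt (i.1 : ℕ) = σ at hσ₀ hσ ⊢
  generalize (i.1 : ℕ) = s at hσ ⊢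
  generalize (i.2 : ℕ) = k at hk₀ ⊢
  revert a b
  simp only [forall_index]
  refine ⟨⟨fun h => absurd rfl h, fun _ => ⟨1, ?_⟩, fun _ => ⟨s * k, ?_⟩, fun _ => ⟨s, ?_⟩⟩,
    ⟨fun _ => ⟨1, ?_⟩, fun h => absurd rfl h, fun _ => ⟨s * k ^ 2, ?_⟩, fun _ => ⟨s * k, ?_⟩⟩,
    ⟨fun _ => ⟨s * k, ?_⟩, fun _ => ⟨s * k ^ 2, ?_⟩, fun h => absurd rfl h,
      fun _ => ⟨s ^ 2 * k ^ 2, ?_⟩⟩,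
    ⟨fun _ => ⟨s, ?_⟩, fun _ => ⟨s * k, ?_⟩, fun _ => ⟨s ^ 2 * k ^ 2, ?_⟩,
      fun h => absurd rfl h⟩⟩ <;>
    simp [← hσ] <;> field_simp

theorem IsSympSymm.apply_swap {X : Mat4} (hX : IsSympSymm X) (a : Fin 2 ⊕ Fin 2) :
    X a a.swap = 0 := by
  have h := congrFun₂ hX
  revert a
  simp only [sympAdjoint_eq, forall_index] at h ⊢
  simp only [fromBlocks_apply₁₁, fromBlocks_apply₁₂, fromBlocks_apply₂₁, fromBlocks_apply₂₂,
    of_apply, cons_val_zero, cons_val_one, cons_val_fin_one, Sum.swap_inl, Sum.swap_inr] at h ⊢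
  refine ⟨?_, ?_, ?_, ?_⟩ <;> grind

theorem isDenominator_elementaryDivisor : IsDenominator N (degree i) (elementaryDivisor i) := by
  intro X hX a b
  obtain ⟨x, hx⟩ := hX a b
  obtain ⟨z, hz⟩ := exists_degree_mul_divisorEntry_eq i a b.swap
  refine ⟨z * x, ?_⟩
  rw [Matrix.smul_apply, conj_elementaryDivisor_apply, hx, smul_eq_mul, Int.cast_mul, ← hz]
  ring

theorem isSymmDenominator_elementaryDivisor :
    IsSymmDenominator N (symmDegree i) (elementaryDivisor i) := by
  intro X hX hs a b
  rw [Matrix.smul_apply, conj_elementaryDivisor_apply, smul_eq_mul]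
  rcases eq_or_ne a b.swap with rfl | hab
  · refine ⟨0, ?_⟩
    rw [← Sum.swap_swap b, Sum.swap_swap b.swap, hs.apply_swap]
    simp
  · obtain ⟨x, hx⟩ := hX a b
    obtain ⟨z, hz⟩ := exists_symmDegree_mul_divisorEntry_eq i hab
    refine ⟨z * x, ?_⟩
    rw [hx, Int.cast_mul, ← hz]
    ring

variable {i}

theorem degree_dvd_of_isDenominator {n : ℕ} (h : IsDenominator N n (elementaryDivisor i)) :
    degree i ∣ n := by
  obtain ⟨z, hz⟩ := h.exists_mul_entry_eq e₁
  rw [coe_elementaryDivisor, diagonal_apply_eq] at hz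
  have hw : weight N 1 e₁ e₃ = 1 := by simp [weight, indexScale, indexBlock, blockWeight]
  refine Int.natCast_dvd_natCast.1 ⟨z, ?_⟩
  have : (n : ℝ) = degree i * z := by
    linear_combination (degree i : ℝ) * hz - (n : ℝ) * degree_mul_divisorEntry i +
      degree i * z * hw
  exact_mod_cast this

theorem symmDegree_dvd_of_isSymmDenominator (hN : N ≠ 0) {n : ℕ}
    (h : IsSymmDenominator N n (elementaryDivisor i)) : symmDegree i ∣ n := by
  obtain ⟨z, hz⟩ := h.exists_mul_minor_eq hN e₂
  rw [coe_elementaryDivisor, diagonal_apply_eq, diagonal_apply_eq,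
    diagonal_apply_ne _ (by simp)] at hz
  have hw : weight N 1 e₂ e₃ = 1 := by simp [weight, indexScale, indexBlock, blockWeight]
  refine Int.natCast_dvd_natCast.1 ⟨z, ?_⟩
  have : (n : ℝ) = symmDegree i * z := by
    linear_combination (symmDegree i : ℝ) * hz - (n : ℝ) * symmDegree_mul_divisorEntry i +
      symmDegree i * z * hw
  exact_mod_cast this

end elementaryDivisor

theorem mem_of_isDenominator_one (hN : Squarefree N) {g : Sp2} (hG : g ∈ bigG)
    (h : IsDenominator N 1 g) : g ∈ extendedParamodular N := by
  obtain ⟨i, hi⟩ := exists_elementaryDivisor hN hG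
  have hdegree := Nat.dvd_one.1 <|
    degree_dvd_of_isDenominator (h.of_mem_extendedDoubleCoset hN.ne_zero hi)
  have hi₁ : i = 1 := Prod.ext
    (PNat.coe_injective (Nat.eq_one_of_mul_eq_one_right hdegree))
    (PNat.coe_injective ((Nat.pow_eq_one.1 (Nat.eq_one_of_mul_eq_one_left hdegree)).resolve_right
      two_ne_zero))
  rw [hi₁, elementaryDivisor_one] at hi
  obtain ⟨u, hu, v, hv, huv⟩ := DoubleCoset.mem_doubleCoset.1 hi
  have : g = u⁻¹ * v⁻¹ := by
    rw [eq_inv_mul_iff_mul_eq, eq_inv_iff_mul_eq_one]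
    exact huv.symm
  exact this ▸ mul_mem (inv_mem hu) (inv_mem hv)

theorem exists_mul_elementaryDivisor_eq_inv_mul (hN : N ≠ 0) (i : ℕ+ × ℕ+) :
    ∃ w ∈ extendedParamodular N,
      w * (elementaryDivisor i : Sp2) = (elementaryDivisor i : Sp2)⁻¹ * w := by
  refine ⟨special13 0 (-1) 1 0 (by norm_num) * special24 N hN 0 (-1) 1 0 (by norm_num),
    mul_mem (special13_mem _) (special24_mem hN _), Subtype.ext ?_⟩
  change (_ : Mat4) * ((elementaryDivisor i : Sp2) : Mat4) =
    (((elementaryDivisor i : Sp2)⁻¹ : Sp2) : Mat4) * _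
  rw [coe_elementaryDivisor, coe_elementaryDivisor_inv]
  ext a b
  rw [mul_diagonal, diagonal_mul]
  revert a b
  simp only [forall_index, special13_mul₁, special13_mul₂, special13_mul₃, special13_mul₄]
  simp [special24, diagonalBlocks, mul_comm]

theorem inv_mem_extendedDoubleCoset (hN : Squarefree N) {g : Sp2} (hG : g ∈ bigG) :
    g⁻¹ ∈ extendedDoubleCoset N g := by
  obtain ⟨i, hi⟩ := exists_elementaryDivisor hN hG
  obtain ⟨u, hu, v, hv, huv⟩ := DoubleCoset.mem_doubleCoset.1 hi
  obtain ⟨w, hw, hwD⟩ := exists_mul_elementaryDivisor_eq_inv_mul hN.ne_zero i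
  have hg : g = u⁻¹ * elementaryDivisor i * v⁻¹ := by
    rw [huv]
    group
  refine DoubleCoset.mem_doubleCoset.2 ⟨v * w * u, mul_mem (mul_mem hv hw) hu, v * w⁻¹ * u,
    mul_mem (mul_mem hv (inv_mem hw)) hu, ?_⟩
  calc g⁻¹ = v * ((elementaryDivisor i : Sp2)⁻¹ * w) * w⁻¹ * u := by
        rw [hg]
        group
    _ = v * w * u * g * (v * w⁻¹ * u) := by
        rw [← hwD, huv]
        group

theorem exists_int_of_mul_eq_one {x y : ℝ} (hxy : x * y = 1) (hx : ∃ m : ℤ, x * x = m)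
    (hy : ∃ n : ℤ, y * y = n) : ∃ ε : ℤ, ε * ε = 1 ∧ x = ε ∧ y = ε := by
  obtain ⟨m, hm⟩ := hx
  obtain ⟨n, hn⟩ := hy
  have hm₀ : 0 ≤ m := by exact_mod_cast hm ▸ mul_self_nonneg x
  have hmn : m * n = 1 := by
    have : (m : ℝ) * n = 1 := by
      rw [← hm, ← hn]
      linear_combination (x * y + 1) * hxy
    exact_mod_cast this
  rw [Int.eq_one_of_mul_eq_one_right hm₀ hmn, Int.cast_one] at hm
  rcases mul_self_eq_one_iff.1 hm with rfl | rfl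
  · exact ⟨1, by simp, by simp, by simpa using hxy⟩
  · exact ⟨-1, by simp, by simp, by push_cast; linarith⟩

section IsLowerTriangular

variable {y : Sp2}

theorem IsLowerTriangular.entry_mul_entry (hy : IsLowerTriangular y) :
    (y : Mat4) e₁ e₁ * (y : Mat4) e₃ e₃ = 1 ∧ (y : Mat4) e₂ e₂ * (y : Mat4) e₄ e₄ = 1 := by
  obtain ⟨y12, y13, y14, y23, y24, y43⟩ := hy
  exact ⟨by simpa [J, y12, y13, y14] using row_relation y e₁ e₃,
    by simpa [J, y23, y24, y43] using row_relation y e₂ e₄⟩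

theorem IsLowerTriangular.entry₃₄_eq (hy : IsLowerTriangular y) :
    (y : Mat4) e₃ e₄ = -((y : Mat4) e₄ e₄ * (y : Mat4) e₂ e₁ * (y : Mat4) e₃ e₃) := by
  have h := row_relation y e₂ e₃
  rw [hy.h₂₃, hy.h₂₄, show J (Fin 2) ℝ e₂ e₃ = 0 by simp [J]] at h
  linear_combination -(y : Mat4) e₃ e₄ * hy.entry_mul_entry.2 - (y : Mat4) e₄ e₄ * h

theorem IsLowerTriangular.entry₃₂_eq (hy : IsLowerTriangular y) :
    (y : Mat4) e₃ e₂ = (y : Mat4) e₂ e₂ *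
      ((y : Mat4) e₃ e₃ * (y : Mat4) e₄ e₁ + (y : Mat4) e₃ e₄ * (y : Mat4) e₄ e₂) := by
  have h := row_relation y e₃ e₄
  rw [hy.h₄₃, show J (Fin 2) ℝ e₃ e₄ = 0 by simp [J]] at h
  linear_combination -(y : Mat4) e₃ e₂ * hy.entry_mul_entry.2 - (y : Mat4) e₂ e₂ * h

theorem IsLowerTriangular.mem_extendedParamodular (hN : N ≠ 0) (hy : IsLowerTriangular y)
    (hcol₁ : ∀ a, ∃ z : ℤ, (y : Mat4) a e₁ * (y : Mat4) e₁ e₁ = z * weight N 1 a e₃)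
    (hcol₂ : ∀ a, ∃ z : ℤ, (y : Mat4) a e₂ * (y : Mat4) e₁ e₁ = z * weight N 1 a e₃)
    (h₃₃ : ∃ z : ℤ, (y : Mat4) e₃ e₃ * (y : Mat4) e₃ e₃ = z)
    (h₃₄ : ∃ z : ℤ, (y : Mat4) e₃ e₃ * (y : Mat4) e₄ e₄ = z) : y ∈ extendedParamodular N := by
  have hw : weight N 1 e₁ e₃ = 1 ∧ weight N 1 e₂ e₃ = 1 ∧ weight N 1 e₃ e₃ = 1 ∧
      weight N 1 e₄ e₃ = N := by simp [weight, indexScale, indexBlock, blockWeight]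
  choose z₁ hz₁ using hcol₁
  choose z₂ hz₂ using hcol₂
  obtain ⟨z₄, hz₄⟩ := h₃₄
  obtain ⟨ε, hε, y11, y33⟩ := exists_int_of_mul_eq_one hy.entry_mul_entry.1
    ⟨z₁ e₁, by rw [hz₁, hw.1, mul_one]⟩ h₃₃
  have hε' : (ε : ℝ) * ε = 1 := by exact_mod_cast hε
  have entry_eq : ∀ {x c : ℝ}, x * ε = c → x = ε * c := fun {x c} h => by
    linear_combination ε * h - x * hε'
  have y21 := entry_eq (y11 ▸ hz₁ e₂)
  have y31 := entry_eq (y11 ▸ hz₁ e₃)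
  have y41 := entry_eq (y11 ▸ hz₁ e₄)
  have y22 := entry_eq (y11 ▸ hz₂ e₂)
  have y42 := entry_eq (y11 ▸ hz₂ e₄)
  have y44 : (y : Mat4) e₄ e₄ = ε * z₄ := entry_eq (by rw [mul_comm, ← y33, hz₄])
  have y34 := hy.entry₃₄_eq
  have y32 := hy.entry₃₂_eq
  rw [y44, y21, y33] at y34
  rw [y22, y33, y41, y34, y42] at y32
  have hN' : (N : ℝ) ≠ 0 := Nat.cast_ne_zero.2 hN
  refine mem_extendedParamodular_of_inOrder hN ?_
  simp only [InOrder, InPattern, forall_index]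
  rw [y11, hy.h₁₂, hy.h₁₃, hy.h₁₄, y21, y22, hy.h₂₃, hy.h₂₄, y31, y32, y33, y34, y41, y42, hy.h₄₃,
    y44, hw.2.1, hw.2.2.1, hw.2.2.2]
  refine ⟨⟨⟨ε, ?_⟩, ⟨0, ?_⟩, ⟨0, ?_⟩, ⟨0, ?_⟩⟩,
    ⟨⟨ε * z₁ e₂, ?_⟩, ⟨ε * z₂ e₂, ?_⟩, ⟨0, ?_⟩, ⟨0, ?_⟩⟩,
    ⟨⟨ε * z₁ e₃, ?_⟩,
      ⟨ε * z₂ e₂ * (ε * (ε * z₁ e₄) - ε * z₄ * (ε * z₁ e₂) * ε * (ε * z₂ e₄)), ?_⟩, ⟨ε, ?_⟩,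
      ⟨-(ε * z₄ * (ε * z₁ e₂) * ε), ?_⟩⟩,
    ⟨⟨ε * z₁ e₄, ?_⟩, ⟨ε * z₂ e₄, ?_⟩, ⟨0, ?_⟩, ⟨ε * z₄, ?_⟩⟩⟩ <;>
    simp [weight, indexScale, indexBlock, blockWeight, hN'] <;> ring

/- Conjugation by `y D_j` maps the elementary matrices with entry `(1, 3)` and, up to symmetry,
`(2, 3)` to matrices made of products of the entries and of the minors of the first two columns. As
`degree` and `symmDegree` exactly compensate the scaling of these by `D_j`, and similarly for
`D_i y⁻¹`, the hypotheses say that these products are integral for both `y` and `y⁻¹`. -/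
theorem IsLowerTriangular.mem_extendedParamodular_of_isDenominator (hN : N ≠ 0)
    (hy : IsLowerTriangular y) {i j : ℕ+ × ℕ+}
    (hj : IsDenominator N (degree j) (y * elementaryDivisor j))
    (hsj : IsSymmDenominator N (symmDegree j) (y * elementaryDivisor j))
    (hi : IsDenominator N (degree i) (elementaryDivisor i * y⁻¹))
    (hsi : IsSymmDenominator N (symmDegree i) (elementaryDivisor i * y⁻¹)) :
    y ∈ extendedParamodular N := by
  have entry_mul : ∀ a b, ((y * elementaryDivisor j : Sp2) : Mat4) a b =
      (y : Mat4) a b * divisorEntry j b := fun a b => by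
    rw [Submonoid.coe_mul, coe_elementaryDivisor, mul_diagonal]
  have mul_entry : ∀ a b, ((elementaryDivisor i * y⁻¹ : Sp2) : Mat4) a b =
      divisorEntry i a * sympAdjoint y a b := fun a b => by
    rw [Submonoid.coe_mul, coe_elementaryDivisor, diagonal_mul, coe_inv]
  have hdi := degree_mul_divisorEntry i
  have hsdi := symmDegree_mul_divisorEntry i
  have hdj := degree_mul_divisorEntry j
  have hsdj := symmDegree_mul_divisorEntry j
  have hw : weight N 1 e₁ e₃ = 1 ∧ weight N 1 e₂ e₃ = 1 := by
    simp [weight, indexScale, indexBlock, blockWeight]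
  refine hy.mem_extendedParamodular hN (fun a => ?_) (fun a => ?_) ?_ ?_
  · obtain ⟨z, hz⟩ := hj.exists_mul_entry_eq a
    simp only [entry_mul] at hz
    exact ⟨z, by linear_combination hz - (y : Mat4) a e₁ * (y : Mat4) e₁ e₁ * hdj⟩
  · obtain ⟨z, hz⟩ := hsj.exists_mul_minor_eq hN a
    simp only [entry_mul, hy.h₁₂] at hz
    exact ⟨z, by linear_combination hz - (y : Mat4) a e₂ * (y : Mat4) e₁ e₁ * hsdj⟩
  · obtain ⟨z, hz⟩ := hi.exists_mul_entry_eq e₁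
    simp only [mul_entry, hw.1, sympAdjoint_eq, fromBlocks_apply₁₁, of_apply, cons_val_zero] at hz
    exact ⟨z, by linear_combination hz - (y : Mat4) e₃ e₃ * (y : Mat4) e₃ e₃ * hdi⟩
  · obtain ⟨z, hz⟩ := hsi.exists_mul_minor_eq hN e₂
    simp only [mul_entry, hw.2, sympAdjoint_eq, fromBlocks_apply₁₁, of_apply, cons_val_zero,
      cons_val_one, cons_val_fin_one, hy.h₄₃] at hz
    exact ⟨z, by linear_combination hz - (y : Mat4) e₃ e₃ * (y : Mat4) e₄ e₄ * hsdi⟩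

end IsLowerTriangular

/-! ### The Hecke pair property -/

theorem InOrder.induction {P : Mat4 → Prop} (hzero : P 0) (hadd : ∀ X Y, P X → P Y → P (X + Y))
    (hsmul : ∀ (z : ℤ) X, P X → P ((z : ℝ) • X))
    (hsingle : ∀ i j, P (Matrix.single i j (weight N 1 i j))) {X : Mat4} (hX : InOrder N X) :
    P X := by
  rw [matrix_eq_sum_single X]
  refine Finset.sum_induction _ P hadd hzero fun i _ =>
    Finset.sum_induction _ P hadd hzero fun j _ => ?_
  obtain ⟨z, hz⟩ := hX i j
  rw [hz, ← smul_eq_mul, ← smul_single]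
  exact hsmul z _ (hsingle i j)

theorem conj_add (g : Sp2) (X Y : Mat4) : conj g (X + Y) = conj g X + conj g Y := by
  rw [conj, Matrix.mul_add, Matrix.add_mul, conj, conj]

theorem InOrder.conj (hN : N ≠ 0) {u : Sp2} (hu : u ∈ extendedParamodular N) {X : Mat4}
    (hX : InOrder N X) : InOrder N (conj u X) := by
  simpa using isDenominator_one_of_mem hN hu X hX

/-- The congruence modulo `m` of the conjugations with two elements, as maps on the matrices of
paramodular shape. -/
def ConjCongr (N m : ℕ) (u v : Sp2) : Prop :=
  ∀ X, InOrder N X → ∃ Z, InOrder N Z ∧ conj u X = conj v X + (m : ℝ) • Z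

theorem conjCongr_of_forall_single {m : ℕ} {u v : Sp2}
    (h : ∀ i j, ∃ Z, InOrder N Z ∧ conj u (Matrix.single i j (weight N 1 i j)) =
      conj v (Matrix.single i j (weight N 1 i j)) + (m : ℝ) • Z) : ConjCongr N m u v := by
  intro X hX
  refine hX.induction (P := fun X => ∃ Z, InOrder N Z ∧ conj u X = conj v X + (m : ℝ) • Z)
    ⟨0, fun i j => ⟨0, by simp⟩, by simp [conj]⟩ ?_ ?_ h
  · rintro X Y ⟨Z, hZ, h⟩ ⟨Z', hZ', h'⟩
    refine ⟨Z + Z', hZ.add hZ', ?_⟩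
    rw [conj_add, h, h', conj_add, smul_add]
    abel
  · rintro c X ⟨Z, hZ, h⟩
    refine ⟨(c : ℝ) • Z, hZ.intSmul c, ?_⟩
    rw [conj_smul, h, conj_smul, smul_add, smul_comm]

theorem ConjCongr.mul_left (hN : N ≠ 0) {m : ℕ} {u v w : Sp2} (h : ConjCongr N m u v)
    (hw : w ∈ extendedParamodular N) : ConjCongr N m (w * u) (w * v) := fun X hX => by
  obtain ⟨Z, hZ, h⟩ := h X hX
  exact ⟨conj w Z, hZ.conj hN hw, by rw [conj_mul, h, conj_add, conj_smul, conj_mul]⟩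

/- The classes are separated by the coordinates, modulo `m`, of the conjugates of a basis. -/
theorem exists_finite_conjCongr (hN : N ≠ 0) (m : ℕ) [NeZero m] :
    ∃ (α : Type) (_ : Finite α) (F : extendedParamodular N → α),
      ∀ u v, F u = F v → ConjCongr N m u v := by
  have hcoord (u : extendedParamodular N) (i j) :
      InOrder N (conj u (Matrix.single i j (weight N 1 i j))) :=
    .conj hN u.2 (inPattern_single ⟨1, by simp⟩)
  choose z hz using hcoord
  have : Finite (ZMod m) := .of_fintype _
  refine ⟨_, inferInstance, fun u i j k l => (z u i j k l : ZMod m), fun u v huv =>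
    conjCongr_of_forall_single fun i j => ?_⟩
  have hdvd : ∀ k l, ∃ t : ℤ, z u i j k l - z v i j k l = m * t := fun k l =>
    (ZMod.intCast_eq_intCast_iff_dvd_sub _ _ m).1
      (congrFun (congrFun (congrFun (congrFun huv i) j) k) l).symm
  choose t ht using hdvd
  refine ⟨Matrix.of fun k l => t k l * weight N 1 k l, fun k l => ⟨t k l, rfl⟩, ?_⟩
  ext k l
  have htkl : (z u i j k l : ℝ) - z v i j k l = m * t k l := by exact_mod_cast ht k l
  rw [Matrix.add_apply, Matrix.smul_apply, hz, hz, Matrix.of_apply, smul_eq_mul]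
  linear_combination weight N 1 k l * htkl

theorem isDenominator_conj_of_conjCongr {g y : Sp2} {n n' : ℕ} (hn' : 0 < n')
    (hg : IsDenominator N n g) (hg' : IsDenominator N n' g⁻¹) (hy : ConjCongr N (n * n') y 1) :
    IsDenominator N 1 (g * y * g⁻¹) := fun X hX => by
  obtain ⟨Z, hZ, h⟩ := hy _ (hg' X hX)
  have hn : (n' : ℝ) ≠ 0 := Nat.cast_ne_zero.2 hn'.ne'
  have hX' : conj y (conj g⁻¹ X) = conj g⁻¹ X + (n : ℝ) • Z := by
    refine smul_right_injective Mat4 hn ?_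
    change (n' : ℝ) • _ = (n' : ℝ) • _
    rw [← conj_smul, h, conj_one, smul_add, smul_smul, Nat.cast_mul, mul_comm (n : ℝ)]
  rw [Nat.cast_one, one_smul, mul_assoc, conj_mul, conj_mul, hX', conj_add, ← conj_mul,
    mul_inv_cancel, conj_one, conj_smul]
  exact hX.add (hg Z hZ)

theorem isHeckePair (hN : Squarefree N) : Hecke.IsHeckePair (SigmaStar N) := by
  intro g
  have hN0 := hN.ne_zero
  obtain ⟨n, hn, hg⟩ := exists_isDenominator hN0 g.2
  obtain ⟨n', hn', hg'⟩ := exists_isDenominator hN0 (inv_mem g.2)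
  have : NeZero (n * n') := ⟨(Nat.mul_pos hn hn').ne'⟩
  obtain ⟨α, _, F, hF⟩ := exists_finite_conjCongr hN0 (n * n')
  choose u hu hcoset using fun c : Hecke.cosetsIn (SigmaStar N) g => c.2
  have hu' c : (u c : Sp2) ∈ extendedParamodular N := Subgroup.mem_subgroupOf.1 (hu c)
  have hinj : Function.Injective fun c => F ⟨u c, hu' c⟩⁻¹ := fun c c' hcc' => by
    refine Subtype.ext ?_
    rw [hcoset, hcoset, Hecke.coset_eq_iff, Subgroup.mem_subgroupOf]
    have hy := (hF _ _ hcc').mul_left hN0 (hu' c')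
    rw [InvMemClass.coe_inv, InvMemClass.coe_inv, mul_inv_cancel] at hy
    refine mem_of_isDenominator_one hN (g * u c' * (g * u c)⁻¹).2 ?_
    simpa [mul_assoc] using isDenominator_conj_of_conjCongr hn' hg hg' hy
  have := Finite.of_injective _ hinj
  exact Set.toFinite _

/-! ### Leading terms -/

theorem exists_eq_mul_mul_iff_mem_extendedDoubleCoset (hN : N ≠ 0) {g h : bigG} :
    (∃ u ∈ SigmaStar N, ∃ v ∈ SigmaStar N, h = u * g * v) ↔
      (h : Sp2) ∈ extendedDoubleCoset N g := by
  rw [DoubleCoset.mem_doubleCoset]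
  constructor
  · rintro ⟨u, hu, v, hv, rfl⟩
    exact ⟨u, Subgroup.mem_subgroupOf.1 hu, v, Subgroup.mem_subgroupOf.1 hv, rfl⟩
  · rintro ⟨u, hu, v, hv, h⟩
    exact ⟨⟨u, extendedParamodular_le_bigG hN hu⟩, Subgroup.mem_subgroupOf.2 hu,
      ⟨v, extendedParamodular_le_bigG hN hv⟩, Subgroup.mem_subgroupOf.2 hv, Subtype.ext h⟩

instance commRing [hN : Fact (Squarefree N)] : CommRing (HeckeAlg N) where
  mul_comm := Hecke.mul_comm_of_inv_mem_doubleCoset fun g =>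
    (exists_eq_mul_mul_iff_mem_extendedDoubleCoset hN.out.ne_zero).2
      (inv_mem_extendedDoubleCoset hN.out g.2)

theorem coeff_eq_of_mem_extendedDoubleCoset (hN : N ≠ 0) (T : HeckeAlg N) {g h : bigG}
    (hh : (h : Sp2) ∈ extendedDoubleCoset N g) : Hecke.coeff h T = Hecke.coeff g T := by
  obtain ⟨u, hu, v, hv, rfl⟩ := (exists_eq_mul_mul_iff_mem_extendedDoubleCoset hN).2 hh
  rw [Hecke.coeff_mul_mem T hv, Hecke.coeff_mem_mul T hu]

open Classical in
theorem coeff_doubleCoset (hN : Squarefree N) (g h : bigG) :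
    Hecke.coeff h (Hecke.doubleCoset (SigmaStar N) g) =
      if (h : Sp2) ∈ extendedDoubleCoset N g then 1 else 0 := by
  simp only [Hecke.coeff_doubleCoset (isHeckePair hN),
    exists_eq_mul_mul_iff_mem_extendedDoubleCoset hN.ne_zero]

theorem mem_extendedDoubleCoset_of_coeff_doubleCoset_ne_zero (hN : Squarefree N) {g h : bigG}
    (hh : Hecke.coeff h (Hecke.doubleCoset (SigmaStar N) g) ≠ 0) :
    (h : Sp2) ∈ extendedDoubleCoset N g := by
  classical
  rw [coeff_doubleCoset hN] at hh
  exact (ite_ne_right_iff.1 hh).1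

theorem mem_sigmaStar_of_isDenominator_mul (hN : Squarefree N) {y : bigG} {i j : ℕ+ × ℕ+}
    (hj : IsDenominator N (degree j) (y * elementaryDivisor j : bigG))
    (hsj : IsSymmDenominator N (symmDegree j) (y * elementaryDivisor j : bigG))
    (hi : IsDenominator N (degree i) (elementaryDivisor i * y⁻¹ : bigG))
    (hsi : IsSymmDenominator N (symmDegree i) (elementaryDivisor i * y⁻¹ : bigG)) :
    y ∈ SigmaStar N := by
  have hN0 := hN.ne_zero
  rw [Subgroup.coe_mul] at hj hsj
  rw [Subgroup.coe_mul, Subgroup.coe_inv] at hi hsi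
  obtain ⟨u, hu, htri⟩ := exists_mul_isLowerTriangular hN y.2
  have hleft : u * y * elementaryDivisor j ∈ extendedDoubleCoset N (y * elementaryDivisor j) := by
    rw [mul_assoc]
    exact mem_mul_extendedDoubleCoset hu _
  have hright : (elementaryDivisor i : Sp2) * (u * y)⁻¹ ∈
      extendedDoubleCoset N (elementaryDivisor i * (y : Sp2)⁻¹) := by
    rw [_root_.mul_inv_rev, ← mul_assoc]
    exact mul_mem_extendedDoubleCoset _ (inv_mem hu)
  rw [Subgroup.mem_subgroupOf, ← (extendedParamodular N).mul_mem_cancel_left hu]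
  exact htri.mem_extendedParamodular_of_isDenominator hN0 (hj.of_mem_extendedDoubleCoset hN0 hleft)
    (hsj.of_mem_extendedDoubleCoset hN0 hleft) (hi.of_mem_extendedDoubleCoset hN0 hright)
    (hsi.of_mem_extendedDoubleCoset hN0 hright)

/-- The double coset of `elementaryDivisor i` is the leading term of `T`: it occurs with
coefficient `1`, and all double cosets occurring in `T` have denominators dividing those of
`elementaryDivisor i`. -/
structure IsLeading (T : HeckeAlg N) (i : ℕ+ × ℕ+) : Prop where
  coeff_self : Hecke.coeff (elementaryDivisor i) T = 1
  isDenominator : ∀ g, Hecke.coeff g T ≠ 0 → IsDenominator N (degree i) (g : Sp2)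
  isSymmDenominator : ∀ g, Hecke.coeff g T ≠ 0 → IsSymmDenominator N (symmDegree i) (g : Sp2)

namespace IsLeading

theorem one (hN : N ≠ 0) : IsLeading (1 : HeckeAlg N) 1 := by
  classical
  have isDenominator_one (g : bigG) (hg : Hecke.coeff g (1 : HeckeAlg N) ≠ 0) :
      IsDenominator N 1 (g : Sp2) := by
    rw [Hecke.coeff_one] at hg
    exact isDenominator_one_of_mem hN (Subgroup.mem_subgroupOf.1 (ite_ne_right_iff.1 hg).1)
  refine ⟨?_, fun g hg => by simpa [degree] using isDenominator_one g hg,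
    fun g hg => by simpa [symmDegree] using (isDenominator_one g hg).isSymmDenominator⟩
  rw [elementaryDivisor_one, Hecke.coeff_one, if_pos (one_mem _)]

theorem mul (hN : Squarefree N) {T S : HeckeAlg N} {i j : ℕ+ × ℕ+}
    (hT : IsLeading T i) (hS : IsLeading S j) : IsLeading (T * S) (i * j) where
  coeff_self := by
    rw [Hecke.coeff_mul_of_unique_factorization T S _ (elementaryDivisor j), hS.coeff_self,
      elementaryDivisor_mul, mul_inv_cancel_right, hT.coeff_self, one_mul]
    intro h hh hk
    obtain ⟨y, rfl⟩ : ∃ y, h = y * elementaryDivisor j :=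
      ⟨_, (inv_mul_cancel_right h (elementaryDivisor j)).symm⟩
    rw [elementaryDivisor_mul, _root_.mul_inv_rev, mul_assoc, mul_inv_cancel_left] at hk
    rw [mul_inv_cancel_right]
    exact mem_sigmaStar_of_isDenominator_mul hN (hS.isDenominator _ hh)
      (hS.isSymmDenominator _ hh) (hT.isDenominator _ hk) (hT.isSymmDenominator _ hk)
  isDenominator k hk := by
    obtain ⟨h, hh, hkh⟩ := Hecke.exists_coeff_ne_zero_of_coeff_mul_ne_zero hk
    rw [degree_mul]
    simpa using (hT.isDenominator _ hkh).mul (hS.isDenominator _ hh)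
  isSymmDenominator k hk := by
    obtain ⟨h, hh, hkh⟩ := Hecke.exists_coeff_ne_zero_of_coeff_mul_ne_zero hk
    rw [symmDegree_mul]
    simpa using (hT.isSymmDenominator _ hkh).mul (hS.isSymmDenominator _ hh)

theorem doubleCoset (hN : Squarefree N) (i : ℕ+ × ℕ+) :
    IsLeading (Hecke.doubleCoset (SigmaStar N) (elementaryDivisor i)) i where
  coeff_self := by
    classical
    rw [coeff_doubleCoset hN, if_pos (DoubleCoset.mem_doubleCoset_self _ _ _)]
  isDenominator _ hg := (isDenominator_elementaryDivisor i).of_mem_extendedDoubleCoset hN.ne_zero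
    (mem_extendedDoubleCoset_of_coeff_doubleCoset_ne_zero hN hg)
  isSymmDenominator _ hg :=
    (isSymmDenominator_elementaryDivisor i).of_mem_extendedDoubleCoset hN.ne_zero
      (mem_extendedDoubleCoset_of_coeff_doubleCoset_ne_zero hN hg)

theorem degree_dvd (hN : N ≠ 0) {i j : ℕ+ × ℕ+} {T : HeckeAlg N} (hT : IsLeading T i)
    (h : Hecke.coeff (elementaryDivisor j) T ≠ 0) :
    degree j ∣ degree i ∧ symmDegree j ∣ symmDegree i :=
  ⟨degree_dvd_of_isDenominator (hT.isDenominator _ h),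
    symmDegree_dvd_of_isSymmDenominator hN (hT.isSymmDenominator _ h)⟩

theorem pow [hN : Fact (Squarefree N)] {T : HeckeAlg N} {i : ℕ+ × ℕ+} (hT : IsLeading T i) (n : ℕ) :
    IsLeading (T ^ n) (i ^ n) := by
  induction n with
  | zero => simpa using one hN.out.ne_zero
  | succ n ih => simpa only [pow_succ] using ih.mul hN.out hT

theorem prod [hN : Fact (Squarefree N)] {ι : Type*} (s : Finset ι) {T : ι → HeckeAlg N}
    {i : ι → ℕ+ × ℕ+} (hT : ∀ x ∈ s, IsLeading (T x) (i x)) :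
    IsLeading (∏ x ∈ s, T x) (∏ x ∈ s, i x) := by
  classical
  induction s using Finset.induction with
  | empty => simpa using one hN.out.ne_zero
  | insert x s hx ih =>
    rw [Finset.prod_insert hx, Finset.prod_insert hx]
    exact (hT x (s.mem_insert_self x)).mul hN.out
      (ih fun z hz => hT z (Finset.mem_insert_of_mem hz))

end IsLeading

theorem coset_elementaryDivisor_injective (hN : Squarefree N) :
    Function.Injective fun i => Hecke.coset (SigmaStar N) (elementaryDivisor i) := by
  have degree_dvd (i j) (hij : Hecke.coset (SigmaStar N) (elementaryDivisor i) =
      Hecke.coset (SigmaStar N) (elementaryDivisor j)) :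
      degree j ∣ degree i ∧ symmDegree j ∣ symmDegree i := by
    refine (IsLeading.doubleCoset hN i).degree_dvd hN.ne_zero ?_
    rw [Hecke.coeff_apply, ← hij, ← Hecke.coeff_apply, (IsLeading.doubleCoset hN i).coeff_self]
    exact one_ne_zero
  intro i j hij
  obtain ⟨hji, hji'⟩ := degree_dvd i j hij
  obtain ⟨hle, hle'⟩ := degree_dvd j i hij.symm
  exact eq_of_degree_eq (Nat.dvd_antisymm hle hji) (Nat.dvd_antisymm hle' hji')

theorem eq_zero_of_coeff_elementaryDivisor (hN : Squarefree N) {T : HeckeAlg N}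
    (h : ∀ i, Hecke.coeff (elementaryDivisor i) T = 0) : T = 0 := by
  refine Hecke.ext_coeff fun g => ?_
  obtain ⟨i, hi⟩ := exists_elementaryDivisor hN g.2
  rw [← coeff_eq_of_mem_extendedDoubleCoset hN.ne_zero T hi, h, map_zero]

/-! ### Monomials in the generators -/

/-- The generators `T1 N p` and `T2 N p` of the Hecke algebra as one family. -/
def generator (N : ℕ) (x : Nat.Primes × Fin 2) : HeckeAlg N := ![T1 N x.1, T2 N x.1] x.2

/-- The index of the elementary divisor matrix in the double coset `generator N x`. -/
def generatorIndex (x : Nat.Primes × Fin 2) : ℕ+ × ℕ+ := ![((x.1 : ℕ+), 1), (1, (x.1 : ℕ+))] x.2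

theorem generator_eq_doubleCoset (x : Nat.Primes × Fin 2) :
    generator N x = Hecke.doubleCoset (SigmaStar N) (elementaryDivisor (generatorIndex x)) := by
  obtain ⟨p, c⟩ := x
  fin_cases c <;>
    simp [generator, generatorIndex, T1, T2, elementaryDivisor, Nat.Primes.coe_pnat_nat]

/-- The index of the leading double coset of the monomial with exponents `e` in the generators. -/
def monomialIndex (e : Nat.Primes × Fin 2 →₀ ℕ) : ℕ+ × ℕ+ := e.prod fun x n => generatorIndex x ^ n

theorem monomialIndex_zero : monomialIndex 0 = 1 := Finsupp.prod_zero_index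

theorem monomialIndex_add (e e' : Nat.Primes × Fin 2 →₀ ℕ) :
    monomialIndex (e + e') = monomialIndex e * monomialIndex e' :=
  Finsupp.prod_add_index' (fun _ => pow_zero _) fun _ _ _ => pow_add _ _ _

theorem monomialIndex_single (x : Nat.Primes × Fin 2) (n : ℕ) :
    monomialIndex (Finsupp.single x n) = generatorIndex x ^ n :=
  Finsupp.prod_single_index (pow_zero _)

theorem factorization_monomialIndex (e : Nat.Primes × Fin 2 →₀ ℕ) (p : Nat.Primes) :
    ((monomialIndex e).1 : ℕ).factorization p = e (p, 0) ∧
      ((monomialIndex e).2 : ℕ).factorization p = e (p, 1) := by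
  have factorization_coe (q : Nat.Primes) :
      (q : ℕ).factorization p = if q = p then 1 else 0 := by
    simp [q.2.factorization, Finsupp.single_apply, Nat.Primes.coe_nat_inj]
  induction e using Finsupp.induction_linear with
  | zero => simp [monomialIndex_zero]
  | add e e' h h' => simp [monomialIndex_add, Nat.factorization_mul, h, h']
  | single x n =>
    obtain ⟨q, c⟩ := x
    rw [monomialIndex_single]
    fin_cases c <;>
      simp [generatorIndex, factorization_coe, Finsupp.single_apply, Nat.Primes.coe_pnat_nat]

theorem monomialIndex_injective : Function.Injective monomialIndex := by
  intro e e' h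
  ext ⟨p, c⟩
  have he := factorization_monomialIndex e p
  rw [h] at he
  have he' := factorization_monomialIndex e' p
  fin_cases c
  · exact he.1.symm.trans he'.1
  · exact he.2.symm.trans he'.2

theorem monomialIndex_surjective : Function.Surjective monomialIndex := by
  suffices h : ∀ n : ℕ+, (∃ e, monomialIndex e = (n, 1)) ∧ ∃ e, monomialIndex e = (1, n) by
    rintro ⟨s, k⟩
    obtain ⟨⟨e, he⟩, -⟩ := h s
    obtain ⟨-, e', he'⟩ := h k
    exact ⟨e + e', by simp [monomialIndex_add, he, he']⟩
  rintro ⟨n, hn⟩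
  induction n using Nat.recOnMul with
  | zero => exact absurd hn (lt_irrefl 0)
  | one => exact ⟨⟨0, monomialIndex_zero⟩, 0, monomialIndex_zero⟩
  | prime p hp =>
    exact ⟨⟨.single (⟨p, hp⟩, 0) 1, by rw [monomialIndex_single, pow_one]; rfl⟩,
      .single (⟨p, hp⟩, 1) 1, by rw [monomialIndex_single, pow_one]; rfl⟩
  | mul a b iha ihb =>
    obtain ⟨⟨e, he⟩, f, hf⟩ := iha (Nat.pos_of_mul_pos_right hn)
    obtain ⟨⟨e', he'⟩, f', hf'⟩ := ihb (Nat.pos_of_mul_pos_left hn)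
    exact ⟨⟨e + e', by rw [monomialIndex_add, he, he']; rfl⟩,
      f + f', by rw [monomialIndex_add, hf, hf']; rfl⟩

theorem fst_eq_of_degree_monomialIndex_dvd {p : Nat.Primes} {r : ℕ} {e : Nat.Primes × Fin 2 →₀ ℕ}
    (h : degree (monomialIndex e) ∣ (p : ℕ) ^ r) {x : Nat.Primes × Fin 2} (hx : e x ≠ 0) :
    x.1 = p := by
  obtain ⟨q, c⟩ := x
  have hfactor := factorization_monomialIndex e q
  have hq : (q : ℕ) ∣ degree (monomialIndex e) := by
    fin_cases c
    · exact (Nat.dvd_of_factorization_pos (hfactor.1 ▸ hx)).mul_right _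
    · exact ((Nat.dvd_of_factorization_pos (hfactor.2 ▸ hx)).pow two_ne_zero).mul_left _
  exact Subtype.ext ((Nat.prime_dvd_prime_iff_eq q.2 p.2).1 (q.2.dvd_of_dvd_pow (hq.trans h)))

theorem diagElement_mem_primaryGroup {p : Nat.Primes} {m r : ℕ} (hm : 0 < m)
    (hmr : m = (p : ℕ) ^ r) {a d : Fin 2 → ℤ} (h : ∀ i, a i * d i = m) :
    diagElement m hm a d h ∈ primaryGroup N p := by
  refine (le_sup_right : _ ≤ primaryGroup N p) (Subgroup.subset_closure
    ⟨r, a 0, 0, 0, a 1, 0, 0, 0, 0, 0, 0, 0, 0, d 0, 0, 0, d 1, ?_⟩)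
  have hs : √(m : ℝ) ≠ 0 := Real.sqrt_ne_zero'.2 (Nat.cast_pos.2 hm)
  rw [← hmr, diagElement, smul_smul, mul_one_div_cancel hs, one_smul]
  ext (i | i) (j | j) <;> fin_cases i <;> fin_cases j <;> simp

section HeckeAlgebra

variable [hN : Fact (Squarefree N)]

theorem isLeading_monomial (e : Nat.Primes × Fin 2 →₀ ℕ) :
    IsLeading (e.prod fun x n => generator N x ^ n) (monomialIndex e) :=
  IsLeading.prod _ fun x _ => IsLeading.pow
    (generator_eq_doubleCoset (N := N) x ▸ IsLeading.doubleCoset hN.out (generatorIndex x)) _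

theorem isUnitriangular_monomial : IsUnitriangular
    (fun e => (Hecke.coeff (elementaryDivisor (monomialIndex e))).toIntLinearMap)
    (fun e : Nat.Primes × Fin 2 →₀ ℕ => e.prod fun x n => generator N x ^ n)
    (fun e => degree (monomialIndex e) * symmDegree (monomialIndex e)) where
  diag e := (isLeading_monomial e).coeff_self
  lt e e' h hne := by
    obtain ⟨hdvd, hdvd'⟩ := (isLeading_monomial e).degree_dvd hN.out.ne_zero h
    have hle := Nat.le_of_dvd (degree_pos _) hdvd
    have hle' := Nat.le_of_dvd (symmDegree_pos _) hdvd'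
    refine (Nat.mul_le_mul hle hle').lt_of_ne fun heq => hne ?_
    obtain ⟨hd, hs⟩ := (mul_eq_mul_iff_eq_and_eq_of_pos' hle hle' (degree_pos _)
      (symmDegree_pos _)).1 heq
    exact monomialIndex_injective (eq_of_degree_eq hd hs)

theorem mem_span_monomial_of_coeff {P : Set (Nat.Primes × Fin 2 →₀ ℕ)}
    (hP : ∀ e ∈ P, ∀ e', degree (monomialIndex e') ∣ degree (monomialIndex e) → e' ∈ P)
    {T : HeckeAlg N}
    (hT : ∀ e, Hecke.coeff (elementaryDivisor (monomialIndex e)) T ≠ 0 → e ∈ P) :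
    T ∈ Submodule.span ℤ ((fun e => e.prod fun x n => generator N x ^ n) '' P) := by
  refine isUnitriangular_monomial.mem_span_image (fun S => ?_) (fun S hS => ?_)
    (fun e he e' h => hP e he e' ((isLeading_monomial e).degree_dvd hN.out.ne_zero h).1) hT
  · exact Hecke.finite_coeff_ne_zero S (fun e => elementaryDivisor (monomialIndex e))
      ((coset_elementaryDivisor_injective hN.out).comp monomialIndex_injective)
  · refine eq_zero_of_coeff_elementaryDivisor hN.out fun i => ?_
    obtain ⟨e, rfl⟩ := monomialIndex_surjective i
    exact hS e

theorem algebraicIndependent_generator : AlgebraicIndependent ℤ (generator N) :=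
  algebraicIndependent_of_linearIndependent_monomials _ isUnitriangular_monomial.linearIndependent

theorem span_monomial_le_adjoin {P : Set (Nat.Primes × Fin 2 →₀ ℕ)} {s : Set (Nat.Primes × Fin 2)}
    (hP : ∀ e ∈ P, ∀ x, e x ≠ 0 → x ∈ s) :
    Submodule.span ℤ ((fun e => e.prod fun x n => generator N x ^ n) '' P) ≤
      Subalgebra.toSubmodule (Algebra.adjoin ℤ (generator N '' s)) := by
  rw [Submodule.span_le]
  rintro _ ⟨e, he, rfl⟩
  exact Subalgebra.prod_mem _ fun x hx => Subalgebra.pow_mem _ (Algebra.subset_adjoin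
    (Set.mem_image_of_mem _ (hP e he x (Finsupp.mem_support_iff.1 hx)))) _

theorem adjoin_generator : Algebra.adjoin ℤ (Set.range (generator N)) = ⊤ := by
  rw [← Set.image_univ, eq_top_iff]
  exact fun T _ => span_monomial_le_adjoin (P := Set.univ) (fun _ _ x _ => Set.mem_univ x)
    (mem_span_monomial_of_coeff (fun _ _ e' _ => Set.mem_univ e') fun e _ => Set.mem_univ e)

theorem noZeroDivisors : NoZeroDivisors (HeckeAlg N) := by
  have hbij : Function.Bijective
      (MvPolynomial.aeval (generator N) : MvPolynomial _ ℤ →ₐ[ℤ] HeckeAlg N) := by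
    refine ⟨algebraicIndependent_generator, AlgHom.range_eq_top _ |>.1 ?_⟩
    rw [← Algebra.adjoin_range_eq_range_aeval, adjoin_generator]
  exact (RingEquiv.ofBijective _ hbij).symm.injective.noZeroDivisors _ (map_zero _) (map_mul _)

theorem exists_isDenominator_of_mem_primaryGroup {p : Nat.Primes} {g : bigG}
    (hg : g ∈ primaryGroup N p) : ∃ r, IsDenominator N ((p : ℕ) ^ r) (g : Sp2) := by
  have hN0 := hN.out.ne_zero
  rw [primaryGroup, ← Subgroup.closure_eq (SigmaStar N), ← Subgroup.closure_union] at hg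
  induction hg using Subgroup.closure_induction with
  | mem u hu =>
    obtain hu | ⟨r, hr⟩ := hu
    · exact ⟨0, by simpa using isDenominator_one_of_mem hN0 (Subgroup.mem_subgroupOf.1 hu)⟩
    · exact ⟨r, isDenominator_of_inOrder_sqrt_smul hN0 ((hasParamodularForm_iff hN0).1 hr)⟩
  | one => exact ⟨0, by simpa using isDenominator_one_of_mem hN0 (one_mem _)⟩
  | mul a b _ _ ha hb =>
    obtain ⟨r, hr⟩ := ha
    obtain ⟨s, hs⟩ := hb
    exact ⟨r + s, by simpa [pow_add] using hr.mul hs⟩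
  | inv a _ ha =>
    obtain ⟨r, hr⟩ := ha
    exact ⟨r, hr.of_mem_extendedDoubleCoset hN0 (inv_mem_extendedDoubleCoset hN.out a.2)⟩

theorem doubleCoset_mem_primaryComponent {p : Nat.Primes} {g : bigG} (hg : g ∈ primaryGroup N p) :
    Hecke.doubleCoset (SigmaStar N) g ∈ primaryComponent N p := by
  refine (Hecke.mem_heckeSubalgebra _ _).2 fun h hh => ?_
  obtain ⟨u, hu, v, hv, rfl⟩ := (exists_eq_mul_mul_iff_mem_extendedDoubleCoset hN.out.ne_zero).2
    (mem_extendedDoubleCoset_of_coeff_doubleCoset_ne_zero hN.out hh)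
  have hle : SigmaStar N ≤ primaryGroup N p := le_sup_left
  exact mul_mem (mul_mem (hle hu) hg) (hle hv)

theorem generator_mem_primaryComponent (x : Nat.Primes × Fin 2) :
    generator N x ∈ primaryComponent N x.1 := by
  obtain ⟨p, c⟩ := x
  fin_cases c
  · exact doubleCoset_mem_primaryComponent (diagElement_mem_primaryGroup _ (pow_one _).symm _)
  · exact doubleCoset_mem_primaryComponent (diagElement_mem_primaryGroup _ rfl _)

theorem primaryComponent_eq_adjoin (p : Nat.Primes) :
    primaryComponent N p = Algebra.adjoin ℤ (Set.range fun c => generator N (p, c)) := by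
  refine le_antisymm (fun T hT => ?_) (Algebra.adjoin_le ?_)
  · have hrange : (Set.range fun c => generator N (p, c)) = generator N '' {x | x.1 = p} := by
      ext T
      constructor
      · rintro ⟨c, rfl⟩
        exact ⟨(p, c), rfl, rfl⟩
      · rintro ⟨⟨_, c⟩, rfl, rfl⟩
        exact ⟨c, rfl⟩
    rw [hrange]
    refine span_monomial_le_adjoin (P := {e | ∃ r, degree (monomialIndex e) ∣ (p : ℕ) ^ r}) ?_
      (mem_span_monomial_of_coeff ?_ fun e he => ?_)
    · rintro e ⟨r, hr⟩ x hx
      exact fst_eq_of_degree_monomialIndex_dvd hr hx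
    · rintro e ⟨r, hr⟩ e' h
      exact ⟨r, h.trans hr⟩
    · obtain ⟨r, hr⟩ := exists_isDenominator_of_mem_primaryGroup
        ((Hecke.mem_heckeSubalgebra _ T).1 hT _ he)
      exact ⟨r, degree_dvd_of_isDenominator hr⟩
  · rintro _ ⟨c, rfl⟩
    exact generator_mem_primaryComponent (p, c)

theorem exists_primaryComponent_equiv (p : Nat.Primes) :
    ∃ φ : MvPolynomial (Fin 2) ℤ ≃ₐ[ℤ] primaryComponent N p,
      (φ (MvPolynomial.X 0) : HeckeAlg N) = T1 N p ∧
        (φ (MvPolynomial.X 1) : HeckeAlg N) = T2 N p := by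
  rw [primaryComponent_eq_adjoin p]
  have hindep := algebraicIndependent_slice (algebraicIndependent_generator (N := N)) p
  refine ⟨hindep.aevalEquiv, ?_, ?_⟩
  · exact (hindep.algebraMap_aevalEquiv _).trans (MvPolynomial.aeval_X _ _)
  · exact (hindep.algebraMap_aevalEquiv _).trans (MvPolynomial.aeval_X _ _)

theorem isInternalTensorProduct_primaryComponent :
    IsInternalTensorProduct fun p : Nat.Primes => primaryComponent N p := by
  simpa only [primaryComponent_eq_adjoin] using
    isInternalTensorProduct_adjoin_slices (algebraicIndependent_generator (N := N)) adjoin_generator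

end HeckeAlgebra

end Paramodular

end

theorem theorem4 (N : ℕ) (hN : Squarefree N) :
    Hecke.IsHeckePair (Paramodular.SigmaStar N) ∧
    (∀ S T : Paramodular.HeckeAlg N, S * T = T * S) ∧
    NoZeroDivisors (Paramodular.HeckeAlg N) ∧
    IsInternalTensorProduct (fun p : Nat.Primes => Paramodular.primaryComponent N p) ∧
    ∀ p : Nat.Primes,
      ∃ φ : MvPolynomial (Fin 2) ℤ ≃ₐ[ℤ] Paramodular.primaryComponent N p,
        (φ (MvPolynomial.X 0) : Paramodular.HeckeAlg N) = Paramodular.T1 N p ∧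
        (φ (MvPolynomial.X 1) : Paramodular.HeckeAlg N) = Paramodular.T2 N p := by
  have : Fact (Squarefree N) := ⟨hN⟩
  exact ⟨Paramodular.isHeckePair hN, fun S T => mul_comm S T, Paramodular.noZeroDivisors,
    Paramodular.isInternalTensorProduct_primaryComponent, Paramodular.exists_primaryComponent_equiv⟩
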